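/- There is a function $C:(0,\infty)^3\to(0,\infty)$ such that the following holds. Let $n\in\{2,3\}$, let $\Omega\subset\mathbb{R}^n$ be a bounded polygonal/polyhedral Lipschitz domain, let $\mathcal{T}_h$ be a conforming simplicial mesh of $\Omega$, and let $k\ge 0$. All functions are complex valued. Let $\mathbb{H}(\mathbf{div},\Omega)$ be the space of tensor fields $\tau\in L^2(\Omega)^{n\times n}$ whose row-wise distributional divergence $\mathbf{div}\,\tau$ lies in $L^2(\Omega)^n$, with norm $\|\tau\|_{\mathbf{div},\Omega}^2=\|\tau\|_{0,\Omega}^2+\|\mathbf{div}\,\tau\|_{0,\Omega}^2$. Let - $\mathbb{H}_h$ be either the Raviart–Thomas space $\mathbb{RT}_k$ of those $\tau\in\mathbb{H}(\mathbf{div},\Omega)$ each of whose rows is, on every cell $T$, of the form $p+q\,x$ with $p\in P_k(T)^n$, $q\in P_k(T)$, or the Brezzi–Douglas–Marini space $\mathbb{BDM}_{k+1}$ of those $\tau\in\mathbb{H}(\mathbf{div},\Omega)$ whose entries are in $P_{k+1}(T)$ on every cell $T$; - $\mathbb{H}_{0,h}=\{\tau\in\mathbb{H}_h:\int_\Omega\operatorname{tr}\tau=0\}$,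 and $\mathbf{Q}_h$ be the space of vector fields that are in $P_k(T)^n$ on every cell $T$. Write $A:B=\sum_{i,j}A_{ij}\overline{B_{ij}}$, $s\cdot r=\sum_i s_i\overline{r_i}$, $A^{\mathtt d}=A-\frac1n(\operatorname{tr}A)I$, $|||(\tau,v)|||^2=\|\tau\|_{\mathbf{div},\Omega}^2+\|v\|_{0,\Omega}^2$, and, for $\nu>0$, $$a(\sigma,\tau)=\frac1\nu\int_\Omega\sigma^{\mathtt d}:\tau^{\mathtt d},\quad b(\tau,v)=\int_\Omega\mathbf{div}\,\tau\cdot v,\quad B((\sigma,u);(\tau,v))=a(\sigma,\tau)+b(\tau,u)+b(\sigma,v).$$ (i) There is $c_1>0$ with $$c_1\|\tau\|_{\mathbf{div},\Omega}^2\le\|\tau^{\mathtt d}\|_{0,\Omega}^2+\|\mathbf{div}\,\tau\|_{0,\Omega}^2\qquad\text{for all }\tau\in\mathbb{H}_{0,h}.\tag{1}$$ (ii) There is $\widehat\gamma>0$ with $$\sup_{0\ne\tau\in\mathbb{H}_{0,h}}\frac{|b(\tau,q)|}{\|\tau\|_{\mathbf{div},\Omega}}\ge\widehat\gamma\,\|q\|_{0,\Omega}\qquad\text{for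 all }q\in\mathbf{Q}_h.\tag{2}$$ (iii) Let $\nu>0$, and let $c_1>0$ and $\widehat\gamma>0$ be any constants satisfying (1) and (2). (For instance, $c_1$ may be any constant for which the inequality in (1) holds for all $\tau\in\mathbb{H}(\mathbf{div},\Omega)$ with $\int_\Omega\operatorname{tr}\tau=0$.) Put $$C_J=\left(\min\left\{\frac{c_1}{2\nu},\frac{c_1\widehat\gamma^2\nu}{2}\right\}\right)^{-1}.$$ Then for each $(\sigma_h,u_h)\in\mathbb{H}_{0,h}\times\mathbf{Q}_h$ there is $(\tau_h,v_h)\in\mathbb{H}_{0,h}\times\mathbf{Q}_h$ such that $|||(\tau_h,v_h)|||\le C(c_1,\nu,\widehat\gamma)\,|||(\sigma_h,u_h)|||$, the number $B((\sigma_h,u_h);(\tau_h,v_h))$ is real, and $$|||(\sigma_h,u_h)|||^2\le C_J\,B((\sigma_h,u_h);(\tau_h,v_h)).$$ In particular $C$ and $C_J$ depend on the domain, the mesh, $k$ and the choice of $\mathbb{H}_h$ only through $c_1$, $\nu$, $\widehat\gamma$. -/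

import Mathlib

open MeasureTheory Set Topology
open scoped ContDiff NNReal ComplexConjugate

noncomputable section

namespace OseenFEM

/-- Points of `ℝⁿ`, with the Euclidean norm. -/
abbrev Pt (n : ℕ) := EuclideanSpace ℝ (Fin n)

/-- Vectors in `ℂⁿ`, with the Euclidean norm. -/
abbrev Vec (n : ℕ) := EuclideanSpace ℂ (Fin n)

/-- Tensors in `ℂ^{n×n}`; `A (i, j)` is the entry in row `i` and column `j`, and the norm is
the Frobenius norm. -/
abbrev Tens (n : ℕ) := EuclideanSpace ℂ (Fin n × Fin n)

/-- The space `Q = L²(Ω)ⁿ` of complex vector fields; its norm is `‖·‖_{0,Ω}`. -/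
abbrev L2V {n : ℕ} (Ω : Set (Pt n)) := Lp (Vec n) 2 (volume.restrict Ω)

/-- The space `L²(Ω)^{n×n}` of complex tensor fields; its norm is `‖·‖_{0,Ω}`. -/
abbrev L2T {n : ℕ} (Ω : Set (Pt n)) := Lp (Tens n) 2 (volume.restrict Ω)

/-! ### Tensor algebra -/

/-- The trace. -/
def tr {n : ℕ} (A : Tens n) : ℂ := ∑ i, A (i, i)

/-- The deviator `A - (1/n) (tr A) I`. -/
def dev {n : ℕ} (A : Tens n) : Tens n :=
  WithLp.toLp 2 fun p => A p - if p.1 = p.2 then (1 / (n : ℂ)) * tr A else 0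

/-- The product `A : B = ∑ A_ij conj(B_ij)`. -/
def ddot {n : ℕ} (A B : Tens n) : ℂ := ∑ i, ∑ j, A (i, j) * conj (B (i, j))

/-- The product `s · r = ∑ s_i conj(r_i)`. -/
def cdot {n : ℕ} (s r : Vec n) : ℂ := ∑ i, s i * conj (r i)

/-! ### The space `H(div, Ω)` -/

/-- `d` is the row-wise distributional divergence of `τ` in `Ω`:
`∫_Ω ∑_j τ_ij ∂_j φ = - ∫_Ω d_i φ` for all test functions `φ ∈ C_c^∞(Ω)` and all rows `i`. -/
def IsWeakDiv {n : ℕ} (Ω : Set (Pt n)) (τ : L2T Ω) (d : L2V Ω) : Prop :=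
  ∀ φ : Pt n → ℝ, ContDiff ℝ ∞ φ → HasCompactSupport φ → tsupport φ ⊆ Ω → ∀ i : Fin n,
    ∫ x in Ω, ∑ j, τ x (i, j) * ((fderiv ℝ φ x (EuclideanSpace.single j 1) : ℝ) : ℂ)
      = - ∫ x in Ω, d x i * ((φ x : ℝ) : ℂ)

/-- The space `H(div, Ω)` of square integrable tensor fields with square integrable
row-wise divergence. -/
def Hdiv {n : ℕ} (Ω : Set (Pt n)) : Set (L2T Ω) := {τ | ∃ d : L2V Ω, IsWeakDiv Ω τ d}

open Classical in
/-- The divergence of an element of `H(div, Ω)` (and `0` off that space). -/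
def wdiv {n : ℕ} {Ω : Set (Pt n)} (τ : L2T Ω) : L2V Ω :=
  if h : ∃ d : L2V Ω, IsWeakDiv Ω τ d then h.choose else 0

/-- The distributional divergence on an open set is unique. -/
theorem IsWeakDiv.unique {n : ℕ} {Ω : Set (Pt n)} (hΩ : IsOpen Ω) {τ : L2T Ω} {d d' : L2V Ω}
    (h : IsWeakDiv Ω τ d) (h' : IsWeakDiv Ω τ d') : d = d' := by
  have hloc : ∀ (d : L2V Ω) (i : Fin n), LocallyIntegrableOn (fun x => d x i) Ω := by
    intro d i
    have h1 : MemLp (fun x => d x i) 2 (volume.restrict Ω) :=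
      (EuclideanSpace.proj i : Vec n →L[ℂ] ℂ).comp_memLp' (Lp.memLp d)
    rw [locallyIntegrableOn_iff hΩ.isLocallyClosed]
    intro k hk hkc
    have h2 : MemLp (fun x => d x i) 2 (volume.restrict k) :=
      h1.mono_measure (Measure.restrict_mono hk le_rfl)
    have : IsFiniteMeasure (volume.restrict k) :=
      ⟨by rw [Measure.restrict_apply_univ]; exact hkc.measure_lt_top⟩
    exact h2.integrable (by norm_num)
  have key : ∀ i : Fin n, ∀ᵐ x ∂(volume : Measure (Pt n)), x ∈ Ω → d x i - d' x i = 0 := by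
    intro i
    refine hΩ.ae_eq_zero_of_integral_contDiff_smul_eq_zero
      (f := fun x => d x i - d' x i) ((hloc d i).sub (hloc d' i)) ?_
    intro g hg hgc hgs
    have hs : ∀ e : L2V Ω, Integrable (fun x => e x i * ((g x : ℝ) : ℂ)) := by
      intro e
      have h3 : IntegrableOn (fun x => e x i) (tsupport g) :=
        (hloc e i).integrableOn_compact_subset hgs hgc
      have h4 : IntegrableOn (fun x => e x i * ((g x : ℝ) : ℂ)) (tsupport g) :=
        h3.mul_continuousOn (Complex.continuous_ofReal.comp hg.continuous).continuousOn hgc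
      refine (integrableOn_iff_integrable_of_support_subset ?_).1 h4
      intro x hx
      apply subset_tsupport
      intro hx0
      apply hx
      simp [hx0]
    have hset : ∀ e : L2V Ω, ∫ x in Ω, e x i * ((g x : ℝ) : ℂ) = ∫ x, e x i * ((g x : ℝ) : ℂ) := by
      intro e
      refine setIntegral_eq_integral_of_forall_compl_eq_zero ?_
      intro x hx
      have : g x = 0 := image_eq_zero_of_notMem_tsupport (fun hx' => hx (hgs hx'))
      simp [this]
    have e1 := h g hg hgc hgs i
    have e2 := h' g hg hgc hgs i
    rw [e1, neg_inj, hset, hset] at e2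
    have : (fun x => g x • (d x i - d' x i))
        = fun x => d x i * ((g x : ℝ) : ℂ) - d' x i * ((g x : ℝ) : ℂ) := by
      funext x
      rw [Complex.real_smul]
      ring
    rw [this, integral_sub (hs d) (hs d'), e2, sub_self]
  apply Lp.ext
  have hall : ∀ᵐ x ∂(volume : Measure (Pt n)), ∀ i : Fin n, x ∈ Ω → d x i - d' x i = 0 :=
    ae_all_iff.2 key
  rw [Filter.EventuallyEq, ae_restrict_iff' hΩ.measurableSet]
  filter_upwards [hall] with x hx hxΩ
  ext i
  exact sub_eq_zero.1 (hx i hxΩ)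

/-- The norm `‖τ‖_{div,Ω} = (‖τ‖²_{0,Ω} + ‖div τ‖²_{0,Ω})^{1/2}`. -/
def divNorm {n : ℕ} {Ω : Set (Pt n)} (τ : L2T Ω) : ℝ := √(‖τ‖ ^ 2 + ‖wdiv τ‖ ^ 2)

/-- The product norm `|||(τ, v)||| = (‖τ‖²_{div,Ω} + ‖v‖²_{0,Ω})^{1/2}`. -/
def tripleNorm {n : ℕ} {Ω : Set (Pt n)} (τ : L2T Ω) (v : L2V Ω) : ℝ :=
  √(divNorm τ ^ 2 + ‖v‖ ^ 2)

/-! ### The forms -/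

/-- `a(ρ, τ) = (1/ν) ∫_Ω ρᵈ : τᵈ`. -/
def formA {n : ℕ} {Ω : Set (Pt n)} (ν : ℝ) (ρ τ : L2T Ω) : ℂ :=
  (1 / (ν : ℂ)) * ∫ x in Ω, ddot (dev (ρ x)) (dev (τ x))

/-- `b(τ, v) = ∫_Ω div τ · v`. -/
def formb {n : ℕ} {Ω : Set (Pt n)} (τ : L2T Ω) (v : L2V Ω) : ℂ :=
  ∫ x in Ω, cdot (wdiv τ x) (v x)

/-- `B((σ, u); (τ, v)) = a(σ, τ) + b(τ, u) + b(σ, v)`. -/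
def formB {n : ℕ} {Ω : Set (Pt n)} (ν : ℝ) (σ : L2T Ω) (u : L2V Ω) (τ : L2T Ω) (v : L2V Ω) : ℂ :=
  formA ν σ τ + formb τ u + formb σ v

/-! ### Domains and meshes -/

/-- Near each boundary point, `Ω` is the strict epigraph, in the direction of a unit vector `e`,
of a Lipschitz function of the coordinates orthogonal to `e`. -/
def HasLipschitzBoundary {n : ℕ} (Ω : Set (Pt n)) : Prop :=
  ∀ x ∈ frontier Ω, ∃ U ∈ 𝓝 x, ∃ e : Pt n, ‖e‖ = 1 ∧ ∃ (K : ℝ≥0) (g : Pt n → ℝ),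
    LipschitzWith K g ∧ (∀ (y : Pt n) (t : ℝ), g (y + t • e) = g y) ∧
      Ω ∩ U = {y | g y < inner ℝ e y} ∩ U

/-- A bounded Lipschitz domain. -/
structure IsLipschitzDomain {n : ℕ} (Ω : Set (Pt n)) : Prop where
  isOpen : IsOpen Ω
  isConnected : IsConnected Ω
  isBounded : Bornology.IsBounded Ω
  lipschitz : HasLipschitzBoundary Ω

/-- The closed simplex with vertex set `T`. -/
def cell {n : ℕ} (T : Finset (Pt n)) : Set (Pt n) := convexHull ℝ (T : Set (Pt n))

/-- `𝒯` (a finite collection of vertex sets) is a conforming simplicial mesh of `Ω`: its cells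
are nondegenerate `n`-simplices, they cover the closure of `Ω`, and any two of them meet in the
simplex spanned by their common vertices. A domain that has such a mesh is
polygonal (`n = 2`) or polyhedral (`n = 3`). -/
structure IsMesh {n : ℕ} (Ω : Set (Pt n)) (𝒯 : Finset (Finset (Pt n))) : Prop where
  card : ∀ T ∈ 𝒯, T.card = n + 1
  indep : ∀ T ∈ 𝒯, AffineIndependent ℝ (fun x : T => (x : Pt n))
  conforming : ∀ T ∈ 𝒯, ∀ T' ∈ 𝒯,
    cell T ∩ cell T' = convexHull ℝ ((T : Set (Pt n)) ∩ (T' : Set (Pt n)))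
  cover : ⋃ T ∈ 𝒯, cell T = closure Ω

/-! ### The finite element spaces -/

/-- The value at the point `x` of a polynomial in the coordinates. -/
def polyAt {n : ℕ} (p : MvPolynomial (Fin n) ℂ) (x : Pt n) : ℂ :=
  MvPolynomial.eval (fun j => ((x j : ℝ) : ℂ)) p

/-- `Q_h = P_k(𝒯)`: vector fields whose components are polynomials of degree at most `k` on
each cell. -/
def Qh {n : ℕ} (Ω : Set (Pt n)) (𝒯 : Finset (Finset (Pt n))) (k : ℕ) : Set (L2V Ω) :=
  {v | ∀ T ∈ 𝒯, ∀ i, ∃ p : MvPolynomial (Fin n) ℂ, p.totalDegree ≤ k ∧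
    ∀ᵐ x ∂(volume.restrict Ω), x ∈ cell T → v x i = polyAt p x}

/-- The Raviart–Thomas space: on each cell, each row of `τ` is of the form `p + q x` with
polynomials `p` (vectorial) and `q` (scalar) of degree at most `k`. -/
def RT {n : ℕ} (Ω : Set (Pt n)) (𝒯 : Finset (Finset (Pt n))) (k : ℕ) : Set (L2T Ω) :=
  {τ | τ ∈ Hdiv Ω ∧ ∀ T ∈ 𝒯, ∀ i, ∃ (p : Fin n → MvPolynomial (Fin n) ℂ)
    (q : MvPolynomial (Fin n) ℂ), (∀ j, (p j).totalDegree ≤ k) ∧ q.totalDegree ≤ k ∧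
      ∀ᵐ x ∂(volume.restrict Ω), x ∈ cell T →
        ∀ j, τ x (i, j) = polyAt (p j) x + polyAt q x * ((x j : ℝ) : ℂ)}

/-- The Brezzi–Douglas–Marini space: tensor fields in `H(div, Ω)` whose entries are polynomials
of degree at most `m` on each cell. -/
def BDM {n : ℕ} (Ω : Set (Pt n)) (𝒯 : Finset (Finset (Pt n))) (m : ℕ) : Set (L2T Ω) :=
  {τ | τ ∈ Hdiv Ω ∧ ∀ T ∈ 𝒯, ∀ i j, ∃ p : MvPolynomial (Fin n) ℂ, p.totalDegree ≤ m ∧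
    ∀ᵐ x ∂(volume.restrict Ω), x ∈ cell T → τ x (i, j) = polyAt p x}

/-- The two families of discretizations. -/
inductive Family
  | rt
  | bdm

/-- `H_h`: either `RT_k` or `BDM_{k+1}`. -/
def Hh {n : ℕ} (Ω : Set (Pt n)) (𝒯 : Finset (Finset (Pt n))) (k : ℕ) : Family → Set (L2T Ω)
  | .rt => RT Ω 𝒯 k
  | .bdm => BDM Ω 𝒯 (k + 1)

/-- `H_{0,h}`: the elements of `H_h` whose trace has mean value zero. -/
def H0h {n : ℕ} (Ω : Set (Pt n)) (𝒯 : Finset (Finset (Pt n))) (k : ℕ) (F : Family) :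
    Set (L2T Ω) :=
  {τ | τ ∈ Hh Ω 𝒯 k F ∧ ∫ x in Ω, tr (τ x) = 0}

/-! ### The constants -/

/-- `c₁ ‖τ‖²_{div,Ω} ≤ ‖τᵈ‖²_{0,Ω} + ‖div τ‖²_{0,Ω}` for all `τ` in the space `V`. -/
def DevDivBound {n : ℕ} {Ω : Set (Pt n)} (V : Set (L2T Ω)) (c₁ : ℝ) : Prop :=
  ∀ τ ∈ V, c₁ * divNorm τ ^ 2 ≤ (∫ x in Ω, ‖dev (τ x)‖ ^ 2) + ‖wdiv τ‖ ^ 2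

/-- The inf-sup condition `sup_{τ ∈ V} |b(τ, q)| / ‖τ‖_{div,Ω} ≥ γ ‖q‖_{0,Ω}` for all `q ∈ W`.
(The quotient is `0` at `τ = 0`, and all quotients are at most `‖q‖_{0,Ω}`.) -/
def InfSup {n : ℕ} {Ω : Set (Pt n)} (V : Set (L2T Ω)) (W : Set (L2V Ω)) (γ : ℝ) : Prop :=
  ∀ q ∈ W, γ * ‖q‖ ≤ ⨆ τ : V, ‖formb (τ : L2T Ω) q‖ / divNorm (τ : L2T Ω)

/-- The stability constant `1 / min {c₁/(2ν), c₁ γ² ν/2}`. -/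
def CJ (c₁ ν γ : ℝ) : ℝ := (min (c₁ / (2 * ν)) (c₁ * γ ^ 2 * ν / 2))⁻¹

end OseenFEM

end

noncomputable section

namespace OseenFEM

/-! ### Polynomial functions -/

section Polynomial

variable {n : ℕ}

/-! Bound (1) is finite-dimensional injectivity. A field in `H0h` with vanishing deviator is f I for
a scalar f; if its divergence vanishes too, f has zero weak gradient, so it is constant on the
connected set Ω, and the trace condition makes it zero (`eq_zero_of_dev_of_wdiv`). An injective
linear map on a finite-dimensional space is bounded below, which gives c₁.

Bound (2) is surjectivity of the divergence from `H0h` onto `Qh`, since a linear right inverse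
between finite-dimensional spaces is bounded. Surjectivity is proved by duality, without degrees of
freedom or interpolation: a q in `Qh` orthogonal to all divergences is zero
(`eq_zero_of_orthogonal`). One works with one row at a time. Bubbles λ_i p (x - b_i), which have no
normal trace on the boundary of their cell, force the gradient of q to vanish on each cell
(`fderiv_eq_zero_of_bubbles`). Fields x - a supported on two cells with a common face, scaled so
that their fluxes through it cancel, force equal constants on both sides (`const_eq_of_adjacent`).
Since a path in Ω can avoid the skeleton of codimension two, q is constant
(`locally_ae_const_of_adjacent`), and testing with the field x, whose divergence is n, shows that
the constant is 0. Restricting to mean trace zero costs nothing, because the identity tensor is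
divergence-free. Membership in H(div) is never expressed by boundary integrals: the condition used
is that the integrals of div(φ r) over the cells add up to zero for every test function φ.

For (iii), the test pair is τ = M (σ + θ ζ w), v = M (-u + ν⁻¹ div σ), where w nearly realizes the
inf-sup condition for u and is scaled so that b(w, u) is positive or zero. The terms in b(σ, u)
cancel, and the value of B is M times ν⁻¹ (‖σᵈ‖² + ‖div σ‖²) + θ (conj ζ a(σ, w) + ζ b(w, u)). A
unimodular ζ is needed because a is antilinear in its second argument while b is linear in its
first; it can be chosen so that the bracket is real and at least b(w, u) - 3 |a(σ, w)|. Young's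
inequality and (1) then give coercivity with the constant min {c₁/(2ν), γ²ν/72}. The prescribed C_J
is only a normalization: the bound on the test pair may depend on c₁, ν and γ, so the factor M
converts the constant obtained into the one demanded. -/

theorem totalDegree_pderiv_le (j : Fin n) (p : MvPolynomial (Fin n) ℂ) :
    (MvPolynomial.pderiv j p).totalDegree ≤ p.totalDegree - 1 := by
  conv_lhs => rw [p.as_sum, map_sum]
  refine (MvPolynomial.totalDegree_finsetSum _ _).trans (Finset.sup_le fun s hs => ?_)
  rw [MvPolynomial.pderiv_monomial]
  by_cases h : s j = 0
  · simp [h]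
  refine (MvPolynomial.totalDegree_monomial_le _ _).trans ?_
  have h1 : (s.sum fun _ e => e) ≤ p.totalDegree := MvPolynomial.le_totalDegree hs
  have h2 : s = (s - Finsupp.single j 1) + Finsupp.single j 1 := by
    ext i
    by_cases hi : i = j
    · subst hi; simp; omega
    · simp [hi]
  have h3 : (s.sum fun _ e => e)
      = ((s - Finsupp.single j 1).sum fun _ e => e) + 1 := by
    conv_lhs => rw [h2]
    rw [Finsupp.sum_add_index' (fun _ => rfl) (fun _ _ _ => rfl)]
    simp
  show ((s - Finsupp.single j 1).sum fun _ e => e) ≤ _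
  omega

theorem polyAt_add (p q : MvPolynomial (Fin n) ℂ) (x : Pt n) :
    polyAt (p + q) x = polyAt p x + polyAt q x := by simp [polyAt]

theorem polyAt_mul (p q : MvPolynomial (Fin n) ℂ) (x : Pt n) :
    polyAt (p * q) x = polyAt p x * polyAt q x := by simp [polyAt]

theorem polyAt_C (c : ℂ) (x : Pt n) : polyAt (MvPolynomial.C c) x = c := by simp [polyAt]

theorem polyAt_X (j : Fin n) (x : Pt n) : polyAt (MvPolynomial.X j) x = ((x j : ℝ) : ℂ) := by
  simp [polyAt]

/-- The `j`-th coordinate as a real linear map to `ℂ`. -/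
def coordC (j : Fin n) : Pt n →L[ℝ] ℂ := Complex.ofRealCLM ∘L EuclideanSpace.proj j

@[simp] theorem coordC_apply (j : Fin n) (x : Pt n) : coordC j x = ((x j : ℝ) : ℂ) := rfl

theorem contDiff_polyAt (p : MvPolynomial (Fin n) ℂ) : ContDiff ℝ ∞ (polyAt p) := by
  induction p using MvPolynomial.induction_on with
  | C a => simpa only [funext (polyAt_C a)] using contDiff_const
  | add p q hp hq =>
    have : polyAt (p + q) = fun x : Pt n => polyAt p x + polyAt q x := funext (polyAt_add p q)
    rw [this]; exact hp.add hq
  | mul_X p j hp =>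
    have : polyAt (p * MvPolynomial.X j) = fun x : Pt n => polyAt p x * coordC j x := by
      funext x; rw [polyAt_mul, polyAt_X, coordC_apply]
    rw [this]; exact hp.mul (coordC j).contDiff

theorem fderiv_polyAt (p : MvPolynomial (Fin n) ℂ) (x v : Pt n) :
    fderiv ℝ (polyAt p) x v = ∑ l, ((v l : ℝ) : ℂ) * polyAt (MvPolynomial.pderiv l p) x := by
  have hd : ∀ p : MvPolynomial (Fin n) ℂ, DifferentiableAt ℝ (polyAt p) x := fun p =>
    ((contDiff_polyAt p).differentiable (by simp)).differentiableAt
  induction p using MvPolynomial.induction_on with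
  | C a =>
    have : polyAt (MvPolynomial.C a) = fun _ : Pt n => a := funext (polyAt_C a)
    rw [this]; simp [polyAt]
  | add p q hp hq =>
    have : polyAt (p + q) = fun x : Pt n => polyAt p x + polyAt q x := funext (polyAt_add p q)
    rw [this, fderiv_fun_add (hd p) (hd q), _root_.add_apply, hp, hq,
      ← Finset.sum_add_distrib]
    simp [polyAt_add, mul_add]
  | mul_X p j hp =>
    have : polyAt (p * MvPolynomial.X j) = fun x : Pt n => polyAt p x * coordC j x := by
      funext x; rw [polyAt_mul, polyAt_X, coordC_apply]
    rw [this, fderiv_fun_mul (hd p) (coordC j).differentiableAt]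
    simp only [ContinuousLinearMap.fderiv, _root_.add_apply,
      _root_.smul_apply, hp, MvPolynomial.pderiv_mul, polyAt_add, polyAt_mul,
      polyAt_X, mul_add, Finset.sum_add_distrib, coordC_apply, smul_eq_mul, Finset.mul_sum]
    rw [add_comm]
    congr 1
    · exact Finset.sum_congr rfl fun l _ => by ring
    · rw [Finset.sum_eq_single j]
      · simp [polyAt]; ring
      · intro l _ hl
        simp [polyAt, MvPolynomial.pderiv_X_of_ne hl.symm]
      · simp

/-- `f` is a polynomial function of degree at most `k`. -/
def IsPoly (k : ℕ) (f : Pt n → ℂ) : Prop :=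
  ∃ p : MvPolynomial (Fin n) ℂ, p.totalDegree ≤ k ∧ ∀ x, f x = polyAt p x

namespace IsPoly

variable {k l : ℕ} {f g : Pt n → ℂ}

theorem mono (hf : IsPoly k f) (h : k ≤ l) : IsPoly l f :=
  let ⟨p, hp, e⟩ := hf; ⟨p, hp.trans h, e⟩

theorem const (c : ℂ) : IsPoly k (fun _ : Pt n => c) :=
  ⟨MvPolynomial.C c, by simp, fun x => (polyAt_C c x).symm⟩

theorem coord (j : Fin n) : IsPoly 1 (fun x : Pt n => ((x j : ℝ) : ℂ)) :=
  ⟨MvPolynomial.X j, by simp, fun x => (polyAt_X j x).symm⟩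

theorem add (hf : IsPoly k f) (hg : IsPoly k g) : IsPoly k (fun x => f x + g x) := by
  obtain ⟨p, hp, e⟩ := hf
  obtain ⟨q, hq, e'⟩ := hg
  exact ⟨p + q, (MvPolynomial.totalDegree_add _ _).trans (max_le hp hq),
    fun x => by simp only [polyAt_add, e, e']⟩

theorem mul (hf : IsPoly k f) (hg : IsPoly l g) : IsPoly (k + l) (fun x => f x * g x) := by
  obtain ⟨p, hp, e⟩ := hf
  obtain ⟨q, hq, e'⟩ := hg
  exact ⟨p * q, (MvPolynomial.totalDegree_mul _ _).trans (add_le_add hp hq),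
    fun x => by simp only [polyAt_mul, e, e']⟩

theorem const_mul (c : ℂ) (hf : IsPoly k f) : IsPoly k (fun x => c * f x) := by
  simpa using (const (k := 0) c).mul hf

theorem sum {ι : Type*} (s : Finset ι) {f : ι → Pt n → ℂ} (hf : ∀ i ∈ s, IsPoly k (f i)) :
    IsPoly k (fun x => ∑ i ∈ s, f i x) := by
  classical
  induction s using Finset.induction_on with
  | empty => simpa using const (k := k) (n := n) 0
  | insert a s ha ih =>
    simp only [Finset.sum_insert ha]
    exact (hf a (by simp)).add (ih fun i hi => hf i (by simp [hi]))

theorem linear (L : Pt n →L[ℝ] ℂ) : IsPoly 1 L := by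
  have : (L : Pt n → ℂ) = fun x => ∑ j, L (EuclideanSpace.single j 1) * ((x j : ℝ) : ℂ) := by
    funext x
    conv_lhs => rw [← (EuclideanSpace.basisFun (Fin n) ℝ).sum_repr x, map_sum]
    refine Finset.sum_congr rfl fun j _ => ?_
    simp [mul_comm]
  rw [this]
  exact sum _ fun j _ => (coord j).const_mul _

theorem contDiff (hf : IsPoly k f) : ContDiff ℝ ∞ f := by
  obtain ⟨p, -, e⟩ := hf
  rw [funext e]
  exact contDiff_polyAt p

theorem fderiv_apply (hf : IsPoly k f) (v : Pt n) :
    IsPoly (k - 1) (fun x => fderiv ℝ f x v) := by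
  obtain ⟨p, hp, e⟩ := hf
  rw [funext e]
  simp only [fun x => show fderiv ℝ (fun x => polyAt p x) x v = _ from fderiv_polyAt p x v]
  refine sum _ fun j _ => const_mul _ ⟨_, ?_, fun _ => rfl⟩
  exact (totalDegree_pderiv_le j p).trans (Nat.sub_le_sub_right hp 1)

end IsPoly

/-- The divergence of a field `r` at `x`. -/
def fdiv (r : Fin n → Pt n → ℂ) (x : Pt n) : ℂ :=
  ∑ j, fderiv ℝ (r j) x (EuclideanSpace.single j 1)

/-- `r` is of the form `p + q x` with polynomials `p`, `q` of degree at most `k`. -/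
def IsRT (k : ℕ) (r : Fin n → Pt n → ℂ) : Prop :=
  ∃ (p : Fin n → Pt n → ℂ) (q : Pt n → ℂ), (∀ j, IsPoly k (p j)) ∧ IsPoly k q ∧
    ∀ j x, r j x = p j x + q x * ((x j : ℝ) : ℂ)

namespace IsRT

variable {k : ℕ} {r : Fin n → Pt n → ℂ}

theorem isPoly (hr : IsRT k r) (j : Fin n) : IsPoly (k + 1) (r j) := by
  obtain ⟨p, q, hp, hq, e⟩ := hr
  rw [funext (e j)]
  exact ((hp j).mono k.le_succ).add (hq.mul (IsPoly.coord j))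

theorem zero : IsRT (n := n) k (fun _ _ => 0) :=
  ⟨fun _ _ => 0, fun _ => 0, fun _ => IsPoly.const 0, IsPoly.const 0, fun _ _ => by simp⟩

end IsRT

theorem isPoly_fdiv {k : ℕ} {r : Fin n → Pt n → ℂ} (hr : ∀ j, IsPoly (k + 1) (r j)) :
    IsPoly k (fdiv r) :=
  IsPoly.sum _ fun j _ => (hr j).fderiv_apply _

end Polynomial

/-! ### The divergence theorem on simplices -/

/-- The simplex of nonnegative vectors with coordinate sum at most one. -/
def cornerSimplex (m : ℕ) : Set (Fin m → ℝ) := {t | (∀ i, 0 ≤ t i) ∧ ∑ i, t i ≤ 1}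

theorem isClosed_cornerSimplex (m : ℕ) : IsClosed (cornerSimplex m) := by
  have : cornerSimplex m = (⋂ i, {t | 0 ≤ t i}) ∩ {t | ∑ i, t i ≤ 1} := by
    ext t; simp [cornerSimplex]
  rw [this]
  exact (isClosed_iInter fun i => isClosed_le continuous_const (continuous_apply i)).inter
    (isClosed_le (by fun_prop) continuous_const)

theorem isCompact_cornerSimplex (m : ℕ) : IsCompact (cornerSimplex m) := by
  refine (isCompact_univ_pi fun _ : Fin m => isCompact_Icc (a := (0 : ℝ)) (b := 1)).of_isClosed_subset
    (isClosed_cornerSimplex m) fun t ht i _ => ⟨ht.1 i, ?_⟩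
  exact (Finset.single_le_sum (f := t) (fun j _ => ht.1 j) (Finset.mem_univ i)).trans ht.2

theorem insertNth_mem_cornerSimplex {m : ℕ} (i : Fin (m + 1)) (a : ℝ) (s : Fin m → ℝ) :
    i.insertNth a s ∈ cornerSimplex (m + 1)
      ↔ s ∈ cornerSimplex m ∧ a ∈ Icc (0 : ℝ) (1 - ∑ j, s j) := by
  simp only [cornerSimplex, mem_ofPred_eq, mem_Icc, i.forall_iff_succAbove, i.sum_univ_succAbove,
    Fin.insertNth_apply_same, Fin.insertNth_apply_succAbove]
  constructor
  · rintro ⟨⟨h1, h2⟩, h3⟩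
    exact ⟨⟨h2, by linarith⟩, h1, by linarith⟩
  · rintro ⟨⟨h2, _⟩, h1, h3⟩
    exact ⟨⟨h1, h2⟩, by linarith⟩

theorem hasDerivAt_insertNth {m : ℕ} (i : Fin (m + 1)) {G : (Fin (m + 1) → ℝ) → ℂ}
    (hG : ContDiff ℝ 1 G) (s : Fin m → ℝ) (a : ℝ) :
    HasDerivAt (fun a => G (i.insertNth a s))
      (fderiv ℝ G (i.insertNth a s) (Pi.single i 1)) a := by
  have h1 : HasDerivAt (fun a : ℝ => (i.insertNth a s : Fin (m + 1) → ℝ)) (Pi.single i 1) a := by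
    rw [hasDerivAt_pi]
    intro j
    rcases Fin.eq_self_or_eq_succAbove i j with rfl | ⟨l, rfl⟩
    · simp only [Fin.insertNth_apply_same, Pi.single_eq_same]
      exact hasDerivAt_id' a
    · simpa using hasDerivAt_const a (s l)
  exact ((hG.differentiable (by simp)) _).hasFDerivAt.comp_hasDerivAt a h1

/-- Fubini in the i-th coordinate: a line in this direction over s meets the simplex in the interval
from 0 to 1 - ∑ s, and the fundamental theorem of calculus leaves the two endpoints. It is the
source of every boundary term on a simplex below. -/
theorem integral_cornerSimplex_fderiv {m : ℕ} (i : Fin (m + 1)) {G : (Fin (m + 1) → ℝ) → ℂ}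
    (hG : ContDiff ℝ 1 G) :
    ∫ t in cornerSimplex (m + 1), fderiv ℝ G t (Pi.single i 1)
      = ∫ s in cornerSimplex m, (G (i.insertNth (1 - ∑ j, s j) s) - G (i.insertNth 0 s)) := by
  set F : (Fin (m + 1) → ℝ) → ℂ := fun t => fderiv ℝ G t (Pi.single i 1) with hF
  have hFc : Continuous F := (hG.continuous_fderiv (by simp)).clm_apply continuous_const
  have hms := (isClosed_cornerSimplex (m + 1)).measurableSet
  have hms' := (isClosed_cornerSimplex m).measurableSet
  have hint : Integrable ((cornerSimplex (m + 1)).indicator F) :=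
    (integrable_indicator_iff hms).2
      (hFc.continuousOn.integrableOn_compact (isCompact_cornerSimplex _))
  have he := (volume_preserving_piFinSuccAbove (fun _ : Fin (m + 1) => ℝ) i).symm
  rw [← integral_indicator hms, ← he.integral_comp', ← integral_indicator hms']
  have hint' := (he.integrable_comp_emb (MeasurableEquiv.measurableEmbedding _)).2 hint
  rw [Measure.volume_eq_prod] at hint' ⊢
  refine (integral_prod_symm _ hint').trans ?_
  congr 1
  funext s
  have hsymm : ∀ a : ℝ, (MeasurableEquiv.piFinSuccAbove (fun _ : Fin (m + 1) => ℝ) i).symm (a, s)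
      = i.insertNth a s := fun a => rfl
  simp only [Function.comp_apply, hsymm]
  by_cases hs : s ∈ cornerSimplex m
  · rw [indicator_of_mem hs]
    have h0 : (0 : ℝ) ≤ 1 - ∑ j, s j := by linarith [hs.2]
    have : (fun a => (cornerSimplex (m + 1)).indicator F (i.insertNth a s))
        = (Icc (0 : ℝ) (1 - ∑ j, s j)).indicator (fun a => F (i.insertNth a s)) := by
      funext a
      by_cases ha : a ∈ Icc (0 : ℝ) (1 - ∑ j, s j)
      · rw [indicator_of_mem ha,
          indicator_of_mem ((insertNth_mem_cornerSimplex i a s).2 ⟨hs, ha⟩)]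
      · rw [indicator_of_notMem ha,
          indicator_of_notMem fun h => ha ((insertNth_mem_cornerSimplex i a s).1 h).2]
    rw [this, integral_indicator measurableSet_Icc, integral_Icc_eq_integral_Ioc,
      ← intervalIntegral.integral_of_le h0]
    refine intervalIntegral.integral_eq_sub_of_hasDerivAt
      (fun a _ => hasDerivAt_insertNth i hG s a) ?_
    apply Continuous.intervalIntegrable
    apply hFc.comp
    exact Continuous.finInsertNth i continuous_id continuous_const
  · rw [indicator_of_notMem hs]
    refine integral_eq_zero_of_ae (Filter.Eventually.of_forall fun a => ?_)
    exact indicator_of_notMem (fun h => hs ((insertNth_mem_cornerSimplex i a s).1 h).1) _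

/-! ### Affine charts of simplices and the change of variables -/

section Chart

variable {n : ℕ} (b : AffineBasis (Fin (n + 1)) ℝ (Pt n))

/-- The affine parametrization of a simplex that maps the origin to the vertex `b 0`. -/
def chart (t : Fin n → ℝ) : Pt n := b 0 + ∑ i, t i • (b i.succ - b 0)

theorem coord_chart (j : Fin (n + 1)) (t : Fin n → ℝ) :
    b.coord j (chart b t) = b.coord j (b 0)
      + ∑ i, t i * (b.coord j (b i.succ) - b.coord j (b 0)) := by
  have h : ∀ x y : Pt n, (b.coord j).linear (x - y) = b.coord j x - b.coord j y := fun x y => by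
    simpa using (b.coord j).linearMap_vsub x y
  have h2 := h (chart b t) (b 0)
  rw [chart, add_sub_cancel_left, map_sum] at h2
  simp only [map_smul, h, smul_eq_mul] at h2
  rw [chart]
  linarith

theorem coord_succ_chart (j : Fin n) (t : Fin n → ℝ) : b.coord j.succ (chart b t) = t j := by
  rw [coord_chart, b.coord_apply_ne (Fin.succ_ne_zero j)]
  rw [Finset.sum_eq_single j]
  · simp
  · intro i _ hi
    rw [b.coord_apply_ne (fun h => hi (Fin.succ_injective _ h).symm)]
    simp
  · simp

theorem coord_zero_chart (t : Fin n → ℝ) : b.coord 0 (chart b t) = 1 - ∑ i, t i := by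
  have := b.sum_coord_apply_eq_one (chart b t)
  rw [Fin.sum_univ_succ] at this
  simp only [coord_succ_chart] at this
  linarith

theorem chart_coord (x : Pt n) : chart b (fun i => b.coord i.succ x) = x := by
  refine b.ext_elem fun j => ?_
  refine Fin.cases ?_ (fun i => ?_) j
  · rw [coord_zero_chart]
    have := b.sum_coord_apply_eq_one x
    rw [Fin.sum_univ_succ] at this
    linarith
  · rw [coord_succ_chart]

theorem chart_injective : Function.Injective (chart b) := fun s t h => by
  funext i
  rw [← coord_succ_chart b i s, h, coord_succ_chart]

theorem chart_image : chart b '' cornerSimplex n = convexHull ℝ (range b) := by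
  rw [b.convexHull_eq_nonneg_coord]
  ext x
  constructor
  · rintro ⟨t, ht, rfl⟩ j
    refine Fin.cases ?_ (fun i => ?_) j
    · rw [coord_zero_chart]; linarith [ht.2]
    · rw [coord_succ_chart]; exact ht.1 i
  · intro hx
    refine ⟨fun i => b.coord i.succ x, ⟨fun i => hx _, ?_⟩, chart_coord b x⟩
    have := b.sum_coord_apply_eq_one x
    rw [Fin.sum_univ_succ] at this
    linarith [hx 0]

/-- The linear part of `chart`, on the Euclidean space. -/
def chartLin : Pt n →L[ℝ] Pt n :=
  ∑ i, (EuclideanSpace.proj i : Pt n →L[ℝ] ℝ).smulRight (b i.succ - b 0)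

theorem chartLin_apply (t : Pt n) : chartLin b t = chart b t - b 0 := by
  simp [chartLin, chart]

theorem det_chartLin_ne_zero : (chartLin b).det ≠ 0 := by
  have hinj : Function.Injective (chartLin b : Pt n →ₗ[ℝ] Pt n) := fun s t h => by
    have h' : chartLin b s = chartLin b t := h
    rw [chartLin_apply, chartLin_apply, sub_left_inj] at h'
    have := chart_injective b h'
    ext i
    exact congrFun this i
  have he : (LinearEquiv.ofInjectiveEndo _ hinj : Pt n →ₗ[ℝ] Pt n) = chartLin b :=
    LinearMap.ext fun _ => rfl
  have := (LinearEquiv.ofInjectiveEndo _ hinj).isUnit_det'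
  rw [he] at this
  exact this.ne_zero

theorem hasFDerivAt_chart (t : Pt n) :
    HasFDerivAt (fun t : Pt n => chart b t) (chartLin b) t := by
  have : (fun t : Pt n => chart b t) = fun t => chartLin b t + b 0 := by
    funext t; rw [chartLin_apply, sub_add_cancel]
  rw [this]
  exact (chartLin b).hasFDerivAt.add_const _

/-- The Jacobian formula needs a map from one space to itself, so the chart is first read on `Pt n`;
the passage to plain coordinate vectors preserves volume. -/
theorem setIntegral_simplex_eq (F : Pt n → ℂ) :
    ∫ x in convexHull ℝ (range b), F x
      = |(chartLin b).det| • ∫ t in cornerSimplex n, F (chart b t) := by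
  set s : Set (Pt n) := WithLp.ofLp ⁻¹' cornerSimplex n with hs
  have himg : (fun t : Pt n => chart b t) '' s = convexHull ℝ (range b) := by
    rw [← chart_image]
    ext x
    constructor
    · rintro ⟨t, ht, rfl⟩; exact ⟨t, ht, rfl⟩
    · rintro ⟨t, ht, rfl⟩; exact ⟨WithLp.toLp 2 t, ht, rfl⟩
  have hms : MeasurableSet s :=
    ((isClosed_cornerSimplex n).preimage (PiLp.continuous_ofLp 2 _)).measurableSet
  rw [← himg, integral_image_eq_integral_abs_det_fderiv_smul volume hms
    (fun t _ => (hasFDerivAt_chart b t).hasFDerivWithinAt)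
    (fun x _ y _ h => by ext i; exact congrFun (chart_injective b h) i), integral_smul]
  congr 1
  exact (PiLp.volume_preserving_ofLp (Fin n)).setIntegral_preimage_emb
    (MeasurableEquiv.toLp 2 (Fin n → ℝ)).symm.measurableEmbedding
    (fun t => F (chart b t)) _

end Chart

/-! ### Pointwise calculus of the divergence -/

section Divergence

variable {n : ℕ}

theorem fdiv_mul {r : Fin n → Pt n → ℂ} {φ : Pt n → ℂ} (hr : ∀ j, ContDiff ℝ 1 (r j))
    (hφ : ContDiff ℝ 1 φ) (x : Pt n) :
    fdiv (fun j x => r j x * φ x) x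
      = ∑ j, r j x * fderiv ℝ φ x (EuclideanSpace.single j 1) + fdiv r x * φ x := by
  rw [fdiv, fdiv, Finset.sum_mul, ← Finset.sum_add_distrib]
  refine Finset.sum_congr rfl fun j _ => ?_
  rw [fderiv_fun_mul ((hr j).differentiable (by simp) x) (hφ.differentiable (by simp) x)]
  simp [mul_comm]

theorem fdiv_sum_mul_const {ι : Type*} [Fintype ι] {g : ι → Pt n → ℂ} (w : ι → Pt n)
    (hg : ∀ i, ContDiff ℝ 1 (g i)) (x : Pt n) :
    fdiv (fun l x => ∑ i, g i x * ((w i l : ℝ) : ℂ)) x = ∑ i, fderiv ℝ (g i) x (w i) := by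
  have hd : ∀ i, DifferentiableAt ℝ (g i) x := fun i => (hg i).differentiable (by simp) x
  have h : ∀ l, fderiv ℝ (fun x => ∑ i, g i x * ((w i l : ℝ) : ℂ)) x
      (EuclideanSpace.single l 1)
        = ∑ i, w i l • fderiv ℝ (g i) x (EuclideanSpace.single l 1) := fun l => by
    rw [fderiv_fun_sum fun i _ => (hd i).mul_const _, _root_.sum_apply]
    refine Finset.sum_congr rfl fun i _ => ?_
    rw [fderiv_mul_const (hd i)]
    simp
  simp only [fdiv, h]
  rw [Finset.sum_comm]
  refine Finset.sum_congr rfl fun i _ => ?_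
  conv_rhs => rw [← (EuclideanSpace.basisFun (Fin n) ℝ).sum_repr (w i), map_sum]
  simp

theorem fdiv_id_sub (a x : Pt n) :
    fdiv (fun j (x : Pt n) => ((x j : ℝ) : ℂ) - ((a j : ℝ) : ℂ)) x = n := by
  have : ∀ j : Fin n, fderiv ℝ (fun x : Pt n => ((x j : ℝ) : ℂ) - ((a j : ℝ) : ℂ)) x
      = coordC j := fun j => ((coordC j).hasFDerivAt.sub_const _).fderiv
  simp [fdiv, this]

theorem contDiff_coordC_sub (a : Pt n) (j : Fin n) :
    ContDiff ℝ ∞ (fun x : Pt n => ((x j : ℝ) : ℂ) - ((a j : ℝ) : ℂ)) :=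
  (coordC j).contDiff.sub contDiff_const

theorem continuous_fdiv {r : Fin n → Pt n → ℂ} (hr : ∀ j, ContDiff ℝ 1 (r j)) :
    Continuous (fdiv r) :=
  continuous_finsetSum _ fun j _ =>
    ((hr j).continuous_fderiv (by simp)).clm_apply continuous_const

end Divergence

/-! ### Edge derivatives, bubbles and face fluxes on a simplex -/

section Simplex

variable {n : ℕ} (b : AffineBasis (Fin (n + 1)) ℝ (Pt n))

theorem hasFDerivAt_chart_pi (t : Fin n → ℝ) :
    HasFDerivAt (chart b) (∑ i, (ContinuousLinearMap.proj i : (Fin n → ℝ) →L[ℝ] ℝ).smulRight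
      (b i.succ - b 0)) t := by
  have : chart b = fun t => b 0 + (∑ i, (ContinuousLinearMap.proj i : (Fin n → ℝ) →L[ℝ] ℝ).smulRight
      (b i.succ - b 0)) t := by
    funext t; simp [chart]
  rw [this]
  exact (ContinuousLinearMap.hasFDerivAt _).const_add _

theorem contDiff_chart : ContDiff ℝ ∞ (chart b) :=
  contDiff_const.add (ContDiff.sum fun i _ => (contDiff_apply ℝ ℝ i).smul contDiff_const)

theorem fderiv_comp_chart {G : Pt n → ℂ} (hG : ContDiff ℝ 1 G) (t : Fin n → ℝ) (i : Fin n) :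
    fderiv ℝ (fun t => G (chart b t)) t (Pi.single i 1)
      = fderiv ℝ G (chart b t) (b i.succ - b 0) := by
  have h := ((hG.differentiable (by simp)) (chart b t)).hasFDerivAt.comp t (hasFDerivAt_chart_pi b t)
  have h' : fderiv ℝ (fun t => G (chart b t)) t = _ := h.fderiv
  rw [h']
  simp only [ContinuousLinearMap.comp_apply, _root_.sum_apply,
    ContinuousLinearMap.smulRight_apply, ContinuousLinearMap.proj_apply]
  rw [Finset.sum_eq_single i]
  · simp
  · intro j _ hj; simp [hj]
  · simp

theorem isCompact_simplex : IsCompact (convexHull ℝ (range b)) :=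
  (finite_range b).isCompact_convexHull ℝ

theorem isPoly_coord (i : Fin (n + 1)) : IsPoly 1 (fun x => ((b.coord i x : ℝ) : ℂ)) := by
  have h : ∀ x, ((b.coord i x : ℝ) : ℂ)
      = (Complex.ofRealCLM ∘L LinearMap.toContinuousLinearMap (b.coord i).linear) x
        + ((b.coord i 0 : ℝ) : ℂ) := fun x => by
    simp only [ContinuousLinearMap.comp_apply, Complex.ofRealCLM_apply,
      LinearMap.coe_toContinuousLinearMap', ← Complex.ofReal_add]
    exact congrArg _ (congrFun (AffineMap.decomp (b.coord i)) x)
  rw [funext h]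
  exact (IsPoly.linear _).add (IsPoly.const _)

theorem contDiff_coord (i : Fin (n + 1)) :
    ContDiff ℝ ∞ (fun x => ((b.coord i x : ℝ) : ℂ)) := (isPoly_coord b i).contDiff

/-- In the chart based at `b 0`, an edge from this vertex is a coordinate direction. The two
endpoints left by `integral_cornerSimplex_fderiv` lie on the faces opposite `b 0` and `b i.succ`,
where G vanishes. -/
theorem integral_simplex_edge_zero {m : ℕ} (b : AffineBasis (Fin (m + 1 + 1)) ℝ (Pt (m + 1)))
    (i : Fin (m + 1)) {G : Pt (m + 1) → ℂ} (hG : ContDiff ℝ 1 G)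
    (h0 : ∀ x, b.coord 0 x = 0 → G x = 0) (hi : ∀ x, b.coord i.succ x = 0 → G x = 0) :
    ∫ x in convexHull ℝ (range b), fderiv ℝ G x (b i.succ - b 0) = 0 := by
  rw [setIntegral_simplex_eq]
  simp only [← fderiv_comp_chart b hG]
  rw [integral_cornerSimplex_fderiv i (G := fun t => G (chart b t))
    (hG.comp ((contDiff_chart b).of_le (by exact_mod_cast le_top)))]
  rw [integral_eq_zero_of_ae, smul_zero]
  refine Filter.Eventually.of_forall fun s => ?_
  simp only [Pi.zero_apply]
  rw [h0 (chart b (i.insertNth (1 - ∑ j, s j) s)) ?_, hi (chart b (i.insertNth 0 s)) ?_, sub_zero]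
  · rw [coord_succ_chart]; simp
  · rw [coord_zero_chart, i.sum_univ_succAbove]; simp

/-- The integral over a simplex of the derivative, along an edge, of a function that vanishes on
the two faces not containing this edge. -/
theorem integral_simplex_edge {m : ℕ} (b : AffineBasis (Fin (m + 1 + 1)) ℝ (Pt (m + 1)))
    (i j : Fin (m + 1 + 1)) {G : Pt (m + 1) → ℂ} (hG : ContDiff ℝ 1 G)
    (hi : ∀ x, b.coord i x = 0 → G x = 0) (hj : ∀ x, b.coord j x = 0 → G x = 0) :
    ∫ x in convexHull ℝ (range b), fderiv ℝ G x (b j - b i) = 0 := by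
  by_cases hij : i = j
  · subst hij; simp
  -- Swapping the labels 0 and i makes `b i` the base vertex of the chart.
  have hne : Equiv.swap 0 i j ≠ 0 := fun h => hij (by
    have := congrArg (Equiv.swap 0 i) h
    rw [Equiv.swap_apply_self, Equiv.swap_apply_left] at this
    exact this.symm)
  obtain ⟨l, hl⟩ := Fin.exists_succ_eq.2 hne
  have hl' : Equiv.swap 0 i l.succ = j := by rw [hl, Equiv.swap_apply_self]
  have key := integral_simplex_edge_zero (b.reindex (Equiv.swap 0 i)) l hG
    (by intro x hx; apply hi; rwa [b.coord_reindex, Equiv.symm_swap, Equiv.swap_apply_left] at hx)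
    (by intro x hx; apply hj; rwa [b.coord_reindex, Equiv.symm_swap, hl'] at hx)
  rw [b.reindex_apply, b.reindex_apply, Equiv.symm_swap, hl', Equiv.swap_apply_left,
    b.coe_reindex, EquivLike.range_comp] at key
  exact key

/-- A field of the form `λ_i p (x - b i)`, where `λ_i` is a barycentric coordinate, has vanishing
normal trace on the boundary of the simplex. -/
theorem integral_simplex_bubble {m : ℕ} (b : AffineBasis (Fin (m + 1 + 1)) ℝ (Pt (m + 1)))
    (i : Fin (m + 1 + 1)) {p φ : Pt (m + 1) → ℂ} (hp : ContDiff ℝ 1 p) (hφ : ContDiff ℝ 1 φ) :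
    ∫ x in convexHull ℝ (range b), fdiv (fun l x =>
      ((b.coord i x : ℝ) : ℂ) * p x * (((x l : ℝ) : ℂ) - ((b i l : ℝ) : ℂ)) * φ x) x = 0 := by
  have hc : ∀ j, ContDiff ℝ 1 (fun x => ((b.coord j x : ℝ) : ℂ)) := fun j =>
    (contDiff_coord b j).of_le (by exact_mod_cast le_top)
  set g : Fin (m + 1 + 1) → Pt (m + 1) → ℂ := fun j x =>
    ((b.coord i x : ℝ) : ℂ) * ((b.coord j x : ℝ) : ℂ) * (p x * φ x) with hg
  have hgc : ∀ j, ContDiff ℝ 1 (g j) := fun j => ((hc i).mul (hc j)).mul (hp.mul hφ)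
  -- Since x - b_i = ∑ λ_j (b_j - b_i), the bubble is a sum of fields along edges with coefficients
  -- λ_i λ_j p. Each coefficient vanishes on the two faces missing its edge, so
  -- `integral_simplex_edge` applies termwise.
  have hx : ∀ (x : Pt (m + 1)) (l : Fin (m + 1)), ((x l : ℝ) : ℂ) - ((b i l : ℝ) : ℂ)
      = ∑ j, ((b.coord j x : ℝ) : ℂ) * (((b j - b i) l : ℝ) : ℂ) := fun x l => by
    have h1 : ∑ j, b.coord j x * (b j l - b i l) = x l - b i l := by
      have h2 := congrArg (fun v : Pt (m + 1) => v l) (b.linear_combination_coord_eq_self x)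
      simp only [PiLp.smul_apply, smul_eq_mul, WithLp.ofLp_sum, Finset.sum_apply] at h2
      simp only [mul_sub, Finset.sum_sub_distrib, ← Finset.sum_mul, b.sum_coord_apply_eq_one,
        one_mul]
      rw [← h2]
    rw [← Complex.ofReal_sub, ← h1]
    push_cast
    simp
  have : (fun (l : Fin (m + 1)) (x : Pt (m + 1)) =>
      ((b.coord i x : ℝ) : ℂ) * p x * (((x l : ℝ) : ℂ) - ((b i l : ℝ) : ℂ)) * φ x)
      = fun l x => ∑ j, g j x * (((b j - b i) l : ℝ) : ℂ) := by
    funext l x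
    rw [hx, Finset.mul_sum, Finset.sum_mul]
    exact Finset.sum_congr rfl fun j _ => by rw [hg]; ring
  rw [this]
  simp only [fdiv_sum_mul_const _ hgc]
  rw [integral_finsetSum]
  · refine Finset.sum_eq_zero fun j _ => integral_simplex_edge b i j (hgc j) ?_ ?_ <;>
      intro x hx <;> simp [hg, hx]
  · intro j _
    exact (((hgc j).continuous_fderiv (by simp)).clm_apply
      continuous_const).continuousOn.integrableOn_compact (isCompact_simplex b)

/-- A multiple of the flux of `x ↦ φ(x) (x - a)` through the simplex with vertices `y`; it does not
depend on the point `a`. -/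
def faceFlux {m : ℕ} (y : Fin (m + 1) → Pt (m + 1)) (φ : Pt (m + 1) → ℂ) : ℂ :=
  ∑ i : Fin (m + 1), ∫ s in cornerSimplex m, ((1 - ∑ j, s j : ℝ) : ℂ) *
    φ (∑ j, (i.insertNth (1 - ∑ j, s j) s : Fin (m + 1) → ℝ) j • y j)

/-- In the chart, x - b_0 becomes the position vector t, so the divergence is the sum of the ∂_i
(t_i φ). The faces t_i = 0 contribute nothing and only the face opposite `b 0` is left. Apart from
the determinant, the result depends only on the ordered vertices of that face, which is why fluxes
from two sides of a face can be matched. -/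
theorem integral_simplex_apex {m : ℕ} (b : AffineBasis (Fin (m + 1 + 1)) ℝ (Pt (m + 1)))
    {φ : Pt (m + 1) → ℂ} (hφ : ContDiff ℝ 1 φ) :
    ∫ x in convexHull ℝ (range b),
      fdiv (fun l x => (((x l : ℝ) : ℂ) - ((b 0 l : ℝ) : ℂ)) * φ x) x
      = |(chartLin b).det| • faceFlux (fun j => b j.succ) φ := by
  have hψ : ContDiff ℝ 1 (fun t => φ (chart b t)) :=
    hφ.comp ((contDiff_chart b).of_le (by exact_mod_cast le_top))
  have hcoord : ∀ i : Fin (m + 1), ContDiff ℝ 1 (fun t : Fin (m + 1) → ℝ => ((t i : ℝ) : ℂ)) :=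
    fun i => Complex.ofRealCLM.contDiff.comp (contDiff_apply ℝ ℝ i)
  have hGc : ∀ i : Fin (m + 1), ContDiff ℝ 1
      (fun t : Fin (m + 1) → ℝ => ((t i : ℝ) : ℂ) * φ (chart b t)) := fun i => (hcoord i).mul hψ
  have hpt : ∀ t, fdiv (fun l x => (((x l : ℝ) : ℂ) - ((b 0 l : ℝ) : ℂ)) * φ x) (chart b t)
      = ∑ i, fderiv ℝ (fun t : Fin (m + 1) → ℝ => ((t i : ℝ) : ℂ) * φ (chart b t)) t
          (Pi.single i 1) := fun t => by
    rw [fdiv_mul (fun j => (contDiff_coordC_sub (b 0) j).of_le (by exact_mod_cast le_top)) hφ,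
      fdiv_id_sub]
    have h1 : ∑ j, (((chart b t j : ℝ) : ℂ) - ((b 0 j : ℝ) : ℂ)) *
        fderiv ℝ φ (chart b t) (EuclideanSpace.single j 1)
        = fderiv ℝ φ (chart b t) (chart b t - b 0) := by
      conv_rhs => rw [← (EuclideanSpace.basisFun _ ℝ).sum_repr (chart b t - b 0), map_sum]
      simp
    have h2 : ∀ i, fderiv ℝ (fun t : Fin (m + 1) → ℝ => ((t i : ℝ) : ℂ) * φ (chart b t)) t
          (Pi.single i 1) = t i • fderiv ℝ φ (chart b t) (b i.succ - b 0) + φ (chart b t) :=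
      fun i => by
        have h3 : fderiv ℝ (fun t : Fin (m + 1) → ℝ => ((t i : ℝ) : ℂ)) t
            = Complex.ofRealCLM ∘L ContinuousLinearMap.proj i :=
          (Complex.ofRealCLM ∘L
            (ContinuousLinearMap.proj i : (Fin (m + 1) → ℝ) →L[ℝ] ℝ)).hasFDerivAt.fderiv
        rw [fderiv_fun_mul ((hcoord i).differentiable (by simp) t)
          (hψ.differentiable (by simp) t), h3]
        simp [fderiv_comp_chart b hφ]
    rw [h1]
    simp only [h2, Finset.sum_add_distrib]
    congr 1
    · rw [chart, add_sub_cancel_left, map_sum]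
      simp
    · simp
  rw [setIntegral_simplex_eq]
  simp only [hpt]
  rw [integral_finsetSum]
  · congr 1
    rw [faceFlux]
    refine Finset.sum_congr rfl fun i _ => ?_
    rw [integral_cornerSimplex_fderiv i (hGc i)]
    congr 1
    funext s
    have hsum : ∑ j, (i.insertNth (1 - ∑ j, s j) s : Fin (m + 1) → ℝ) j = 1 := by
      rw [i.sum_univ_succAbove]; simp
    have hch : chart b (i.insertNth (1 - ∑ j, s j) s)
        = ∑ j, (i.insertNth (1 - ∑ j, s j) s : Fin (m + 1) → ℝ) j • b j.succ := by
      rw [chart]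
      simp only [smul_sub, Finset.sum_sub_distrib, ← Finset.sum_smul, hsum, one_smul]
      abel
    rw [hch]
    simp
  · intro i _
    exact (((hGc i).continuous_fderiv (by simp)).clm_apply
      continuous_const).continuousOn.integrableOn_compact (isCompact_cornerSimplex _)

end Simplex

/-! ### Linearity of the weak divergence -/

section WeakDiv

variable {n : ℕ} {Ω : Set (Pt n)}

theorem memLp_coord {ι : Type*} [Fintype ι] {α : Type*} [MeasurableSpace α] {μ : Measure α}
    (f : Lp (EuclideanSpace ℂ ι) 2 μ) (i : ι) : MemLp (fun x => f x i) 2 μ :=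
  (EuclideanSpace.proj i : EuclideanSpace ℂ ι →L[ℂ] ℂ).comp_memLp' (Lp.memLp f)

theorem integrable_mul_of_hasCompactSupport {f g : Pt n → ℂ}
    (hf : MemLp f 2 (volume.restrict Ω)) (hg : Continuous g) (hgc : HasCompactSupport g) :
    Integrable (fun x => f x * g x) (volume.restrict Ω) :=
  have hg' : MemLp g 2 (volume.restrict Ω) := hg.memLp_of_hasCompactSupport hgc
  hf.integrable_mul hg'

theorem hasCompactSupport_ofReal {φ : Pt n → ℝ} (h : HasCompactSupport φ) :
    HasCompactSupport (fun x => ((φ x : ℝ) : ℂ)) :=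
  h.comp_left (g := fun t : ℝ => (t : ℂ)) (by simp)

theorem integrable_mul_fderiv (τ : L2T Ω) {φ : Pt n → ℝ} (hφ : ContDiff ℝ ∞ φ)
    (hφc : HasCompactSupport φ) (i j : Fin n) :
    Integrable (fun x => τ x (i, j) * ((fderiv ℝ φ x (EuclideanSpace.single j 1) : ℝ) : ℂ))
      (volume.restrict Ω) :=
  integrable_mul_of_hasCompactSupport (memLp_coord τ (i, j))
    (Complex.continuous_ofReal.comp
      ((hφ.continuous_fderiv (by simp)).clm_apply continuous_const))
    (hasCompactSupport_ofReal (hφc.fderiv_apply ℝ _))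

theorem integrable_mul_test (d : L2V Ω) {φ : Pt n → ℝ} (hφ : ContDiff ℝ ∞ φ)
    (hφc : HasCompactSupport φ) (i : Fin n) :
    Integrable (fun x => d x i * ((φ x : ℝ) : ℂ)) (volume.restrict Ω) :=
  integrable_mul_of_hasCompactSupport (memLp_coord d i)
    (Complex.continuous_ofReal.comp hφ.continuous) (hasCompactSupport_ofReal hφc)

theorem IsWeakDiv.add {σ τ : L2T Ω} {d e : L2V Ω} (h : IsWeakDiv Ω σ d) (h' : IsWeakDiv Ω τ e) :
    IsWeakDiv Ω (σ + τ) (d + e) := by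
  intro φ hφ hφc hφs i
  have h1 := h φ hφ hφc hφs i
  have h2 := h' φ hφ hφc hφs i
  have e1 : ∫ x in Ω, ∑ j, (σ + τ) x (i, j) *
      ((fderiv ℝ φ x (EuclideanSpace.single j 1) : ℝ) : ℂ)
      = ∫ x in Ω, (∑ j, σ x (i, j) * ((fderiv ℝ φ x (EuclideanSpace.single j 1) : ℝ) : ℂ)
        + ∑ j, τ x (i, j) * ((fderiv ℝ φ x (EuclideanSpace.single j 1) : ℝ) : ℂ)) := by
    refine integral_congr_ae ?_
    filter_upwards [Lp.coeFn_add σ τ] with x hx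
    rw [hx, ← Finset.sum_add_distrib]
    exact Finset.sum_congr rfl fun j _ => by simp [add_mul]
  have e2 : ∫ x in Ω, (d + e) x i * ((φ x : ℝ) : ℂ)
      = ∫ x in Ω, (d x i * ((φ x : ℝ) : ℂ) + e x i * ((φ x : ℝ) : ℂ)) := by
    refine integral_congr_ae ?_
    filter_upwards [Lp.coeFn_add d e] with x hx
    rw [hx]; simp [add_mul]
  rw [e1, e2, integral_add (integrable_finsetSum _ fun j _ => integrable_mul_fderiv σ hφ hφc i j)
    (integrable_finsetSum _ fun j _ => integrable_mul_fderiv τ hφ hφc i j),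
    integral_add (integrable_mul_test d hφ hφc i) (integrable_mul_test e hφ hφc i), h1, h2]
  ring

theorem IsWeakDiv.smul {σ : L2T Ω} {d : L2V Ω} (c : ℂ) (h : IsWeakDiv Ω σ d) :
    IsWeakDiv Ω (c • σ) (c • d) := by
  intro φ hφ hφc hφs i
  have e1 : ∫ x in Ω, ∑ j, (c • σ) x (i, j) *
      ((fderiv ℝ φ x (EuclideanSpace.single j 1) : ℝ) : ℂ)
      = ∫ x in Ω, c * ∑ j, σ x (i, j) *
        ((fderiv ℝ φ x (EuclideanSpace.single j 1) : ℝ) : ℂ) := by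
    refine integral_congr_ae ?_
    filter_upwards [Lp.coeFn_smul c σ] with x hx
    rw [hx, Finset.mul_sum]
    exact Finset.sum_congr rfl fun j _ => by simp [mul_assoc]
  have e2 : ∫ x in Ω, (c • d) x i * ((φ x : ℝ) : ℂ)
      = ∫ x in Ω, c * (d x i * ((φ x : ℝ) : ℂ)) := by
    refine integral_congr_ae ?_
    filter_upwards [Lp.coeFn_smul c d] with x hx
    rw [hx]; simp [mul_assoc]
  rw [e1, e2, integral_const_mul, integral_const_mul, h φ hφ hφc hφs i]
  ring

theorem IsWeakDiv.zero : IsWeakDiv Ω (0 : L2T Ω) 0 := by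
  intro φ hφ hφc hφs i
  have e1 : ∫ x in Ω, ∑ j, (0 : L2T Ω) x (i, j) *
      ((fderiv ℝ φ x (EuclideanSpace.single j 1) : ℝ) : ℂ) = 0 := by
    refine integral_eq_zero_of_ae ?_
    filter_upwards [Lp.coeFn_zero (Tens n) 2 (volume.restrict Ω)] with x hx
    simp only [hx]; simp
  have e2 : ∫ x in Ω, (0 : L2V Ω) x i * ((φ x : ℝ) : ℂ) = 0 := by
    refine integral_eq_zero_of_ae ?_
    filter_upwards [Lp.coeFn_zero (Vec n) 2 (volume.restrict Ω)] with x hx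
    simp only [hx]; simp
  rw [e1, e2, neg_zero]

theorem isWeakDiv_wdiv {τ : L2T Ω} (h : τ ∈ Hdiv Ω) : IsWeakDiv Ω τ (wdiv τ) := by
  have h' : ∃ d : L2V Ω, IsWeakDiv Ω τ d := h
  rw [wdiv, dif_pos h']
  exact h'.choose_spec

theorem IsWeakDiv.wdiv_eq (hΩ : IsOpen Ω) {τ : L2T Ω} {d : L2V Ω} (h : IsWeakDiv Ω τ d) :
    wdiv τ = d := (isWeakDiv_wdiv ⟨d, h⟩).unique hΩ h

/-- `H(div, Ω)` as a subspace. -/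
def hdivSubmodule (Ω : Set (Pt n)) : Submodule ℂ (L2T Ω) where
  carrier := Hdiv Ω
  zero_mem' := ⟨0, IsWeakDiv.zero⟩
  add_mem' := fun ⟨_, h⟩ ⟨_, h'⟩ => ⟨_, h.add h'⟩
  smul_mem' := fun c _ ⟨_, h⟩ => ⟨_, h.smul c⟩

/-- The weak divergence as a linear map. -/
def wdivLin (hΩ : IsOpen Ω) : hdivSubmodule Ω →ₗ[ℂ] L2V Ω where
  toFun τ := wdiv (τ : L2T Ω)
  map_add' σ τ := ((isWeakDiv_wdiv σ.2).add (isWeakDiv_wdiv τ.2)).wdiv_eq hΩ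
  map_smul' c σ := ((isWeakDiv_wdiv σ.2).smul c).wdiv_eq hΩ

end WeakDiv

/-! ### Tensor algebra -/

section Tensor

variable {n : ℕ}

/-- The trace as a continuous linear map. -/
def trL : Tens n →L[ℂ] ℂ := ∑ i, EuclideanSpace.proj (i, i)

theorem trL_apply (A : Tens n) : trL A = tr A := by simp [trL, tr]

/-- The deviator as a continuous linear map. -/
def devL : Tens n →L[ℂ] Tens n := LinearMap.toContinuousLinearMap
  { toFun := dev
    map_add' := fun A B => by
      ext p
      simp only [dev, PiLp.add_apply, ← trL_apply, map_add]
      split_ifs <;> ring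
    map_smul' := fun c A => by
      ext p
      simp only [dev, PiLp.smul_apply, ← trL_apply, map_smul, smul_eq_mul, RingHom.id_apply]
      split_ifs <;> ring }

theorem cdot_eq_inner (s r : Vec n) : cdot s r = inner ℂ r s := by
  simp [cdot, PiLp.inner_apply]

theorem ddot_eq_inner (A B : Tens n) : ddot A B = inner ℂ B A := by
  simp [ddot, PiLp.inner_apply, Fintype.sum_prod_type]

end Tensor

/-! ### Piecewise polynomial spaces -/

section PiecewisePolynomial

variable {n : ℕ}

theorem polyAt_zero (x : Pt n) : polyAt 0 x = 0 := by simp [polyAt]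

theorem polyAt_smul (c : ℂ) (p : MvPolynomial (Fin n) ℂ) (x : Pt n) :
    polyAt (c • p) x = c * polyAt p x := by simp [polyAt]

variable (Ω : Set (Pt n)) (𝒯 : Finset (Finset (Pt n)))

/-- Fields whose components are polynomials of degree at most `m` on each cell. -/
def pwPoly (ι : Type*) [Fintype ι] (m : ℕ) :
    Submodule ℂ (Lp (EuclideanSpace ℂ ι) 2 (volume.restrict Ω)) where
  carrier := {v | ∀ T ∈ 𝒯, ∀ i, ∃ p : MvPolynomial (Fin n) ℂ, p.totalDegree ≤ m ∧
    ∀ᵐ x ∂(volume.restrict Ω), x ∈ cell T → v x i = polyAt p x}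
  zero_mem' := fun T _ i => ⟨0, by simp, by
    filter_upwards [Lp.coeFn_zero (EuclideanSpace ℂ ι) 2 (volume.restrict Ω)] with x hx _
    rw [hx]; simp [polyAt]⟩
  add_mem' := fun {f g} hf hg T hT i => by
    obtain ⟨p, hp, ep⟩ := hf T hT i
    obtain ⟨q, hq, eq⟩ := hg T hT i
    refine ⟨p + q, (MvPolynomial.totalDegree_add _ _).trans (max_le hp hq), ?_⟩
    filter_upwards [ep, eq, Lp.coeFn_add f g] with x h1 h2 h3 hx
    rw [h3, polyAt_add, Pi.add_apply, PiLp.add_apply, h1 hx, h2 hx]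
  smul_mem' := fun c f hf T hT i => by
    obtain ⟨p, hp, ep⟩ := hf T hT i
    refine ⟨c • p, (MvPolynomial.totalDegree_smul_le _ _).trans hp, ?_⟩
    filter_upwards [ep, Lp.coeFn_smul c f] with x h1 h3 hx
    rw [h3, Pi.smul_apply, PiLp.smul_apply, h1 hx]
    simp [polyAt]

variable {Ω 𝒯}

/-- The space is the first projection of the relation `R` between fields and families of
polynomials, one for each cell and component. The second projection is injective on `R`, since the
cells cover Ω, and its target is finite-dimensional. A relation avoids having to show that the
polynomials are determined by the field. -/
theorem finiteDimensional_pwPoly (hcov : Ω ⊆ ⋃ T ∈ 𝒯, cell T) (hΩ : MeasurableSet Ω)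
    (ι : Type*) [Fintype ι] (m : ℕ) : FiniteDimensional ℂ (pwPoly Ω 𝒯 ι m) := by
  let E := Lp (EuclideanSpace ℂ ι) 2 (volume.restrict Ω)
  let P := 𝒯 × ι → MvPolynomial.restrictTotalDegree (Fin n) ℂ m
  let R : Submodule ℂ (E × P) :=
    { carrier := {z | ∀ (T : 𝒯) (i : ι), ∀ᵐ x ∂(volume.restrict Ω), x ∈ cell (T : Finset (Pt n)) →
        z.1 x i = polyAt (z.2 (T, i) : MvPolynomial (Fin n) ℂ) x}
      zero_mem' := fun T i => by
        filter_upwards [Lp.coeFn_zero (EuclideanSpace ℂ ι) 2 (volume.restrict Ω)] with x hx _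
        rw [Prod.fst_zero, hx]; exact (polyAt_zero x).symm
      add_mem' := fun {y z} hy hz T i => by
        filter_upwards [hy T i, hz T i, Lp.coeFn_add y.1 z.1] with x h1 h2 h3 hx
        rw [Prod.fst_add, h3, Pi.add_apply, PiLp.add_apply, h1 hx, h2 hx, ← polyAt_add]; rfl
      smul_mem' := fun c z hz T i => by
        filter_upwards [hz T i, Lp.coeFn_smul c z.1] with x h1 h3 hx
        rw [Prod.smul_fst, h3, Pi.smul_apply, PiLp.smul_apply, h1 hx]; exact (polyAt_smul c _ x).symm }
  have hinj : Function.Injective ((LinearMap.snd ℂ E P).comp R.subtype) := by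
    refine (injective_iff_map_eq_zero _).2 ?_
    rintro ⟨⟨f, p⟩, hz⟩ hp
    have hp' : p = 0 := hp
    subst hp'
    have hf : f = 0 := by
      refine Lp.ext ?_
      have hall : ∀ᵐ x ∂(volume.restrict Ω), ∀ (T : 𝒯) (i : ι), x ∈ cell (T : Finset (Pt n)) →
          f x i = 0 := by
        rw [ae_all_iff]; intro T; rw [ae_all_iff]; intro i
        filter_upwards [hz T i] with x hx hxT
        exact (hx hxT).trans (polyAt_zero x)
      filter_upwards [hall, ae_restrict_mem hΩ,
        Lp.coeFn_zero (EuclideanSpace ℂ ι) 2 (volume.restrict Ω)] with x hx hxΩ h0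
      rw [h0]
      obtain ⟨T, hT, hxT⟩ := mem_iUnion₂.1 (hcov hxΩ)
      ext i
      exact hx ⟨T, hT⟩ i hxT
    subst hf
    rfl
  have : FiniteDimensional ℂ R := FiniteDimensional.of_injective _ hinj
  have hle : pwPoly Ω 𝒯 ι m ≤ R.map (LinearMap.fst ℂ E P) := by
    intro f hf
    choose p hp ep using fun (z : 𝒯 × ι) => hf z.1.1 z.1.2 z.2
    exact ⟨(f, fun z => ⟨p z, (MvPolynomial.mem_restrictTotalDegree _ _ _).2 (hp z)⟩),
      fun T i => ep (T, i), rfl⟩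
  exact Submodule.finiteDimensional_of_le hle

end PiecewisePolynomial

/-! ### Geometry of meshes -/

section Geometry

variable {n : ℕ}

theorem volume_affineSpan_eq_zero {S : Finset (Pt n)} (hS : S.card ≤ n) :
    volume (affineSpan ℝ (S : Set (Pt n)) : Set (Pt n)) = 0 := by
  classical
  refine Measure.addHaar_affineSubspace volume _ fun h => ?_
  rcases Nat.eq_zero_or_eq_succ_pred S.card with h0 | h1
  · rw [Finset.card_eq_zero] at h0
    subst h0
    rw [Finset.coe_empty, AffineSubspace.span_empty] at h
    exact AffineSubspace.bot_ne_top ℝ (Pt n) (Pt n) h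
  · have h2 := finrank_vectorSpan_image_finset_le ℝ (id : Pt n → Pt n) S h1
    rw [Finset.image_id, ← direction_affineSpan, h, AffineSubspace.direction_top, finrank_top,
      finrank_euclideanSpace_fin] at h2
    rw [Nat.succ_eq_add_one] at h1
    omega

theorem volume_convexHull_eq_zero {S : Finset (Pt n)} (hS : S.card ≤ n) :
    volume (convexHull ℝ (S : Set (Pt n))) = 0 :=
  measure_mono_null (convexHull_subset_affineSpan _) (volume_affineSpan_eq_zero hS)

theorem isCompact_cell (T : Finset (Pt n)) : IsCompact (cell T) :=
  T.finite_toSet.isCompact_convexHull ℝ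

theorem volume_frontier_cell (T : Finset (Pt n)) : volume (frontier (cell T)) = 0 :=
  (convex_convexHull ℝ _).addHaar_frontier volume

/-- A Lipschitz boundary excludes slits. From a boundary point, a small move in the direction -e
leads strictly below the graph, where a whole neighbourhood misses Ω, so the point is not interior
to the closure. This is needed because a mesh covers the closure of Ω, while test functions on a
cell must be supported in Ω. -/
theorem IsLipschitzDomain.interior_closure {Ω : Set (Pt n)} (hΩ : IsLipschitzDomain Ω) :
    interior (closure Ω) = Ω := by
  refine Subset.antisymm (fun x hx => ?_) (hΩ.isOpen.subset_interior_iff.2 subset_closure)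
  by_contra hxΩ
  have hxf : x ∈ frontier Ω := ⟨interior_subset hx, by rwa [hΩ.isOpen.interior_eq]⟩
  obtain ⟨U, hU, e, he, K, g, hg, hge, hUe⟩ := hΩ.lipschitz x hxf
  have hgx : inner ℝ e x ≤ g x := by
    by_contra! hlt
    have : x ∈ {y | g y < inner ℝ e y} ∩ U := ⟨hlt, mem_of_mem_nhds hU⟩
    rw [← hUe] at this
    exact hxΩ this.1
  have hlim : Filter.Tendsto (fun s : ℝ => x + (-s) • e) (𝓝[>] 0) (𝓝 x) := by
    have : Continuous fun s : ℝ => x + (-s) • e := by fun_prop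
    have h := this.tendsto 0
    simp only [neg_zero, zero_smul, add_zero] at h
    exact h.mono_left nhdsWithin_le_nhds
  have hev := hlim.eventually
    (Filter.inter_mem (isOpen_interior.mem_nhds hx) (interior_mem_nhds.2 hU))
  obtain ⟨s, ⟨hs1, hs2⟩, hs⟩ := (hev.and self_mem_nhdsWithin).exists
  have hs0 : (0 : ℝ) < s := hs
  have hlt : inner ℝ e (x + (-s) • e) < g (x + (-s) • e) := by
    rw [hge, inner_add_right, inner_smul_right, real_inner_self_eq_norm_sq, he]
    linarith
  have hopen : IsOpen ({y | inner ℝ e y < g y} ∩ interior U) :=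
    (isOpen_lt (by fun_prop) hg.continuous).inter isOpen_interior
  obtain ⟨y, ⟨hy1, hy2⟩, hyΩ⟩ := mem_closure_iff.1 (interior_subset hs1) _ hopen ⟨hlt, hs2⟩
  have : y ∈ Ω ∩ U := ⟨hyΩ, interior_subset hy2⟩
  rw [hUe] at this
  exact lt_asymm (show g y < inner ℝ e y from this.1) hy1

/-- An affine basis with given vertices. -/
theorem exists_affineBasis_eq {T : Finset (Pt n)}
    (hind : AffineIndependent ℝ (fun x : T => (x : Pt n))) (e : Fin (n + 1) → Pt n)
    (he : Function.Injective e) (heT : ∀ i, e i ∈ T) :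
    ∃ b : AffineBasis (Fin (n + 1)) ℝ (Pt n), ∀ i, b i = e i := by
  have h1 : AffineIndependent ℝ e := by
    have := hind.comp_embedding ⟨fun i => ⟨e i, heT i⟩, fun i j h => he (by simpa using h)⟩
    exact this
  refine ⟨⟨e, h1, ?_⟩, fun i => rfl⟩
  rw [h1.affineSpan_eq_top_iff_card_eq_finrank_add_one]
  simp

theorem range_eq_of_card {T : Finset (Pt n)} (hT : T.card = n + 1) {e : Fin (n + 1) → Pt n}
    (he : Function.Injective e) (heT : ∀ i, e i ∈ T) : range e = T := by
  classical
  have : Finset.univ.image e = T := by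
    refine Finset.eq_of_subset_of_card_le ?_ ?_
    · intro x hx
      obtain ⟨i, -, rfl⟩ := Finset.mem_image.1 hx
      exact heT i
    · rw [Finset.card_image_of_injective _ he, hT]; simp
  rw [← this]; simp

variable {Ω : Set (Pt n)} {𝒯 : Finset (Finset (Pt n))}

theorem IsMesh.exists_basis (h𝒯 : IsMesh Ω 𝒯) {T : Finset (Pt n)} (hT : T ∈ 𝒯) :
    ∃ b : AffineBasis (Fin (n + 1)) ℝ (Pt n), range b = (T : Set (Pt n)) := by
  let e := (T.equivFinOfCardEq (h𝒯.card T hT)).symm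
  obtain ⟨b, hb⟩ := exists_affineBasis_eq (h𝒯.indep T hT) (fun i => (e i : Pt n))
    (fun i j h => e.injective (Subtype.ext h)) (fun i => (e i).2)
  refine ⟨b, ?_⟩
  rw [show (b : Fin (n + 1) → Pt n) = fun i => (e i : Pt n) from funext hb]
  exact range_eq_of_card (h𝒯.card T hT) (fun i j h => e.injective (Subtype.ext h))
    (fun i => (e i).2)

theorem IsMesh.card_inter_le (h𝒯 : IsMesh Ω 𝒯) {T T' : Finset (Pt n)} [DecidableEq (Pt n)]
    (hT : T ∈ 𝒯) (hT' : T' ∈ 𝒯) (hne : T ≠ T') : (T ∩ T').card ≤ n := by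
  by_contra! h
  have h1 : T ∩ T' = T := Finset.eq_of_subset_of_card_le Finset.inter_subset_left
    (by rw [h𝒯.card T hT]; exact h)
  have h2 : T ∩ T' = T' := Finset.eq_of_subset_of_card_le Finset.inter_subset_right
    (by rw [h𝒯.card T' hT']; exact h)
  exact hne (h1.symm.trans h2)

theorem IsMesh.volume_inter (h𝒯 : IsMesh Ω 𝒯) {T T' : Finset (Pt n)}
    (hT : T ∈ 𝒯) (hT' : T' ∈ 𝒯) (hne : T ≠ T') : volume (cell T ∩ cell T') = 0 := by
  classical
  rw [h𝒯.conforming T hT T' hT', ← Finset.coe_inter]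
  exact volume_convexHull_eq_zero (h𝒯.card_inter_le hT hT' hne)

theorem IsMesh.interior_cell_subset (h𝒯 : IsMesh Ω 𝒯) (hΩ : IsLipschitzDomain Ω)
    {T : Finset (Pt n)} (hT : T ∈ 𝒯) : interior (cell T) ⊆ Ω := by
  rw [← hΩ.interior_closure, ← h𝒯.cover]
  exact interior_mono (subset_biUnion_of_mem (u := cell) hT)

theorem IsLipschitzDomain.volume_real_ne_zero (hΩ : IsLipschitzDomain Ω) :
    volume.real Ω ≠ 0 := by
  rw [measureReal_def]
  exact (ENNReal.toReal_pos (hΩ.isOpen.measure_pos volume hΩ.isConnected.nonempty).ne'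
    hΩ.isBounded.measure_lt_top.ne).ne'

theorem IsMesh.volume_cell_diff (h𝒯 : IsMesh Ω 𝒯) (hΩ : IsLipschitzDomain Ω)
    {T : Finset (Pt n)} (hT : T ∈ 𝒯) : volume (cell T \ Ω) = 0 := by
  refine measure_mono_null ?_ (volume_frontier_cell T)
  rintro x ⟨hx, hxΩ⟩
  exact ⟨subset_closure hx, fun h => hxΩ (h𝒯.interior_cell_subset hΩ hT h)⟩

theorem IsMesh.subset_cells (h𝒯 : IsMesh Ω 𝒯) : Ω ⊆ ⋃ T ∈ 𝒯, cell T := by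
  rw [h𝒯.cover]; exact subset_closure

theorem IsMesh.ae_cells (h𝒯 : IsMesh Ω 𝒯) (hΩ : IsLipschitzDomain Ω) :
    Ω =ᵐ[volume] ⋃ T : 𝒯, cell (T : Finset (Pt n)) := by
  refine Filter.EventuallyLE.antisymm ?_ ?_
  · refine LE.le.eventuallyLE ?_
    intro x hx
    obtain ⟨T, hT, hxT⟩ := mem_iUnion₂.1 (h𝒯.subset_cells hx)
    exact mem_iUnion.2 ⟨⟨T, hT⟩, hxT⟩
  · rw [ae_le_set, iUnion_sdiff]
    exact measure_iUnion_null fun T => h𝒯.volume_cell_diff hΩ T.2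

theorem IsMesh.integral_eq_sum (h𝒯 : IsMesh Ω 𝒯) (hΩ : IsLipschitzDomain Ω) {F : Pt n → ℂ}
    (hF : ∀ T ∈ 𝒯, IntegrableOn F (cell T)) :
    ∫ x in Ω, F x = ∑ T ∈ 𝒯, ∫ x in cell T, F x := by
  rw [setIntegral_congr_set (h𝒯.ae_cells hΩ), integral_iUnion_ae, tsum_fintype]
  · exact Finset.sum_coe_sort 𝒯 fun T => ∫ x in cell T, F x
  · exact fun T => (isCompact_cell _).measurableSet.nullMeasurableSet
  · intro T T' hne
    exact h𝒯.volume_inter T.2 T'.2 fun h => hne (Subtype.ext h)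
  · exact (integrableOn_finite_iUnion (f := F) (μ := volume)).2 fun T => hF T T.2

/-- Almost everywhere in `Ω`, each point lies in exactly one cell. -/
theorem IsMesh.ae_existsUnique (h𝒯 : IsMesh Ω 𝒯) :
    ∀ᵐ x, ∀ T ∈ 𝒯, ∀ T' ∈ 𝒯, x ∈ cell T → x ∈ cell T' → T = T' := by
  have h : ∀ᵐ x, ∀ T : 𝒯, ∀ T' : 𝒯, x ∈ cell (T : Finset (Pt n)) →
      x ∈ cell (T' : Finset (Pt n)) → T = T' := by
    rw [ae_all_iff]; intro T; rw [ae_all_iff]; intro T'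
    by_cases hne : T = T'
    · exact Filter.Eventually.of_forall fun _ _ _ => hne
    · have := h𝒯.volume_inter T.2 T'.2 fun h => hne (Subtype.ext h)
      filter_upwards [measure_eq_zero_iff_ae_notMem.1 this] with x hx h1 h2
      exact absurd ⟨h1, h2⟩ hx
  filter_upwards [h] with x hx T hT T' hT' h1 h2
  exact congrArg Subtype.val (hx ⟨T, hT⟩ ⟨T', hT'⟩ h1 h2)

/-! ### Piecewise continuous fields -/

/-- The function that equals `f T` on each cell `T`. -/
def pw (𝒯 : Finset (Finset (Pt n))) (f : Finset (Pt n) → Pt n → ℂ) (x : Pt n) : ℂ :=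
  ∑ T ∈ 𝒯, (cell T).indicator (f T) x

/-- The sum defining `pw` counts twice only where cells overlap. This null set does not depend on
the functions, so the index type may be arbitrary. -/
theorem IsMesh.pw_eq {ι : Type*} (h𝒯 : IsMesh Ω 𝒯) (f : ι → Finset (Pt n) → Pt n → ℂ) :
    ∀ᵐ x, ∀ i, ∀ T ∈ 𝒯, x ∈ cell T → pw 𝒯 (f i) x = f i T x := by
  filter_upwards [h𝒯.ae_existsUnique] with x hx i T hT hxT
  rw [pw, Finset.sum_eq_single T, indicator_of_mem hxT]
  · intro T' hT' hne
    exact indicator_of_notMem (fun h => hne (hx T' hT' T hT h hxT)) _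
  · exact fun h => absurd hT h

end Geometry

/-! ### Fields in the Raviart–Thomas space -/

section RowField

variable {n : ℕ} {Ω : Set (Pt n)} {𝒯 : Finset (Finset (Pt n))}

theorem memLp_pw (Ω : Set (Pt n)) {f : Finset (Pt n) → Pt n → ℂ}
    (hf : ∀ T ∈ 𝒯, Continuous (f T)) : MemLp (pw 𝒯 f) 2 (volume.restrict Ω) := by
  have h : MemLp (fun x => ∑ T ∈ 𝒯, (cell T).indicator (f T) x) 2 (volume.restrict Ω) := by
    refine memLp_finsetSum _ fun T hT => ?_
    have hm := (isCompact_cell T).measurableSet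
    rw [memLp_indicator_iff_restrict hm]
    obtain ⟨C, hC⟩ := (isCompact_cell T).exists_bound_of_continuousOn (hf T hT).continuousOn
    have : IsFiniteMeasure ((volume.restrict Ω).restrict (cell T)) := by
      refine ⟨?_⟩
      rw [Measure.restrict_apply_univ]
      exact (Measure.restrict_apply_le _ _).trans_lt (isCompact_cell T).measure_lt_top
    refine MemLp.of_bound (hf T hT).aestronglyMeasurable C ?_
    filter_upwards [ae_restrict_mem hm] with x hx using hC x hx
  exact h

/-- The tensor field whose row `i` equals `r T` on each cell `T` and whose other rows vanish. -/
def rowField (𝒯 : Finset (Finset (Pt n))) (i : Fin n) (r : Finset (Pt n) → Fin n → Pt n → ℂ)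
    (x : Pt n) : Tens n :=
  WithLp.toLp 2 fun p => if p.1 = i then pw 𝒯 (fun T => r T p.2) x else 0

/-- The vector field whose component `i` equals `f T` on each cell `T` and whose other components
vanish. -/
def compField (𝒯 : Finset (Finset (Pt n))) (i : Fin n) (f : Finset (Pt n) → Pt n → ℂ)
    (x : Pt n) : Vec n :=
  WithLp.toLp 2 fun l => if l = i then pw 𝒯 f x else 0

theorem memLp_rowField (Ω : Set (Pt n)) (i : Fin n) {r : Finset (Pt n) → Fin n → Pt n → ℂ}
    (hr : ∀ T ∈ 𝒯, ∀ j, Continuous (r T j)) :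
    MemLp (rowField 𝒯 i r) 2 (volume.restrict Ω) := by
  rw [memLp_piLp_iff]
  rintro ⟨l, j⟩
  by_cases h : l = i
  · simpa [rowField, h] using memLp_pw (𝒯 := 𝒯) Ω (f := fun T => r T j) fun T hT => hr T hT j
  · simp [rowField, h]

theorem memLp_compField (Ω : Set (Pt n)) (i : Fin n) {f : Finset (Pt n) → Pt n → ℂ}
    (hf : ∀ T ∈ 𝒯, Continuous (f T)) : MemLp (compField 𝒯 i f) 2 (volume.restrict Ω) := by
  rw [memLp_piLp_iff]
  intro l
  by_cases h : l = i
  · simpa [compField, h] using memLp_pw Ω hf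
  · simp [compField, h]

theorem integrableOn_fdiv {r : Fin n → Pt n → ℂ} (hr : ∀ j, ContDiff ℝ 1 (r j))
    (T : Finset (Pt n)) : IntegrableOn (fdiv r) (cell T) :=
  (continuous_fdiv hr).continuousOn.integrableOn_compact (isCompact_cell T)

/-- By the product rule, the defect in the weak formulation is the sum over the cells of the
integrals of div(φ r). The hypothesis `hw` that it vanishes replaces continuity of the normal
component across faces. -/
theorem isWeakDiv_rowField (hΩ : IsLipschitzDomain Ω) (h𝒯 : IsMesh Ω 𝒯) (i : Fin n)
    {r : Finset (Pt n) → Fin n → Pt n → ℂ} (hr : ∀ T ∈ 𝒯, ∀ j, ContDiff ℝ ∞ (r T j))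
    (hw : ∀ φ : Pt n → ℝ, ContDiff ℝ ∞ φ → HasCompactSupport φ → tsupport φ ⊆ Ω →
      ∑ T ∈ 𝒯, ∫ x in cell T, fdiv (fun j x => r T j x * ((φ x : ℝ) : ℂ)) x = 0)
    {τ : L2T Ω} {d : L2V Ω} (hτ : τ =ᵐ[volume.restrict Ω] rowField 𝒯 i r)
    (hd : d =ᵐ[volume.restrict Ω] compField 𝒯 i (fun T => fdiv (r T))) :
    IsWeakDiv Ω τ d := by
  intro φ hφ hφc hφs l
  rw [← add_eq_zero_iff_eq_neg, ← integral_add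
    (integrable_finsetSum _ fun j _ => integrable_mul_fderiv τ hφ hφc l j)
    (integrable_mul_test d hφ hφc l)]
  by_cases hl : l = i
  · subst hl
    set F : Pt n → ℂ := fun x => ∑ j, pw 𝒯 (fun T => r T j) x *
      ((fderiv ℝ φ x (EuclideanSpace.single j 1) : ℝ) : ℂ)
        + pw 𝒯 (fun T => fdiv (r T)) x * ((φ x : ℝ) : ℂ) with hF
    have h1 : ∀ T ∈ 𝒯, ∀ᵐ x, x ∈ cell T →
        F x = fdiv (fun j x => r T j x * ((φ x : ℝ) : ℂ)) x := by
      intro T hT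
      filter_upwards [h𝒯.pw_eq (fun j T => r T j), h𝒯.pw_eq (fun (_ : Unit) T => fdiv (r T))]
        with x hx hx' hxT
      have hφ' : ContDiff ℝ 1 (fun x => ((φ x : ℝ) : ℂ)) :=
        Complex.ofRealCLM.contDiff.comp (hφ.of_le (by exact_mod_cast le_top))
      rw [fdiv_mul (fun j => (hr T hT j).of_le (by exact_mod_cast le_top)) hφ', hF]
      have hx2 := hx' () T hT hxT
      simp only [hx _ T hT hxT, hx2]
      congr 1
      refine Finset.sum_congr rfl fun j _ => ?_
      have hfd : fderiv ℝ (fun x => ((φ x : ℝ) : ℂ)) x = Complex.ofRealCLM ∘L fderiv ℝ φ x :=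
        (Complex.ofRealCLM.hasFDerivAt.comp x
          (hφ.differentiable (by simp) x).hasFDerivAt).fderiv
      rw [hfd]
      rfl
    have h2 : ∀ T ∈ 𝒯, ∫ x in cell T, F x
        = ∫ x in cell T, fdiv (fun j x => r T j x * ((φ x : ℝ) : ℂ)) x := fun T hT =>
      setIntegral_congr_ae (isCompact_cell T).measurableSet (h1 T hT)
    have h3 : ∀ T ∈ 𝒯, IntegrableOn F (cell T) := fun T hT => by
      refine (integrableOn_fdiv (r := fun j x => r T j x * ((φ x : ℝ) : ℂ)) (fun j => ?_) T).congr ?_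
      · exact ((hr T hT j).mul (Complex.ofRealCLM.contDiff.comp hφ)).of_le
          (by exact_mod_cast le_top)
      · rw [Filter.EventuallyEq, ae_restrict_iff' (isCompact_cell T).measurableSet]
        filter_upwards [h1 T hT] with x hx hxT using (hx hxT).symm
    rw [← hw φ hφ hφc hφs, ← Finset.sum_congr rfl h2, ← h𝒯.integral_eq_sum hΩ h3]
    refine integral_congr_ae ?_
    filter_upwards [hτ, hd] with x h4 h5
    rw [h4, h5, hF]
    simp [rowField, compField]
  · refine integral_eq_zero_of_ae ?_
    filter_upwards [hτ, hd] with x h4 h5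
    rw [h4, h5]
    simp [rowField, compField, hl]

theorem rowField_mem_RT (h𝒯 : IsMesh Ω 𝒯) (i : Fin n) {k : ℕ}
    {r : Finset (Pt n) → Fin n → Pt n → ℂ} (hr : ∀ T ∈ 𝒯, IsRT k (r T))
    {τ : L2T Ω} (hτ : τ =ᵐ[volume.restrict Ω] rowField 𝒯 i r) (hτd : τ ∈ Hdiv Ω) :
    τ ∈ RT Ω 𝒯 k := by
  refine ⟨hτd, fun T hT l => ?_⟩
  by_cases hl : l = i
  · subst hl
    obtain ⟨p, q, hp, ⟨q', hq', eq'⟩, e⟩ := hr T hT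
    choose p' hp' ep' using hp
    refine ⟨p', q', hp', hq', ?_⟩
    filter_upwards [hτ, ae_restrict_of_ae (h𝒯.pw_eq (fun j T => r T j))] with x h1 h2 hxT j
    rw [h1, ← ep', ← eq', ← e, ← h2 j T hT hxT]
    simp [rowField]
  · refine ⟨fun _ => 0, 0, by simp, by simp, ?_⟩
    filter_upwards [hτ] with x h1 _ j
    rw [h1]
    simp [rowField, hl, polyAt_zero]

/-- If `q` is orthogonal to the divergences of Raviart–Thomas fields, then its component `i`, given
by `Q T` on each cell, is orthogonal to the divergences of fields that have a weak divergence. -/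
theorem sum_integral_fdiv_eq_zero (hΩ : IsLipschitzDomain Ω) (h𝒯 : IsMesh Ω 𝒯) {k : ℕ}
    {q : L2V Ω} (hq : ∀ τ ∈ RT Ω 𝒯 k, formb τ q = 0) (i : Fin n)
    {Q : Finset (Pt n) → Pt n → ℂ} (hQc : ∀ T ∈ 𝒯, Continuous (Q T))
    (hQ : ∀ T ∈ 𝒯, ∀ᵐ x ∂(volume.restrict Ω), x ∈ cell T → q x i = Q T x)
    {r : Finset (Pt n) → Fin n → Pt n → ℂ} (hr : ∀ T ∈ 𝒯, IsRT k (r T))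
    (hw : ∀ φ : Pt n → ℝ, ContDiff ℝ ∞ φ → HasCompactSupport φ → tsupport φ ⊆ Ω →
      ∑ T ∈ 𝒯, ∫ x in cell T, fdiv (fun j x => r T j x * ((φ x : ℝ) : ℂ)) x = 0) :
    ∑ T ∈ 𝒯, ∫ x in cell T, fdiv (r T) x * conj (Q T x) = 0 := by
  have hrc : ∀ T ∈ 𝒯, ∀ j, ContDiff ℝ ∞ (r T j) := fun T hT j => ((hr T hT).isPoly j).contDiff
  have hdc : ∀ T ∈ 𝒯, Continuous (fdiv (r T)) := fun T hT =>
    continuous_fdiv fun j => (hrc T hT j).of_le (by exact_mod_cast le_top)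
  have m1 := memLp_rowField Ω i fun T hT j => (hrc T hT j).continuous
  have m2 := memLp_compField Ω i hdc
  have hdiv : IsWeakDiv Ω m1.toLp m2.toLp :=
    isWeakDiv_rowField hΩ h𝒯 i hrc hw m1.coeFn_toLp m2.coeFn_toLp
  have hmem := rowField_mem_RT h𝒯 i hr m1.coeFn_toLp ⟨_, hdiv⟩
  have h0 := hq _ hmem
  rw [formb, hdiv.wdiv_eq hΩ.isOpen] at h0
  set F : Pt n → ℂ := fun x => pw 𝒯 (fun T => fdiv (r T)) x * conj (pw 𝒯 Q x) with hF
  have h1 : ∀ T ∈ 𝒯, ∀ᵐ x, x ∈ cell T → F x = fdiv (r T) x * conj (Q T x) := fun T hT => by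
    filter_upwards [h𝒯.pw_eq (fun (_ : Unit) T => fdiv (r T)), h𝒯.pw_eq (fun (_ : Unit) => Q)]
      with x hx hx' hxT
    rw [hF]
    simp only [hx' () T hT hxT]
    rw [show pw 𝒯 (fun T => fdiv (r T)) x = _ from hx () T hT hxT]
  have h2 : ∀ T ∈ 𝒯, ∫ x in cell T, F x = ∫ x in cell T, fdiv (r T) x * conj (Q T x) :=
    fun T hT => setIntegral_congr_ae (isCompact_cell T).measurableSet (h1 T hT)
  have h3 : ∀ T ∈ 𝒯, IntegrableOn F (cell T) := fun T hT => by
    refine IntegrableOn.congr_fun_ae (f := fun x => fdiv (r T) x * conj (Q T x)) ?_ ?_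
    · exact ((hdc T hT).mul (Complex.continuous_conj.comp
        (hQc T hT))).continuousOn.integrableOn_compact (isCompact_cell T)
    · rw [Filter.EventuallyEq, ae_restrict_iff' (isCompact_cell T).measurableSet]
      filter_upwards [h1 T hT] with x hx hxT using (hx hxT).symm
  rw [← Finset.sum_congr rfl h2, ← h𝒯.integral_eq_sum hΩ h3, ← h0]
  refine integral_congr_ae ?_
  have hQ' : ∀ᵐ x ∂(volume.restrict Ω), ∀ T : 𝒯, x ∈ cell (T : Finset (Pt n)) →
      q x i = Q T x := ae_all_iff.2 fun T => hQ T T.2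
  filter_upwards [m2.coeFn_toLp, hQ', ae_restrict_mem hΩ.isOpen.measurableSet,
    ae_restrict_of_ae (h𝒯.pw_eq (fun (_ : Unit) => Q))] with x h4 h5 h6 h7
  obtain ⟨T, hT, hxT⟩ := mem_iUnion₂.1 (h𝒯.subset_cells h6)
  rw [h4, cdot, Finset.sum_eq_single i, h5 ⟨T, hT⟩ hxT, ← h7 () T hT hxT, hF]
  · simp [compField]
  · intro l _ hl
    simp [compField, hl]
  · simp

end RowField

/-! ### Functions that are almost everywhere constant -/

section Constant

variable {n : ℕ} {Ω : Set (Pt n)}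

/-- If the centre of a second ball lies in the first, the balls meet in a nonempty open set, which
has positive measure, so their constants agree. Hence the constant is a locally constant function of
the centre. -/
theorem ae_const_of_locally {f : Pt n → ℂ} (hΩ : IsOpen Ω) (hc : IsConnected Ω)
    (h : ∀ x ∈ Ω, ∃ r > 0, ∃ c, ∀ᵐ y, y ∈ Metric.ball x r → f y = c) :
    ∃ c, ∀ᵐ y ∂(volume.restrict Ω), f y = c := by
  choose! r hr c hcr using h
  obtain ⟨x₀, hx₀⟩ := hc.nonempty
  have : PreconnectedSpace Ω := isPreconnected_iff_preconnectedSpace.1 hc.isPreconnected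
  have hloc : IsLocallyConstant (fun x : Ω => c x) := by
    rw [IsLocallyConstant.iff_eventually_eq]
    intro x
    have : ∀ᶠ y : Ω in 𝓝 x, (y : Pt n) ∈ Metric.ball (x : Pt n) (r x) :=
      continuous_subtype_val.continuousAt.eventually (Metric.ball_mem_nhds _ (hr x x.2))
    filter_upwards [this] with y hy
    have hopen : IsOpen (Metric.ball (x : Pt n) (r x) ∩ Metric.ball (y : Pt n) (r y)) :=
      Metric.isOpen_ball.inter Metric.isOpen_ball
    have hpos := (hopen.measure_pos volume ⟨y, hy, Metric.mem_ball_self (hr y y.2)⟩).ne'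
    obtain ⟨z, hz, h1, h2⟩ := ((frequently_ae_mem_iff.2 hpos).and_eventually
      ((hcr x x.2).and (hcr y y.2))).exists
    rw [← h1 hz.1, ← h2 hz.2]
  refine ⟨c x₀, ?_⟩
  rw [ae_restrict_iff' hΩ.measurableSet, ae_iff]
  refine measure_null_of_locally_null _ fun x hx => ?_
  rw [mem_ofPred_eq, Classical.not_imp] at hx
  refine ⟨_, inter_mem_nhdsWithin _ (Metric.ball_mem_nhds x (hr x hx.1)), ?_⟩
  refine measure_mono_null ?_ (ae_iff.1 (hcr x hx.1))
  rintro y ⟨hy1, hy2⟩ hy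
  rw [mem_ofPred_eq, Classical.not_imp] at hy1
  refine hy1.2 ((hy hy2).trans ?_)
  exact hloc.apply_eq_of_preconnectedSpace ⟨x, hx.1⟩ ⟨x₀, hx₀⟩

/-- A function with vanishing weak gradient is locally constant. -/
theorem locally_ae_const_of_weak_gradient {f : Pt n → ℂ} (hΩ : IsOpen Ω)
    (hf : IntegrableOn f Ω)
    (hw : ∀ φ : Pt n → ℝ, ContDiff ℝ ∞ φ → HasCompactSupport φ → tsupport φ ⊆ Ω → ∀ j,
      ∫ x in Ω, f x * ((fderiv ℝ φ x (EuclideanSpace.single j 1) : ℝ) : ℂ) = 0)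
    {x : Pt n} (hx : x ∈ Ω) : ∃ r > 0, ∃ c, ∀ᵐ y, y ∈ Metric.ball x r → f y = c := by
  obtain ⟨ε, hε, hball⟩ := Metric.isOpen_iff.1 hΩ x hx
  set r := ε / 2 with hrdef
  have hr : 0 < r := by positivity
  set F := Ω.indicator f with hF
  have hFint : LocallyIntegrable F :=
    ((integrable_indicator_iff hΩ.measurableSet).2 hf).locallyIntegrable
  -- Mollifiers of radius below r = ε/2: centred at a point of `ball x r`, they are supported in
  -- `ball x ε`, hence in Ω. The fixed ratio of the two radii is what the almost everywhere
  -- convergence theorem asks for.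
  let φ : ℕ → ContDiffBump (0 : Pt n) := fun m =>
    ⟨r / (m + 1) / 4, r / (m + 1) / 2, by positivity, by
      have : 0 < r / (m + 1) := by positivity
      linarith⟩
  have hφ : Filter.Tendsto (fun m => (φ m).rOut) Filter.atTop (𝓝 0) := by
    have : Filter.Tendsto (fun m : ℕ => r / 2 * (1 / ((m : ℝ) + 1))) Filter.atTop
      (𝓝 (r / 2 * 0)) := tendsto_one_div_add_atTop_nhds_zero_nat.const_mul _
    rw [mul_zero] at this
    refine this.congr fun m => ?_
    show r / 2 * (1 / ((m : ℝ) + 1)) = r / (m + 1) / 2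
    ring
  have hφr : ∀ m, (φ m).rOut < r := fun m => by
    show r / ((m : ℝ) + 1) / 2 < r
    have : r / ((m : ℝ) + 1) ≤ r := div_le_self hr.le (by linarith [m.cast_nonneg (α := ℝ)])
    linarith
  have hlim := ContDiffBump.ae_convolution_tendsto_right_of_locallyIntegrable (K := 2)
    (μ := (volume : Measure (Pt n))) hφ (Filter.Eventually.of_forall fun m => by
      show r / ((m : ℝ) + 1) / 2 ≤ 2 * (r / (m + 1) / 4)
      linarith) hFint
  let L : ℂ →L[ℝ] ℝ →L[ℝ] ℂ := (ContinuousLinearMap.lsmul ℝ ℝ).flip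
  -- A derivative of the mollified function at y is, up to sign, f paired with the derivative of the
  -- test function t ↦ φ(y - t), so it vanishes by `hw`.
  have hconst : ∀ m, ∃ c, ∀ y ∈ Metric.ball x r,
      convolution ((φ m).normed volume) F (ContinuousLinearMap.lsmul ℝ ℝ) volume y = c := by
    intro m
    have hflip : convolution ((φ m).normed volume) F (ContinuousLinearMap.lsmul ℝ ℝ) volume
        = convolution F ((φ m).normed volume) L volume :=
      (convolution_flip (L := (ContinuousLinearMap.lsmul ℝ ℝ : ℝ →L[ℝ] ℂ →L[ℝ] ℂ))).symm
    rw [hflip]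
    have hcs : HasCompactSupport ((φ m).normed (volume : Measure (Pt n))) :=
      (φ m).hasCompactSupport_normed
    have hsm : ContDiff ℝ ∞ ((φ m).normed (volume : Measure (Pt n))) := (φ m).contDiff_normed
    have hd := fun y => hcs.hasFDerivAt_convolution_right L hFint
      (hsm.of_le (by exact_mod_cast le_top)) y
    refine Metric.isOpen_ball.exists_is_const_of_fderiv_eq_zero (𝕜 := ℝ)
      (convex_ball x r).isPreconnected
      (fun y _ => (hd y).differentiableAt.differentiableWithinAt) fun y hy => ?_
    rw [(hd y).fderiv, Pi.zero_apply]
    have hb : ∀ j, (convolution F (fderiv ℝ ((φ m).normed volume)) (L.precompR (Pt n)) volume) y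
        (EuclideanSpace.single j 1) = 0 := fun j => by
      rw [convolution_precompR_apply L hFint (hcs.fderiv ℝ) (hsm.continuous_fderiv (by simp))]
      set ψ : Pt n → ℝ := fun t => (φ m).normed volume (y - t) with hψ
      have hψd : ∀ t, fderiv ℝ ψ t (EuclideanSpace.single j 1)
          = - fderiv ℝ ((φ m).normed volume) (y - t) (EuclideanSpace.single j 1) := fun t => by
        have h1 : HasFDerivAt (fun t : Pt n => y - t) (-ContinuousLinearMap.id ℝ (Pt n)) t :=
          (hasFDerivAt_id t).const_sub y
        have h2 := ((hsm.differentiable (by simp)) (y - t)).hasFDerivAt.comp t h1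
        have h3 : fderiv ℝ ψ t = _ := h2.fderiv
        rw [h3]; simp
      have hsupp : tsupport ψ ⊆ Metric.closedBall y (φ m).rOut := by
        refine closure_minimal (fun t ht => ?_) Metric.isClosed_closedBall
        have : y - t ∈ Function.support ((φ m).normed (volume : Measure (Pt n))) := ht
        rw [(φ m).support_normed_eq, Metric.mem_ball, dist_zero_right] at this
        rw [Metric.mem_closedBall, dist_comm, dist_eq_norm]
        exact this.le
      have hψc : HasCompactSupport ψ :=
        (isCompact_closedBall y (φ m).rOut).of_isClosed_subset (isClosed_tsupport _) hsupp
      have hψΩ : tsupport ψ ⊆ Ω := fun t ht => hball (by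
        have h1 := Metric.mem_closedBall.1 (hsupp ht)
        have h2 := Metric.mem_ball.1 hy
        have h3 := dist_triangle t y x
        have h4 := hφr m
        rw [Metric.mem_ball]
        linarith)
      have key := hw ψ (hsm.comp (contDiff_const.sub contDiff_id)) hψc hψΩ j
      rw [← integral_indicator hΩ.measurableSet] at key
      rw [convolution_def, ← neg_eq_zero, ← integral_neg, ← key]
      congr 1
      funext t
      by_cases ht : t ∈ Ω
      · rw [indicator_of_mem ht, hψd, hF, indicator_of_mem ht]
        simp [L, mul_comm]
      · rw [indicator_of_notMem ht, hF, indicator_of_notMem ht]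
        simp [L]
    ext v
    rw [← (EuclideanSpace.basisFun (Fin n) ℝ).sum_repr v, map_sum]
    simp [hb]
  choose c hc using hconst
  have hpos : volume (Metric.ball x r) ≠ 0 := (Metric.measure_ball_pos _ _ hr).ne'
  obtain ⟨z, hz, hzlim⟩ := ((frequently_ae_mem_iff.2 hpos).and_eventually hlim).exists
  refine ⟨r, hr, F z, ?_⟩
  filter_upwards [hlim] with y hy hyb
  have h1 : F y = F z := by
    refine tendsto_nhds_unique hy (hzlim.congr fun m => ?_)
    rw [hc m z hz, hc m y hyb]
  rw [← h1, hF, indicator_of_mem (hball (Metric.ball_subset_ball (by linarith) hyb))]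

end Constant

/-! ### Surjectivity of the discrete divergence -/

section Orthogonality

theorem integrableOn_of_continuous {n : ℕ} {E : Type*} [NormedAddCommGroup E] {f : Pt n → E}
    (hf : Continuous f) {s : Set (Pt n)} (hs : IsCompact s) : IntegrableOn f s :=
  hf.continuousOn.integrableOn_compact hs

theorem fdiv_const_mul {n : ℕ} {r : Fin n → Pt n → ℂ} (hr : ∀ j, ContDiff ℝ 1 (r j)) (c : ℂ)
    (x : Pt n) : fdiv (fun j x => c * r j x) x = c * fdiv r x := by
  rw [fdiv, fdiv, Finset.mul_sum]
  refine Finset.sum_congr rfl fun j _ => ?_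
  rw [fderiv_const_mul ((hr j).differentiable (by simp) x)]
  simp

theorem IsRT.apex {n : ℕ} (k : ℕ) (a : Pt n) {q : Pt n → ℂ} (hq : IsPoly k q) :
    IsRT k (fun j x => q x * (((x j : ℝ) : ℂ) - ((a j : ℝ) : ℂ))) :=
  ⟨fun j x => (-((a j : ℝ) : ℂ)) * q x, q, fun _ => hq.const_mul _, hq, fun j x => by ring⟩

theorem sum_mul_fderiv_single {n : ℕ} (φ : Pt n → ℂ) (x v : Pt n) :
    ∑ j, ((v j : ℝ) : ℂ) * fderiv ℝ φ x (EuclideanSpace.single j 1) = fderiv ℝ φ x v := by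
  conv_rhs => rw [← (EuclideanSpace.basisFun _ ℝ).sum_repr v, map_sum]
  simp

variable {m : ℕ} {Ω : Set (Pt (m + 1))} {𝒯 : Finset (Finset (Pt (m + 1)))}

/-- On a simplex, a polynomial that is orthogonal to the divergences of all Raviart–Thomas bubbles
has vanishing gradient. -/
theorem fderiv_eq_zero_of_bubbles (b : AffineBasis (Fin (m + 1 + 1)) ℝ (Pt (m + 1)))
    {Q : Pt (m + 1) → ℂ} (hQ : ContDiff ℝ ∞ Q)
    (h : ∀ i, ∫ x in convexHull ℝ (range b), fdiv (fun l x =>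
      ((b.coord i x : ℝ) : ℂ) * fderiv ℝ Q x (b i) * (((x l : ℝ) : ℂ) - ((b i l : ℝ) : ℂ))) x
        * conj (Q x) = 0)
    {x : Pt (m + 1)} (hx : x ∈ interior (convexHull ℝ (range b))) : fderiv ℝ Q x = 0 := by
  have hQ1 : ContDiff ℝ 1 Q := hQ.of_le (by exact_mod_cast le_top)
  have hQc : ContDiff ℝ 1 (fun x => conj (Q x)) :=
    (Complex.conjCLE : ℂ →L[ℝ] ℂ).contDiff.comp hQ1
  have hDc : ∀ v, ContDiff ℝ ∞ (fun x => fderiv ℝ Q x v) := fun v =>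
    (hQ.fderiv_right (by simp)).clm_apply contDiff_const
  have hD1 : ∀ v, ContDiff ℝ 1 (fun x => fderiv ℝ Q x v) := fun v =>
    (hDc v).of_le (by exact_mod_cast le_top)
  have hcc : ∀ i, ContDiff ℝ 1 (fun x => ((b.coord i x : ℝ) : ℂ)) := fun i =>
    (contDiff_coord b i).of_le (by exact_mod_cast le_top)
  have hconjD : ∀ x v, fderiv ℝ (fun x => conj (Q x)) x v = conj (fderiv ℝ Q x v) := fun x v => by
    have : HasFDerivAt (fun x => conj (Q x)) ((Complex.conjCLE : ℂ →L[ℝ] ℂ) ∘L fderiv ℝ Q x) x :=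
      (Complex.conjCLE : ℂ →L[ℝ] ℂ).hasFDerivAt.comp x
        (hQ1.differentiable (by simp) x).hasFDerivAt
    rw [this.fderiv]; rfl
  have hs := isCompact_simplex b
  -- Integration by parts against a bubble with p = ∂Q in the direction of the vector b_i. There is
  -- no boundary term, and the derivative falls on the conjugate of Q.
  have h1 : ∀ i, ∫ x in convexHull ℝ (range b), ((b.coord i x : ℝ) : ℂ) * fderiv ℝ Q x (b i)
      * conj (fderiv ℝ Q x (x - b i)) = 0 := fun i => by
    set r : Fin (m + 1) → Pt (m + 1) → ℂ := fun l x =>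
      ((b.coord i x : ℝ) : ℂ) * fderiv ℝ Q x (b i) * (((x l : ℝ) : ℂ) - ((b i l : ℝ) : ℂ)) with hr
    have hrc : ∀ l, ContDiff ℝ 1 (r l) := fun l => ((hcc i).mul (hD1 _)).mul
      ((contDiff_coordC_sub (b i) l).of_le (by exact_mod_cast le_top))
    have key := integral_simplex_bubble b i (hD1 (b i)) hQc
    have hpt : ∀ x, fdiv (fun l x => r l x * conj (Q x)) x
        = ((b.coord i x : ℝ) : ℂ) * fderiv ℝ Q x (b i) * conj (fderiv ℝ Q x (x - b i))
          + fdiv r x * conj (Q x) := fun x => by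
      rw [fdiv_mul hrc hQc, ← hconjD,
        ← sum_mul_fderiv_single (fun x => conj (Q x)) x (x - b i), Finset.mul_sum]
      congr 1
      refine Finset.sum_congr rfl fun l _ => ?_
      simp only [hr, PiLp.sub_apply, Complex.ofReal_sub]
      ring
    have key' : ∫ x in convexHull ℝ (range b), fdiv (fun l x => r l x * conj (Q x)) x = 0 := key
    simp only [hpt] at key'
    rw [integral_add, h i, add_zero] at key'
    · exact key'
    · refine integrableOn_of_continuous ?_ hs
      exact ((hcc i).continuous.mul (hD1 _).continuous).mul (Complex.continuous_conj.comp
        ((hQ1.continuous_fderiv (by simp)).clm_apply (continuous_id.sub continuous_const)))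
    · exact integrableOn_of_continuous ((continuous_fdiv hrc).mul hQc.continuous) hs
  set g : Pt (m + 1) → ℝ := fun x =>
    ∑ i, b.coord i x * ‖fderiv ℝ Q x (b i) - fderiv ℝ Q x x‖ ^ 2 with hg
  have hcoordc : ∀ i, Continuous (fun x => b.coord i x) := fun i =>
    (b.coord i).continuous_of_finiteDimensional
  have hDx : Continuous (fun x => fderiv ℝ Q x x) :=
    (hQ1.continuous_fderiv (by simp)).clm_apply continuous_id
  have hgc : Continuous g := continuous_finsetSum _ fun i _ =>
    (hcoordc i).mul ((((hD1 _).continuous).sub hDx).norm.pow 2)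
  -- With D_i = Q'(x) b_i and M = Q'(x) x = ∑ λ_i D_i, the sum ∑ λ_i M conj(M - D_i) is zero. Adding
  -- it turns the sum of the integrands of `h1` into minus a weighted sum of the squares |D_i - M|².
  have hpt : ∀ x, ((g x : ℝ) : ℂ) = - ∑ i, ((b.coord i x : ℝ) : ℂ) * fderiv ℝ Q x (b i)
      * conj (fderiv ℝ Q x (x - b i)) := fun x => by
    have hsum : ∑ i, ((b.coord i x : ℝ) : ℂ) = 1 := by
      rw [← Complex.ofReal_sum, b.sum_coord_apply_eq_one, Complex.ofReal_one]
    have hm : ∑ i, ((b.coord i x : ℝ) : ℂ) * fderiv ℝ Q x (b i) = fderiv ℝ Q x x := by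
      conv_rhs => rw [← b.linear_combination_coord_eq_self x, map_sum]
      simp only [b.linear_combination_coord_eq_self, map_smul, Complex.real_smul]
    set M := fderiv ℝ Q x x
    have h2 : ∑ i, ((b.coord i x : ℝ) : ℂ) * M * conj (M - fderiv ℝ Q x (b i)) = 0 := by
      have : ∀ i, ((b.coord i x : ℝ) : ℂ) * M * conj (M - fderiv ℝ Q x (b i))
          = M * conj (((b.coord i x : ℝ) : ℂ) * M - ((b.coord i x : ℝ) : ℂ)
            * fderiv ℝ Q x (b i)) := fun i => by
        simp only [map_sub, map_mul, Complex.conj_ofReal]; ring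
      simp only [this, ← Finset.mul_sum, ← map_sum, Finset.sum_sub_distrib, ← Finset.sum_mul,
        hsum, hm, one_mul, sub_self, map_zero, mul_zero]
    rw [hg]
    push_cast
    rw [eq_neg_iff_add_eq_zero, ← h2, ← Finset.sum_add_distrib]
    refine Finset.sum_congr rfl fun i _ => ?_
    rw [← Complex.mul_conj', map_sub (fderiv ℝ Q x)]
    simp only [map_sub]
    ring
  have hint : ∫ x in convexHull ℝ (range b), g x = 0 := by
    have : ((∫ x in convexHull ℝ (range b), g x : ℝ) : ℂ) = 0 := by
      rw [← integral_complex_ofReal]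
      simp only [hpt]
      rw [integral_neg, integral_finsetSum, Finset.sum_eq_zero fun i _ => h1 i, neg_zero]
      intro i _
      refine integrableOn_of_continuous ?_ hs
      exact ((hcc i).continuous.mul (hD1 _).continuous).mul (Complex.continuous_conj.comp
        ((hQ1.continuous_fderiv (by simp)).clm_apply (continuous_id.sub continuous_const)))
    exact_mod_cast this
  have hcell : ∀ y ∈ convexHull ℝ (range b), ∀ i, 0 ≤ b.coord i y := fun y hy => by
    rwa [b.convexHull_eq_nonneg_coord] at hy
  have hg0 : ∀ y ∈ convexHull ℝ (range b), 0 ≤ g y := fun y hy =>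
    Finset.sum_nonneg fun i _ => mul_nonneg (hcell y hy i) (by positivity)
  rw [setIntegral_eq_zero_iff_of_nonneg_ae
    (by filter_upwards [ae_restrict_mem hs.measurableSet] with y hy using hg0 y hy)
    (integrableOn_of_continuous hgc hs)] at hint
  have hgx : g x = 0 := by
    have h3 : g =ᵐ[volume.restrict (interior (convexHull ℝ (range b)))] fun _ => 0 :=
      ae_restrict_of_ae_restrict_of_subset interior_subset hint
    exact Measure.eqOn_open_of_ae_eq h3 isOpen_interior hgc.continuousOn continuousOn_const hx
  have hpos : ∀ i, 0 < b.coord i x := by rwa [b.interior_convexHull] at hx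
  have hd : ∀ i, fderiv ℝ Q x (b i) = fderiv ℝ Q x x := fun i => by
    have h4 := (Finset.sum_eq_zero_iff_of_nonneg fun i _ =>
      mul_nonneg (hpos i).le (by positivity)).1 hgx i (Finset.mem_univ i)
    have h5 := (mul_eq_zero.1 h4).resolve_left (hpos i).ne'
    exact sub_eq_zero.1 (norm_eq_zero.1 (pow_eq_zero_iff two_ne_zero |>.1 h5))
  -- Taking the same value at all vertices, the derivative kills the edge vectors from `b 0`, which
  -- form a basis.
  have h6 : (fderiv ℝ Q x : Pt (m + 1) →ₗ[ℝ] ℂ) = 0 := by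
    refine (b.basisOf 0).ext fun i => ?_
    rw [b.basisOf_apply]
    simp [hd]
  ext v
  exact LinearMap.congr_fun h6 v

end Orthogonality

/-! ### Constants on the cells and across common faces -/

section Orthogonality

theorem fdiv_zero {n : ℕ} (x : Pt n) : fdiv (fun _ _ => 0) x = 0 := by simp [fdiv]

theorem IsPoly.eq_const {n : ℕ} {f : Pt n → ℂ} (hf : IsPoly 0 f) : ∃ c, ∀ x, f x = c := by
  obtain ⟨p, hp, e⟩ := hf
  rw [MvPolynomial.totalDegree_eq_zero_iff_eq_C.1 (Nat.le_zero.1 hp)] at e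
  exact ⟨_, fun x => (e x).trans (polyAt_C _ x)⟩

variable {m : ℕ} {Ω : Set (Pt (m + 1))} {𝒯 : Finset (Finset (Pt (m + 1)))}

/-- A component, on a cell, of an element of `P_k(𝒯)` that is orthogonal to the divergences of
Raviart–Thomas fields is constant. -/
theorem exists_const_on_cell (hΩ : IsLipschitzDomain Ω) (h𝒯 : IsMesh Ω 𝒯) {k : ℕ}
    {q : L2V Ω} (hq : ∀ τ ∈ RT Ω 𝒯 k, formb τ q = 0) (i : Fin (m + 1))
    {Q : Finset (Pt (m + 1)) → Pt (m + 1) → ℂ} (hQp : ∀ T ∈ 𝒯, IsPoly k (Q T))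
    (hQ : ∀ T ∈ 𝒯, ∀ᵐ x ∂(volume.restrict Ω), x ∈ cell T → q x i = Q T x)
    {T : Finset (Pt (m + 1))} (hT : T ∈ 𝒯) : ∃ c, ∀ x ∈ cell T, Q T x = c := by
  classical
  -- For k = 0 the polynomial is already constant. The bubble argument needs k ≥ 1, so that λ_l
  -- times a derivative of Q has degree at most k.
  rcases k with _ | k
  · obtain ⟨c, hc⟩ := (hQp T hT).eq_const
    exact ⟨c, fun x _ => hc x⟩
  obtain ⟨b, hb⟩ := h𝒯.exists_basis hT
  have hcell : cell T = convexHull ℝ (range b) := by rw [hb]; rfl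
  have hQs : ContDiff ℝ ∞ (Q T) := (hQp T hT).contDiff
  have hgrad : ∀ x ∈ interior (cell T), fderiv ℝ (Q T) x = 0 := by
    rw [hcell]
    intro x hx
    refine fderiv_eq_zero_of_bubbles b hQs (fun l => ?_) hx
    have hpoly : IsPoly (k + 1) (fun x => ((b.coord l x : ℝ) : ℂ) * fderiv ℝ (Q T) x (b l)) :=
      ((isPoly_coord b l).mul ((hQp T hT).fderiv_apply (b l))).mono (by omega)
    set r : Finset (Pt (m + 1)) → Fin (m + 1) → Pt (m + 1) → ℂ := fun S =>
      if S = T then fun j x => ((b.coord l x : ℝ) : ℂ) * fderiv ℝ (Q T) x (b l)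
        * (((x j : ℝ) : ℂ) - ((b l j : ℝ) : ℂ)) else fun _ _ => 0 with hr
    have key := sum_integral_fdiv_eq_zero hΩ h𝒯 hq i (fun S hS => (hQp S hS).contDiff.continuous)
      hQ (r := r) ?_ ?_
    · rw [Finset.sum_eq_single T] at key
      · simpa only [hr, if_true, hcell] using key
      · intro S _ hS
        simp only [hr, if_neg hS, fdiv_zero, zero_mul, integral_zero]
      · exact fun h => absurd hT h
    · intro S _
      by_cases hS : S = T
      · simp only [hr, if_pos hS]
        exact IsRT.apex (k + 1) (b l) hpoly
      · simp only [hr, if_neg hS]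
        exact IsRT.zero
    · intro φ hφ _ _
      refine Finset.sum_eq_zero fun S _ => ?_
      by_cases hS : S = T
      · subst hS
        simp only [hr, if_true, hcell]
        refine integral_simplex_bubble b l ?_
          ((Complex.ofRealCLM.contDiff.comp hφ).of_le (by exact_mod_cast le_top))
        exact ((hQs.fderiv_right (m := ∞) (by simp)).clm_apply contDiff_const).of_le
          (by exact_mod_cast le_top)
      · simp only [hr, if_neg hS, zero_mul, fdiv_zero, integral_zero]
  have hconv : Convex ℝ (cell T) := convex_convexHull ℝ _
  obtain ⟨c, hc⟩ := isOpen_interior.exists_is_const_of_fderiv_eq_zero (𝕜 := ℝ)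
    hconv.interior.isPreconnected (hQs.differentiable (by simp)).differentiableOn hgrad
  refine ⟨c, ?_⟩
  have hne : (interior (cell T)).Nonempty := by
    rw [hcell]
    exact interior_convexHull_nonempty_iff_affineSpan_eq_top.2 b.tot
  have hcl : closure (interior (cell T)) = cell T := by
    rw [hconv.closure_interior_eq_closure_of_nonempty_interior hne,
      (isCompact_cell T).isClosed.closure_eq]
  have : EqOn (Q T) (fun _ => c) (closure (interior (cell T))) :=
    EqOn.closure hc hQs.continuous continuous_const
  rwa [hcl] at this

theorem integral_cornerSimplex_ne_zero (n : ℕ) {c : ℂ} (hc : c ≠ 0) :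
    ∫ _ in cornerSimplex n, c ≠ 0 := by
  rw [setIntegral_const]
  refine smul_ne_zero ?_ hc
  have hpos : volume (cornerSimplex n) ≠ 0 := by
    have hsub : univ.pi (fun _ : Fin n => Ioo (0 : ℝ) (1 / (n + 1))) ⊆ cornerSimplex n := by
      intro t ht
      refine ⟨fun i => (ht i (mem_univ i)).1.le, ?_⟩
      calc ∑ i, t i ≤ ∑ _ : Fin n, (1 / ((n : ℝ) + 1)) :=
            Finset.sum_le_sum fun i _ => (ht i (mem_univ i)).2.le
        _ = n / ((n : ℝ) + 1) := by simp; ring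
        _ ≤ 1 := by rw [div_le_one (by positivity)]; linarith
    refine (lt_of_lt_of_le ?_ (measure_mono hsub)).ne'
    refine (isOpen_set_pi finite_univ fun _ _ => isOpen_Ioo).measure_pos volume ?_
    exact univ_pi_nonempty_iff.2 fun _ => nonempty_Ioo.2 (by positivity)
  rw [measureReal_def]
  exact (ENNReal.toReal_pos hpos (isCompact_cornerSimplex n).measure_lt_top.ne).ne'

/-- The constants on two cells with a common face coincide. -/
theorem const_eq_of_adjacent (hΩ : IsLipschitzDomain Ω) (h𝒯 : IsMesh Ω 𝒯) {k : ℕ}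
    {q : L2V Ω} (hq : ∀ τ ∈ RT Ω 𝒯 k, formb τ q = 0) (i : Fin (m + 1))
    {Q : Finset (Pt (m + 1)) → Pt (m + 1) → ℂ} (hQc : ∀ T ∈ 𝒯, Continuous (Q T))
    (hQ : ∀ T ∈ 𝒯, ∀ᵐ x ∂(volume.restrict Ω), x ∈ cell T → q x i = Q T x)
    [DecidableEq (Pt (m + 1))]
    {T T' : Finset (Pt (m + 1))} (hT : T ∈ 𝒯) (hT' : T' ∈ 𝒯) (hne : T ≠ T')
    (hcard : (T ∩ T').card = m + 1) {c c' : ℂ} (hc : ∀ x ∈ cell T, Q T x = c)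
    (hc' : ∀ x ∈ cell T', Q T' x = c') : c = c' := by
  -- Both cells get the shared vertices in the same order, with the remaining vertex at index 0;
  -- thus `faceFlux` is literally the same for both.
  have hbasis : ∀ S ∈ 𝒯, T ∩ T' ⊆ S → ∃ b : AffineBasis (Fin (m + 1 + 1)) ℝ (Pt (m + 1)),
      cell S = convexHull ℝ (range b) ∧
        ∀ j : Fin (m + 1), b j.succ = ((T ∩ T').equivFinOfCardEq hcard).symm j := by
    intro S hS hsub
    obtain ⟨a, haS, ha⟩ : ∃ a ∈ S, a ∉ T ∩ T' := by
      by_contra! h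
      have := Finset.card_le_card (show S ⊆ T ∩ T' from h)
      rw [h𝒯.card S hS, hcard] at this
      omega
    let e := ((T ∩ T').equivFinOfCardEq hcard).symm
    let f : Fin (m + 1 + 1) → Pt (m + 1) := Fin.cons a fun j => (e j : Pt (m + 1))
    have hf : Function.Injective f := by
      rw [Fin.cons_injective_iff]
      refine ⟨?_, fun _ _ h => e.injective (Subtype.ext h)⟩
      rintro ⟨j, hj⟩
      exact ha (hj ▸ (e j).2)
    have hfS : ∀ j, f j ∈ S := by
      refine Fin.cases haS fun j => hsub (e j).2
    obtain ⟨b, hb⟩ := exists_affineBasis_eq (h𝒯.indep S hS) f hf hfS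
    refine ⟨b, ?_, fun j => hb _⟩
    rw [show (b : Fin (m + 1 + 1) → Pt (m + 1)) = f from funext hb,
      range_eq_of_card (h𝒯.card S hS) hf hfS]
    rfl
  obtain ⟨b, hcell, hby⟩ := hbasis T hT Finset.inter_subset_left
  obtain ⟨b', hcell', hby'⟩ := hbasis T' hT' Finset.inter_subset_right
  set y : Fin (m + 1) → Pt (m + 1) := fun j => ((T ∩ T').equivFinOfCardEq hcard).symm j with hy
  have hbf : (fun j : Fin (m + 1) => b j.succ) = y := funext hby
  have hbf' : (fun j : Fin (m + 1) => b' j.succ) = y := funext hby'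
  set κ : ℝ := |(chartLin b).det| with hκ
  set κ' : ℝ := |(chartLin b').det| with hκ'
  have hκ0 : (κ : ℂ) ≠ 0 := Complex.ofReal_ne_zero.2 (abs_ne_zero.2 (det_chartLin_ne_zero b))
  have hκ0' : (κ' : ℂ) ≠ 0 := Complex.ofReal_ne_zero.2 (abs_ne_zero.2 (det_chartLin_ne_zero b'))
  -- Each piece points away from the vertex opposite the common face and has no flux through the
  -- other faces of its cell. Dividing by the determinants and changing one sign makes the fluxes
  -- through the common face cancel. The divergences are constants of opposite sign, and their
  -- integrals over the two cells are opposite as well, so orthogonality compares c with c'.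
  set r : Finset (Pt (m + 1)) → Fin (m + 1) → Pt (m + 1) → ℂ := fun S =>
    if S = T then fun j x => (κ : ℂ)⁻¹ * (((x j : ℝ) : ℂ) - ((b 0 j : ℝ) : ℂ))
    else if S = T' then fun j x => -(κ' : ℂ)⁻¹ * (((x j : ℝ) : ℂ) - ((b' 0 j : ℝ) : ℂ))
    else fun _ _ => 0 with hr
  have hrT : r T = fun j x => (κ : ℂ)⁻¹ * (((x j : ℝ) : ℂ) - ((b 0 j : ℝ) : ℂ)) := by
    simp only [hr, if_true]
  have hrT' : r T' = fun j x => -(κ' : ℂ)⁻¹ * (((x j : ℝ) : ℂ) - ((b' 0 j : ℝ) : ℂ)) := by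
    simp only [hr, if_neg hne.symm, if_true]
  have hr0 : ∀ S, S ≠ T ∧ S ≠ T' → r S = fun _ _ => 0 := fun S hS => by
    simp only [hr, if_neg hS.1, if_neg hS.2]
  have hcs : ∀ (a : Pt (m + 1)) (j : Fin (m + 1)),
      ContDiff ℝ 1 (fun x : Pt (m + 1) => ((x j : ℝ) : ℂ) - ((a j : ℝ) : ℂ)) := fun a j =>
    (contDiff_coordC_sub a j).of_le (by exact_mod_cast le_top)
  have key := sum_integral_fdiv_eq_zero hΩ h𝒯 hq i hQc hQ (r := r) ?_ ?_
  · rw [Finset.sum_eq_add_of_mem T T' hT hT' hne] at key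
    · have e1 : ∫ x in cell T, fdiv (r T) x * conj (Q T x)
          = (m + 1 : ℕ) * ∫ _ in cornerSimplex (m + 1), conj c := by
        rw [setIntegral_congr_fun (g := fun _ => (κ : ℂ)⁻¹ * (m + 1 : ℕ) * conj c)
          (isCompact_cell T).measurableSet, hcell, setIntegral_simplex_eq, ← hκ,
          ← integral_const_mul, ← integral_smul]
        · congr 1
          funext t
          rw [Complex.real_smul]
          field_simp
        · intro x hx
          simp only [hrT, fdiv_const_mul (hcs (b 0)), fdiv_id_sub, hc x hx]
      have e2 : ∫ x in cell T', fdiv (r T') x * conj (Q T' x)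
          = -((m + 1 : ℕ) * ∫ _ in cornerSimplex (m + 1), conj c') := by
        rw [setIntegral_congr_fun (g := fun _ => -(κ' : ℂ)⁻¹ * (m + 1 : ℕ) * conj c')
          (isCompact_cell T').measurableSet, hcell', setIntegral_simplex_eq, ← hκ',
          ← integral_const_mul, ← integral_smul, ← integral_neg]
        · congr 1
          funext t
          rw [Complex.real_smul]
          field_simp
        · intro x hx
          simp only [hrT', fdiv_const_mul (hcs (b' 0)), fdiv_id_sub, hc' x hx]
      rw [e1, e2, ← sub_eq_add_neg, ← mul_sub, setIntegral_const, setIntegral_const, ← smul_sub,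
        ← setIntegral_const] at key
      by_contra hcc
      refine integral_cornerSimplex_ne_zero (m + 1) (c := conj c - conj c') ?_
        ((mul_eq_zero.1 key).resolve_left (by exact_mod_cast (Nat.succ_ne_zero m)))
      rw [← map_sub]
      exact (map_ne_zero _).2 (sub_ne_zero.2 hcc)
    · intro S _ hS
      simp only [hr0 S hS, fdiv_zero, zero_mul, integral_zero]
  · intro S _
    by_cases h1 : S = T
    · rw [h1, hrT]; exact IsRT.apex k (b 0) (IsPoly.const _)
    by_cases h2 : S = T'
    · rw [h2, hrT']; exact IsRT.apex k (b' 0) (IsPoly.const _)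
    · rw [hr0 S ⟨h1, h2⟩]; exact IsRT.zero
  · intro φ hφ _ _
    have hφ' : ContDiff ℝ 1 (fun x => ((φ x : ℝ) : ℂ)) :=
      (Complex.ofRealCLM.contDiff.comp hφ).of_le (by exact_mod_cast le_top)
    rw [Finset.sum_eq_add_of_mem T T' hT hT' hne]
    · have e1 : ∫ x in cell T, fdiv (fun j x => r T j x * ((φ x : ℝ) : ℂ)) x
          = faceFlux y (fun x => ((φ x : ℝ) : ℂ)) := by
        simp only [hrT, mul_assoc]
        simp only [fdiv_const_mul fun j => (hcs (b 0) j).mul hφ']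
        rw [integral_const_mul, hcell, integral_simplex_apex b hφ', hbf, Complex.real_smul,
          inv_mul_cancel_left₀ hκ0]
      have e2 : ∫ x in cell T', fdiv (fun j x => r T' j x * ((φ x : ℝ) : ℂ)) x
          = -faceFlux y (fun x => ((φ x : ℝ) : ℂ)) := by
        simp only [hrT', mul_assoc]
        simp only [fdiv_const_mul fun j => (hcs (b' 0) j).mul hφ']
        rw [integral_const_mul, hcell', integral_simplex_apex b' hφ', hbf', Complex.real_smul,
          neg_mul, inv_mul_cancel_left₀ hκ0']
      rw [e1, e2, add_neg_cancel]
    · intro S _ hS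
      simp only [hr0 S hS, zero_mul, fdiv_zero, integral_zero]

end Orthogonality

/-! ### Propagating constants around the skeleton of codimension two -/

section Orthogonality

/-- Such a y lies on the line through x₀ and a point z ≠ x₀ of the simplex, hence in the affine span
of S and x₀. These are at most n points, so their span is a null set. -/
theorem volume_cone_eq_zero {n : ℕ} {S : Finset (Pt n)} (hS : S.card < n) {x₀ : Pt n}
    (hx₀ : x₀ ∉ convexHull ℝ (S : Set (Pt n))) :
    volume {y | ∃ z ∈ segment ℝ x₀ y, z ∈ convexHull ℝ (S : Set (Pt n))} = 0 := by
  classical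
  refine measure_mono_null ?_ (volume_affineSpan_eq_zero (S := insert x₀ S)
    ((Finset.card_insert_le _ _).trans hS))
  rintro y ⟨z, hz, hzS⟩
  rw [segment_eq_image_lineMap] at hz
  obtain ⟨t, -, rfl⟩ := hz
  have ht : t ≠ 0 := by
    rintro rfl
    rw [AffineMap.lineMap_apply_zero] at hzS
    exact hx₀ hzS
  have h1 : x₀ ∈ affineSpan ℝ ((insert x₀ S : Finset (Pt n)) : Set (Pt n)) :=
    subset_affineSpan _ _ (by simp)
  have h2 : AffineMap.lineMap x₀ y t ∈ affineSpan ℝ ((insert x₀ S : Finset (Pt n)) : Set (Pt n)) :=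
    affineSpan_mono ℝ (by simp) (convexHull_subset_affineSpan _ hzS)
  have h3 := AffineMap.lineMap_mem t⁻¹ h1 h2
  rw [AffineMap.lineMap_apply, AffineMap.lineMap_apply] at h3
  simpa [smul_smul, inv_mul_cancel₀ ht] using h3

/-- The union of the simplices spanned by fewer than `n` vertices of a cell. -/
def lowSkeleton {n : ℕ} (𝒯 : Finset (Finset (Pt n))) : Set (Pt n) :=
  {x | ∃ T ∈ 𝒯, ∃ S ⊆ T, S.card < n ∧ x ∈ convexHull ℝ (S : Set (Pt n))}

theorem ae_of_forall_lowSkeleton {n : ℕ} {𝒯 : Finset (Finset (Pt n))} {P : Finset (Pt n) → Pt n → Prop}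
    (h : ∀ S : Finset (Pt n), (∃ T ∈ 𝒯, S ⊆ T ∧ S.card < n) → ∀ᵐ x, P S x) :
    ∀ᵐ x, ∀ T ∈ 𝒯, ∀ S ⊆ T, S.card < n → P S x := by
  have h1 : ∀ T ∈ 𝒯, ∀ᵐ x, ∀ S ∈ T.powerset, S.card < n → P S x := fun T hT => by
    refine (ae_ball_iff T.powerset.countable_toSet).2 fun S hS => ?_
    by_cases hc : S.card < n
    · filter_upwards [h S ⟨T, hT, Finset.mem_powerset.1 hS, hc⟩] with x hx _ using hx
    · exact Filter.Eventually.of_forall fun x hx => absurd hx hc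
  have h2 := (ae_ball_iff 𝒯.countable_toSet).2 h1
  filter_upwards [h2] with x hx T hT S hS
  exact hx T hT S (Finset.mem_powerset.2 hS)

theorem ae_notMem_lowSkeleton {n : ℕ} (𝒯 : Finset (Finset (Pt n))) :
    ∀ᵐ x, x ∉ lowSkeleton 𝒯 := by
  have := ae_of_forall_lowSkeleton (𝒯 := 𝒯) (P := fun S x => x ∉ convexHull ℝ (S : Set (Pt n)))
    fun S ⟨_, _, _, hS⟩ => measure_eq_zero_iff_ae_notMem.1 (volume_convexHull_eq_zero hS.le)
  filter_upwards [this] with x hx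
  rintro ⟨T, hT, S, hS, hc, hxS⟩
  exact hx T hT S hS hc hxS

theorem ae_segment_disjoint_lowSkeleton {n : ℕ} {𝒯 : Finset (Finset (Pt n))} {x₀ : Pt n}
    (hx₀ : x₀ ∉ lowSkeleton 𝒯) : ∀ᵐ y, ∀ z ∈ segment ℝ x₀ y, z ∉ lowSkeleton 𝒯 := by
  have := ae_of_forall_lowSkeleton (𝒯 := 𝒯)
    (P := fun S y => ¬ ∃ z ∈ segment ℝ x₀ y, z ∈ convexHull ℝ (S : Set (Pt n)))
    fun S ⟨T, hT, hST, hS⟩ => measure_eq_zero_iff_ae_notMem.1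
      (volume_cone_eq_zero hS fun h => hx₀ ⟨T, hT, S, hST, hS, h⟩)
  filter_upwards [this] with y hy z hz
  rintro ⟨T, hT, S, hS, hc, hzS⟩
  exact hy T hT S hS hc ⟨z, hz, hzS⟩

/-- A function that is constant on each cell, with equal constants on cells with a common face, is
locally almost everywhere constant. -/
theorem locally_ae_const_of_adjacent {n : ℕ} {Ω : Set (Pt n)} {𝒯 : Finset (Finset (Pt n))}
    [DecidableEq (Pt n)]
    (hΩ : IsOpen Ω) (h𝒯 : IsMesh Ω 𝒯) {f : Pt n → ℂ} {cc : Finset (Pt n) → ℂ}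
    (hf : ∀ᵐ x ∂(volume.restrict Ω), ∀ T ∈ 𝒯, x ∈ cell T → f x = cc T)
    (hcc : ∀ T ∈ 𝒯, ∀ T' ∈ 𝒯, T ≠ T' → (T ∩ T').card = n → cc T = cc T')
    {x : Pt n} (hx : x ∈ Ω) : ∃ r > 0, ∃ c, ∀ᵐ y, y ∈ Metric.ball x r → f y = c := by
  obtain ⟨r, hr, hball⟩ := Metric.isOpen_iff.1 hΩ x hx
  have hex : ∀ y ∈ Ω, ∃ T ∈ 𝒯, y ∈ cell T := fun y hy => by
    obtain ⟨T, hT, hyT⟩ := mem_iUnion₂.1 (h𝒯.subset_cells hy)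
    exact ⟨T, hT, hyT⟩
  -- A point on a face lies in several cells, and S picks one of them. Off `lowSkeleton` the choice
  -- does not affect the constant: two cells containing such a point share n vertices or coincide
  -- (`hcomm`).
  choose! S hS hmem using hex
  have hcomm : ∀ y ∉ lowSkeleton 𝒯, ∀ T ∈ 𝒯, ∀ T' ∈ 𝒯, y ∈ cell T → y ∈ cell T' →
      cc T = cc T' := by
    intro y hy T hT T' hT' h1 h2
    by_cases hne : T = T'
    · rw [hne]
    refine hcc T hT T' hT' hne (le_antisymm (h𝒯.card_inter_le hT hT' hne) ?_)
    by_contra! hlt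
    refine hy ⟨T, hT, T ∩ T', Finset.inter_subset_left, hlt, ?_⟩
    rw [Finset.coe_inter, ← h𝒯.conforming T hT T' hT']
    exact ⟨h1, h2⟩
  have hloc : ∀ y ∈ Ω, y ∉ lowSkeleton 𝒯 →
      ∀ᶠ z in 𝓝 y, z ∈ Ω → cc (S z) = cc (S y) := by
    intro y hy hyN
    have h1 : ∀ᶠ z in 𝓝 y, ∀ T ∈ 𝒯, z ∈ cell T → y ∈ cell T := by
      rw [Filter.eventually_all_finset]
      intro T _
      by_cases hyT : y ∈ cell T
      · exact Filter.Eventually.of_forall fun _ _ => hyT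
      · filter_upwards [(isCompact_cell T).isClosed.isOpen_compl.mem_nhds hyT] with z hz h
        exact absurd h hz
    filter_upwards [h1] with z hz hzΩ
    exact hcomm y hyN _ (hS z hzΩ) _ (hS y hy) (hz _ (hS z hzΩ) (hmem z hzΩ)) (hmem y hy)
  -- Fix a base point of the ball off the skeleton. For almost every y the segment from it to y
  -- avoids the skeleton, so the cell constant is locally constant along this segment.
  have hpos : volume (Metric.ball x r) ≠ 0 := (Metric.measure_ball_pos _ _ hr).ne'
  obtain ⟨x₀, hx₀, hx₀N⟩ :=
    ((frequently_ae_mem_iff.2 hpos).and_eventually (ae_notMem_lowSkeleton 𝒯)).exists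
  refine ⟨r, hr, cc (S x₀), ?_⟩
  filter_upwards [ae_segment_disjoint_lowSkeleton hx₀N,
    (ae_restrict_iff' hΩ.measurableSet).1 hf] with y hseg hfy hy
  rw [hfy (hball hy) _ (hS y (hball hy)) (hmem y (hball hy))]
  have hsub : ∀ z ∈ segment ℝ x₀ y, z ∈ Ω := fun z hz =>
    hball ((convex_ball x r).segment_subset hx₀ hy hz)
  have : PreconnectedSpace (segment ℝ x₀ y) :=
    isPreconnected_iff_preconnectedSpace.1 (convex_segment x₀ y).isPreconnected
  have hlc : IsLocallyConstant (fun z : segment ℝ x₀ y => cc (S z)) := by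
    rw [IsLocallyConstant.iff_eventually_eq]
    intro z
    filter_upwards [continuous_subtype_val.continuousAt.eventually
      (hloc z (hsub z z.2) (hseg z z.2))] with w hw
    exact hw (hsub w w.2)
  exact hlc.apply_eq_of_preconnectedSpace ⟨y, right_mem_segment ℝ x₀ y⟩
    ⟨x₀, left_mem_segment ℝ x₀ y⟩

theorem integral_fderiv_eq_zero {n : ℕ} {E : Type*} [NormedAddCommGroup E] [NormedSpace ℝ E]
    [CompleteSpace E] {G : Pt n → E} (hG : ContDiff ℝ 1 G)
    (hc : HasCompactSupport G) (v : Pt n) : ∫ x, fderiv ℝ G x v = 0 := by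
  have hd : Integrable (fun x => fderiv ℝ G x v) :=
    ((hG.continuous_fderiv (by simp)).clm_apply continuous_const).integrable_of_hasCompactSupport
      (hc.fderiv_apply ℝ v)
  have := integral_smul_fderiv_eq_neg_fderiv_smul_of_integrable (𝕜 := ℝ)
    (μ := (volume : Measure (Pt n))) (f := fun _ => (1 : ℝ)) (g := G) (v := v) (by simp)
    (by simpa using hd) (by simpa using hG.continuous.integrable_of_hasCompactSupport hc)
    (by fun_prop) (fun x _ => hG.differentiable (by simp) x)
  simpa using this

theorem integral_fdiv_eq_zero {n : ℕ} {Ω : Set (Pt n)} {r : Fin n → Pt n → ℂ}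
    (hr : ∀ j, ContDiff ℝ 1 (r j)) {φ : Pt n → ℝ} (hφ : ContDiff ℝ 1 φ)
    (hφc : HasCompactSupport φ) (hφs : tsupport φ ⊆ Ω) :
    ∫ x in Ω, fdiv (fun j x => r j x * ((φ x : ℝ) : ℂ)) x = 0 := by
  have hsm : ∀ j, ContDiff ℝ 1 (fun x => r j x * ((φ x : ℝ) : ℂ)) := fun j =>
    (hr j).mul (Complex.ofRealCLM.contDiff.comp hφ)
  have hsupp : ∀ j, tsupport (fun x => r j x * ((φ x : ℝ) : ℂ)) ⊆ tsupport φ := fun j =>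
    closure_mono fun x hx h => hx (by simp [h])
  have hcs : ∀ j, HasCompactSupport (fun x => r j x * ((φ x : ℝ) : ℂ)) := fun j =>
    hφc.of_isClosed_subset (isClosed_tsupport _) (hsupp j)
  rw [setIntegral_eq_integral_of_forall_compl_eq_zero]
  · simp only [fdiv]
    rw [integral_finsetSum]
    · exact Finset.sum_eq_zero fun j _ => integral_fderiv_eq_zero (hsm j) (hcs j) _
    · intro j _
      exact (((hsm j).continuous_fderiv
        (by simp)).clm_apply continuous_const).integrable_of_hasCompactSupport
        ((hcs j).fderiv_apply ℝ _)
  · intro x hx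
    refine Finset.sum_eq_zero fun j _ => ?_
    have : fderiv ℝ (fun x => r j x * ((φ x : ℝ) : ℂ)) x = 0 :=
      image_eq_zero_of_notMem_tsupport fun h =>
        hx (hφs (hsupp j (tsupport_fderiv_subset ℝ h)))
    rw [this]; rfl

variable {m : ℕ} {Ω : Set (Pt (m + 1))} {𝒯 : Finset (Finset (Pt (m + 1)))}

/-- Each component is constant on cells, then equal on adjacent cells, then constant on the
connected set Ω; a last global test field shows that this constant is zero. -/
theorem eq_zero_of_orthogonal (hΩ : IsLipschitzDomain Ω) (h𝒯 : IsMesh Ω 𝒯) {k : ℕ}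
    {q : L2V Ω} (hqQ : q ∈ Qh Ω 𝒯 k) (hq : ∀ τ ∈ RT Ω 𝒯 k, formb τ q = 0) : q = 0 := by
  classical
  have hcomp : ∀ i, ∀ᵐ x ∂(volume.restrict Ω), q x i = 0 := by
    intro i
    choose! p hp hpe using fun T hT => hqQ T hT i
    have hQp : ∀ T ∈ 𝒯, IsPoly k (polyAt (p T)) := fun T hT => ⟨p T, hp T hT, fun _ => rfl⟩
    choose! cc hcc using fun T (hT : T ∈ 𝒯) => exists_const_on_cell hΩ h𝒯 hq i hQp hpe hT
    have hf : ∀ᵐ x ∂(volume.restrict Ω), ∀ T ∈ 𝒯, x ∈ cell T → q x i = cc T := by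
      refine (ae_ball_iff 𝒯.countable_toSet).2 fun T hT => ?_
      filter_upwards [hpe T hT] with x hx hxT
      rw [hx hxT, hcc T hT x hxT]
    obtain ⟨c, hc⟩ := ae_const_of_locally hΩ.isOpen hΩ.isConnected fun x hx =>
      locally_ae_const_of_adjacent hΩ.isOpen h𝒯 hf (fun T hT T' hT' hne hcard =>
        const_eq_of_adjacent hΩ h𝒯 hq i (fun T hT => (hQp T hT).contDiff.continuous) hpe hT hT'
          hne hcard (hcc T hT) (hcc T' hT')) hx
    have hrc : ∀ j : Fin (m + 1), ContDiff ℝ ∞ (fun x : Pt (m + 1) =>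
        (1 : ℂ) * (((x j : ℝ) : ℂ) - (((0 : Pt (m + 1)) j : ℝ) : ℂ))) := fun j =>
      contDiff_const.mul (contDiff_coordC_sub 0 j)
    have hrc1 := fun j => (hrc j).of_le (m := 1) (by exact_mod_cast le_top)
    -- The field x is smooth across all faces and has constant divergence n, so orthogonality says
    -- that n |Ω| conj c = 0.
    have key := sum_integral_fdiv_eq_zero hΩ h𝒯 hq i (Q := fun _ _ => c)
      (fun _ _ => continuous_const) (fun T _ => by filter_upwards [hc] with x hx _ using hx)
      (r := fun _ j x => (1 : ℂ) * (((x j : ℝ) : ℂ) - (((0 : Pt (m + 1)) j : ℝ) : ℂ)))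
      (fun T _ => IsRT.apex k 0 (IsPoly.const 1)) (fun φ hφ hφc hφs => by
        have hφ1 : ContDiff ℝ 1 φ := hφ.of_le (by exact_mod_cast le_top)
        rw [← h𝒯.integral_eq_sum hΩ, integral_fdiv_eq_zero hrc1 hφ1 hφc hφs]
        intro T _
        exact integrableOn_fdiv (fun j => (hrc1 j).mul (Complex.ofRealCLM.contDiff.comp hφ1)) T)
    have hdiv : ∀ x, fdiv (fun j (x : Pt (m + 1)) =>
        (1 : ℂ) * (((x j : ℝ) : ℂ) - (((0 : Pt (m + 1)) j : ℝ) : ℂ))) x = (m + 1 : ℕ) := fun x => by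
      simp only [one_mul]; exact fdiv_id_sub 0 x
    simp only [hdiv] at key
    rw [← h𝒯.integral_eq_sum hΩ fun T _ =>
      integrableOn_of_continuous continuous_const (isCompact_cell T), setIntegral_const] at key
    have hc0 : c = 0 := by
      have h1 := (smul_eq_zero.1 key).resolve_left hΩ.volume_real_ne_zero
      have h2 := (mul_eq_zero.1 h1).resolve_left (by exact_mod_cast Nat.succ_ne_zero m)
      exact (map_eq_zero _).1 h2
    filter_upwards [hc] with x hx
    rw [hx, hc0]
  refine Lp.ext ?_
  filter_upwards [ae_all_iff.2 hcomp, Lp.coeFn_zero (Vec (m + 1)) 2 (volume.restrict Ω)]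
    with x hx h0
  rw [h0]
  ext i
  exact hx i

end Orthogonality

/-! ### The discrete spaces -/

section Spaces

variable {n : ℕ} {Ω : Set (Pt n)} {𝒯 : Finset (Finset (Pt n))}

theorem IsLipschitzDomain.isFiniteMeasure (hΩ : IsLipschitzDomain Ω) :
    IsFiniteMeasure (volume.restrict Ω) :=
  ⟨by rw [Measure.restrict_apply_univ]; exact hΩ.isBounded.measure_lt_top⟩

theorem mem_BDM_iff {m : ℕ} {τ : L2T Ω} :
    τ ∈ BDM Ω 𝒯 m ↔ τ ∈ hdivSubmodule Ω ∧ τ ∈ pwPoly Ω 𝒯 (Fin n × Fin n) m :=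
  ⟨fun h => ⟨h.1, fun T hT p => h.2 T hT p.1 p.2⟩, fun h => ⟨h.1, fun T hT i j => h.2 T hT (i, j)⟩⟩

theorem RT_subset_BDM (k : ℕ) : RT Ω 𝒯 k ⊆ BDM Ω 𝒯 (k + 1) := by
  rintro τ ⟨h, hτ⟩
  refine ⟨h, fun T hT i j => ?_⟩
  obtain ⟨p, q, hp, hq, e⟩ := hτ T hT i
  refine ⟨p j + q * MvPolynomial.X j, ?_, ?_⟩
  · refine (MvPolynomial.totalDegree_add _ _).trans (max_le ((hp j).trans k.le_succ) ?_)
    refine (MvPolynomial.totalDegree_mul _ _).trans (add_le_add hq ?_)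
    simp
  · filter_upwards [e] with x hx hxT
    rw [hx hxT, polyAt_add, polyAt_mul, polyAt_X]

theorem Hh_subset_BDM (k : ℕ) (F : Family) : Hh Ω 𝒯 k F ⊆ BDM Ω 𝒯 (k + 1) := by
  cases F
  · exact RT_subset_BDM k
  · exact Subset.rfl

theorem RT_subset_Hh (k : ℕ) (F : Family) : RT Ω 𝒯 k ⊆ Hh Ω 𝒯 k F := by
  cases F
  · exact Subset.rfl
  · exact RT_subset_BDM k

/-- The Raviart–Thomas space as a subspace. -/
def rtSubmodule (Ω : Set (Pt n)) (𝒯 : Finset (Finset (Pt n))) (k : ℕ) : Submodule ℂ (L2T Ω) where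
  carrier := RT Ω 𝒯 k
  zero_mem' := by
    refine ⟨(hdivSubmodule Ω).zero_mem, fun T _ i => ⟨fun _ => 0, 0, by simp, by simp, ?_⟩⟩
    filter_upwards [Lp.coeFn_zero (Tens n) 2 (volume.restrict Ω)] with x hx _ j
    rw [hx]; simp [polyAt_zero]
  add_mem' := by
    rintro σ τ ⟨hσ, hσ'⟩ ⟨hτ, hτ'⟩
    refine ⟨(hdivSubmodule Ω).add_mem hσ hτ, fun T hT i => ?_⟩
    obtain ⟨p, q, hp, hq, e⟩ := hσ' T hT i
    obtain ⟨p', q', hp', hq', e'⟩ := hτ' T hT i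
    refine ⟨fun j => p j + p' j, q + q', fun j => (MvPolynomial.totalDegree_add _ _).trans
      (max_le (hp j) (hp' j)), (MvPolynomial.totalDegree_add _ _).trans (max_le hq hq'), ?_⟩
    filter_upwards [e, e', Lp.coeFn_add σ τ] with x h1 h2 h3 hx j
    rw [h3, Pi.add_apply, PiLp.add_apply, h1 hx, h2 hx, polyAt_add, polyAt_add]
    ring
  smul_mem' := by
    rintro c σ ⟨hσ, hσ'⟩
    refine ⟨(hdivSubmodule Ω).smul_mem c hσ, fun T hT i => ?_⟩
    obtain ⟨p, q, hp, hq, e⟩ := hσ' T hT i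
    refine ⟨fun j => c • p j, c • q, fun j => (MvPolynomial.totalDegree_smul_le _ _).trans (hp j),
      (MvPolynomial.totalDegree_smul_le _ _).trans hq, ?_⟩
    filter_upwards [e, Lp.coeFn_smul c σ] with x h1 h3 hx j
    rw [h3, Pi.smul_apply, PiLp.smul_apply, h1 hx, polyAt_smul, polyAt_smul, smul_eq_mul]
    ring

/-- The space `H_h` as a subspace. -/
def hhSubmodule (Ω : Set (Pt n)) (𝒯 : Finset (Finset (Pt n))) (k : ℕ) :
    Family → Submodule ℂ (L2T Ω)
  | .rt => rtSubmodule Ω 𝒯 k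
  | .bdm => hdivSubmodule Ω ⊓ pwPoly Ω 𝒯 (Fin n × Fin n) (k + 1)

theorem mem_hhSubmodule {k : ℕ} {F : Family} {τ : L2T Ω} :
    τ ∈ hhSubmodule Ω 𝒯 k F ↔ τ ∈ Hh Ω 𝒯 k F := by
  cases F
  · exact Iff.rfl
  · exact mem_BDM_iff.symm

theorem integrable_tr (hΩ : IsLipschitzDomain Ω) (τ : L2T Ω) :
    Integrable (fun x => tr (τ x)) (volume.restrict Ω) := by
  have := hΩ.isFiniteMeasure
  simpa only [trL_apply] using trL.integrable_comp ((Lp.memLp τ).integrable (by norm_num))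

/-- The integral of the trace. -/
def trInt (hΩ : IsLipschitzDomain Ω) : L2T Ω →ₗ[ℂ] ℂ where
  toFun τ := ∫ x in Ω, tr (τ x)
  map_add' σ τ := by
    rw [← integral_add (integrable_tr hΩ σ) (integrable_tr hΩ τ)]
    refine integral_congr_ae ?_
    filter_upwards [Lp.coeFn_add σ τ] with x hx
    rw [hx, Pi.add_apply, ← trL_apply, map_add, trL_apply, trL_apply]
  map_smul' c τ := by
    rw [RingHom.id_apply, smul_eq_mul, ← integral_const_mul]
    refine integral_congr_ae ?_
    filter_upwards [Lp.coeFn_smul c τ] with x hx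
    rw [hx, Pi.smul_apply, ← trL_apply, map_smul, trL_apply, smul_eq_mul]

/-- The space `H_{0,h}` as a subspace. -/
def h0Submodule (hΩ : IsLipschitzDomain Ω) (𝒯 : Finset (Finset (Pt n))) (k : ℕ) (F : Family) :
    Submodule ℂ (L2T Ω) := hhSubmodule Ω 𝒯 k F ⊓ LinearMap.ker (trInt hΩ)

theorem mem_h0Submodule {hΩ : IsLipschitzDomain Ω} {k : ℕ} {F : Family} {τ : L2T Ω} :
    τ ∈ h0Submodule hΩ 𝒯 k F ↔ τ ∈ H0h Ω 𝒯 k F :=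
  and_congr mem_hhSubmodule Iff.rfl

theorem h0Submodule_le_hdiv (hΩ : IsLipschitzDomain Ω) (k : ℕ) (F : Family) :
    h0Submodule hΩ 𝒯 k F ≤ hdivSubmodule Ω := fun _ h =>
  (Hh_subset_BDM k F (mem_hhSubmodule.1 h.1)).1

theorem finiteDimensional_h0 (hΩ : IsLipschitzDomain Ω) (h𝒯 : IsMesh Ω 𝒯) (k : ℕ) (F : Family) :
    FiniteDimensional ℂ (h0Submodule hΩ 𝒯 k F) := by
  have := finiteDimensional_pwPoly h𝒯.subset_cells hΩ.isOpen.measurableSet (Fin n × Fin n) (k + 1)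
  refine Submodule.finiteDimensional_of_le
    (S₂ := pwPoly Ω 𝒯 (Fin n × Fin n) (k + 1)) fun τ h => ?_
  exact (mem_BDM_iff.1 (Hh_subset_BDM k F (mem_hhSubmodule.1 h.1))).2

/-- The divergence on `H_{0,h}`. -/
def h0Div (hΩ : IsLipschitzDomain Ω) (𝒯 : Finset (Finset (Pt n))) (k : ℕ) (F : Family) :
    h0Submodule hΩ 𝒯 k F →ₗ[ℂ] L2V Ω :=
  (wdivLin hΩ.isOpen).comp (Submodule.inclusion (h0Submodule_le_hdiv hΩ k F))

/-- Test functions supported in the interior of a cell identify the weak divergence there with the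
classical divergence of the polynomial row, and the frontier of a cell is a null set. This makes div
σ admissible as a discrete test function in the stability estimate. -/
theorem wdiv_mem_Qh (hΩ : IsLipschitzDomain Ω) (h𝒯 : IsMesh Ω 𝒯) {k : ℕ} {τ : L2T Ω}
    (hτ : τ ∈ BDM Ω 𝒯 (k + 1)) : wdiv τ ∈ Qh Ω 𝒯 k := by
  intro T hT i
  choose p hp hpe using hτ.2 T hT i
  set r : Fin n → Pt n → ℂ := fun j => polyAt (p j) with hr
  have hrp : ∀ j, IsPoly (k + 1) (r j) := fun j => ⟨p j, hp j, fun _ => rfl⟩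
  have hrc : ∀ j, ContDiff ℝ 1 (r j) := fun j =>
    (hrp j).contDiff.of_le (by exact_mod_cast le_top)
  obtain ⟨d, hd, hde⟩ := isPoly_fdiv hrp
  refine ⟨d, hd, ?_⟩
  have hOΩ : interior (cell T) ⊆ Ω := h𝒯.interior_cell_subset hΩ hT
  have := hΩ.isFiniteMeasure
  have hwint : IntegrableOn (fun x => wdiv τ x i) Ω :=
    (memLp_coord (wdiv τ) i).integrable (by norm_num)
  have hdint : IntegrableOn (fdiv r) (interior (cell T)) :=
    (integrableOn_fdiv hrc T).mono_set interior_subset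
  have key := (isOpen_interior (s := cell T)).ae_eq_zero_of_integral_contDiff_smul_eq_zero
    (μ := (volume : Measure (Pt n))) (f := fun x => wdiv τ x i - fdiv r x)
    ((hwint.mono_set hOΩ).locallyIntegrableOn.sub hdint.locallyIntegrableOn) ?_
  · have hfr : ∀ᵐ x, x ∉ frontier (cell T) :=
      measure_eq_zero_iff_ae_notMem.1 (volume_frontier_cell T)
    refine ae_restrict_of_ae ?_
    filter_upwards [key, hfr] with x hx hx' hxT
    have hxi : x ∈ interior (cell T) := by
      by_contra h
      exact hx' ⟨subset_closure hxT, h⟩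
    rw [sub_eq_zero.1 (hx hxi), hde]
  · intro g hg hgc hgs
    have hgΩ := hgs.trans hOΩ
    have hg1 : ContDiff ℝ 1 g := hg.of_le (by exact_mod_cast le_top)
    have hgC : ContDiff ℝ 1 (fun x => ((g x : ℝ) : ℂ)) := Complex.ofRealCLM.contDiff.comp hg1
    have h1 := isWeakDiv_wdiv hτ.1 g hg hgc hgΩ i
    have h2 : ∫ x in Ω, ∑ j, τ x (i, j) * ((fderiv ℝ g x (EuclideanSpace.single j 1) : ℝ) : ℂ)
        = ∫ x in Ω, ∑ j, r j x * ((fderiv ℝ g x (EuclideanSpace.single j 1) : ℝ) : ℂ) := by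
      refine integral_congr_ae ?_
      filter_upwards [ae_all_iff.2 hpe] with x hx
      refine Finset.sum_congr rfl fun j _ => ?_
      by_cases hxT : x ∈ cell T
      · rw [hx j hxT]
      · have : fderiv ℝ g x = 0 := image_eq_zero_of_notMem_tsupport fun h =>
          hxT (interior_subset (hgs (tsupport_fderiv_subset ℝ h)))
        rw [this]; simp
    have h3 := integral_fdiv_eq_zero hrc hg1 hgc hgΩ
    have h4 : ∀ x, fdiv (fun j x => r j x * ((g x : ℝ) : ℂ)) x
        = ∑ j, r j x * ((fderiv ℝ g x (EuclideanSpace.single j 1) : ℝ) : ℂ)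
          + fdiv r x * ((g x : ℝ) : ℂ) := fun x => by
      rw [fdiv_mul hrc hgC]
      congr 1
      refine Finset.sum_congr rfl fun j _ => ?_
      have hfd : fderiv ℝ (fun x => ((g x : ℝ) : ℂ)) x = Complex.ofRealCLM ∘L fderiv ℝ g x :=
        (Complex.ofRealCLM.hasFDerivAt.comp x
          (hg1.differentiable (by simp) x).hasFDerivAt).fderiv
      rw [hfd]
      rfl
    have hcs := hasCompactSupport_ofReal hgc
    have hcs' : ∀ j, HasCompactSupport
        (fun x => ((fderiv ℝ g x (EuclideanSpace.single j 1) : ℝ) : ℂ)) := fun j =>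
      hasCompactSupport_ofReal (hgc.fderiv_apply ℝ _)
    have i1 : Integrable (fun x =>
        ∑ j, r j x * ((fderiv ℝ g x (EuclideanSpace.single j 1) : ℝ) : ℂ))
        (volume.restrict Ω) := by
      refine integrable_finsetSum _ fun j _ => ?_
      refine Integrable.restrict (Continuous.integrable_of_hasCompactSupport ?_ (hcs' j).mul_left)
      exact (hrc j).continuous.mul (Complex.continuous_ofReal.comp
        ((hg1.continuous_fderiv (by simp)).clm_apply continuous_const))
    have i2 : Integrable (fun x => fdiv r x * ((g x : ℝ) : ℂ)) (volume.restrict Ω) :=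
      Integrable.restrict (((continuous_fdiv hrc).mul hgC.continuous).integrable_of_hasCompactSupport
        hcs.mul_left)
    simp only [h4] at h3
    rw [integral_add i1 i2, ← h2, h1, neg_add_eq_zero,
      ← sub_eq_zero, ← integral_sub (integrable_mul_test _ hg hgc i) i2] at h3
    rw [← h3, setIntegral_eq_integral_of_forall_compl_eq_zero]
    · congr 1
      funext x
      rw [Complex.real_smul]
      ring
    · intro x hx
      have : g x = 0 := image_eq_zero_of_notMem_tsupport fun h => hx (hgΩ h)
      simp [this]

end Spaces

/-! ### The two constants -/

section Constants

variable {n : ℕ} {Ω : Set (Pt n)} {𝒯 : Finset (Finset (Pt n))}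

theorem norm_sq_eq_integral {α E : Type*} [MeasurableSpace α] {μ : Measure α}
    [NormedAddCommGroup E] [InnerProductSpace ℂ E] (f : Lp E 2 μ) :
    ‖f‖ ^ 2 = ∫ x, ‖f x‖ ^ 2 ∂μ := by
  have h := L2.inner_def (𝕜 := ℂ) f f
  simp only [inner_self_eq_norm_sq_to_K] at h
  have h' : ((‖f‖ ^ 2 : ℝ) : ℂ) = ((∫ x, ‖f x‖ ^ 2 ∂μ : ℝ) : ℂ) := by
    rw [← integral_complex_ofReal]
    simpa using h
  exact_mod_cast h'

theorem formb_eq_inner (τ : L2T Ω) (q : L2V Ω) : formb τ q = inner ℂ q (wdiv τ) := by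
  rw [formb, L2.inner_def]
  simp only [cdot_eq_inner]

/-- The deviator of an `L²` tensor field. -/
def devLp (Ω : Set (Pt n)) : L2T Ω →L[ℂ] L2T Ω := devL.compLpL 2 (volume.restrict Ω)

theorem coeFn_devLp (τ : L2T Ω) : devLp Ω τ =ᵐ[volume.restrict Ω] fun x => dev (τ x) :=
  devL.coeFn_compLp τ

theorem integral_norm_dev_sq (τ : L2T Ω) : ∫ x in Ω, ‖dev (τ x)‖ ^ 2 = ‖devLp Ω τ‖ ^ 2 := by
  rw [norm_sq_eq_integral]
  refine integral_congr_ae ?_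
  filter_upwards [coeFn_devLp τ] with x hx
  rw [hx]

theorem divNorm_sq (τ : L2T Ω) : divNorm τ ^ 2 = ‖τ‖ ^ 2 + ‖wdiv τ‖ ^ 2 :=
  Real.sq_sqrt (by positivity)

theorem norm_wdiv_le_divNorm (τ : L2T Ω) : ‖wdiv τ‖ ≤ divNorm τ :=
  Real.le_sqrt_of_sq_le (by nlinarith [sq_nonneg ‖τ‖])

theorem norm_le_divNorm (τ : L2T Ω) : ‖τ‖ ≤ divNorm τ :=
  Real.le_sqrt_of_sq_le (by nlinarith [sq_nonneg ‖wdiv τ‖])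

theorem divNorm_nonneg (τ : L2T Ω) : 0 ≤ divNorm τ := Real.sqrt_nonneg _

/-- A tensor field whose deviator and divergence vanish is a constant multiple of the identity, so
it vanishes if the integral of its trace does. -/
theorem eq_zero_of_dev_of_wdiv (hn : n ≠ 0) (hΩ : IsLipschitzDomain Ω) {τ : L2T Ω}
    (hτ : τ ∈ Hdiv Ω) (hdev : devLp Ω τ = 0) (hdiv : wdiv τ = 0)
    (htr : ∫ x in Ω, tr (τ x) = 0) : τ = 0 := by
  have hn' : (n : ℂ) ≠ 0 := Nat.cast_ne_zero.2 hn
  set f : Pt n → ℂ := fun x => (1 / (n : ℂ)) * tr (τ x) with hf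
  have hτf : ∀ᵐ x ∂(volume.restrict Ω), ∀ p : Fin n × Fin n,
      τ x p = if p.1 = p.2 then f x else 0 := by
    filter_upwards [coeFn_devLp τ, Lp.coeFn_zero (Tens n) 2 (volume.restrict Ω)] with x h1 h2 p
    rw [hdev, h2] at h1
    have h3 := congrArg (fun A : Tens n => A p) h1
    simp only [dev, Pi.zero_apply, PiLp.zero_apply] at h3
    exact (sub_eq_zero.1 h3.symm)
  obtain ⟨c, hc⟩ := ae_const_of_locally (f := f) hΩ.isOpen hΩ.isConnected fun x hx => by
    refine locally_ae_const_of_weak_gradient hΩ.isOpen ((integrable_tr hΩ τ).const_mul _)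
      (fun φ hφ hφc hφs j => ?_) hx
    have h := isWeakDiv_wdiv hτ φ hφ hφc hφs j
    have h0 : ∫ x in Ω, wdiv τ x j * ((φ x : ℝ) : ℂ) = 0 := by
      refine integral_eq_zero_of_ae ?_
      filter_upwards [Lp.coeFn_zero (Vec n) 2 (volume.restrict Ω)] with x hx
      rw [hdiv, hx]; simp
    rw [h0, neg_zero] at h
    rw [← h]
    refine integral_congr_ae ?_
    filter_upwards [hτf] with x hx
    rw [Finset.sum_eq_single j]
    · rw [hx, if_pos rfl]
    · intro l _ hl
      rw [hx, if_neg fun h : j = l => hl h.symm, zero_mul]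
    · simp
  have hfint : ∫ x in Ω, f x = 0 := by rw [hf, integral_const_mul, htr, mul_zero]
  rw [integral_congr_ae hc, setIntegral_const] at hfint
  have hc0 : c = 0 := (smul_eq_zero.1 hfint).resolve_left hΩ.volume_real_ne_zero
  refine Lp.ext ?_
  filter_upwards [hτf, hc, Lp.coeFn_zero (Tens n) 2 (volume.restrict Ω)] with x h1 h2 h3
  rw [h3]
  ext p
  rw [h1, h2, hc0]
  simp

/-- The map τ ↦ (τᵈ, div τ) is injective on a finite-dimensional space, hence antilipschitz. -/
theorem exists_devDivBound (hn : n ≠ 0) (hΩ : IsLipschitzDomain Ω) (h𝒯 : IsMesh Ω 𝒯) (k : ℕ)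
    (F : Family) : ∃ c₁ : ℝ, 0 < c₁ ∧ DevDivBound (H0h Ω 𝒯 k F) c₁ := by
  have := finiteDimensional_h0 hΩ h𝒯 k F
  let Φ : h0Submodule hΩ 𝒯 k F →ₗ[ℂ] L2T Ω × L2V Ω :=
    ((devLp Ω : L2T Ω →ₗ[ℂ] L2T Ω).comp (h0Submodule hΩ 𝒯 k F).subtype).prod (h0Div hΩ 𝒯 k F)
  have hker : LinearMap.ker Φ = ⊥ := by
    rw [LinearMap.ker_eq_bot']
    intro τ hτ
    have h1 : devLp Ω (τ : L2T Ω) = 0 := congrArg Prod.fst hτ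
    have h2 : wdiv (τ : L2T Ω) = 0 := congrArg Prod.snd hτ
    exact Subtype.ext (eq_zero_of_dev_of_wdiv hn hΩ (h0Submodule_le_hdiv hΩ k F τ.2) h1 h2
      (mem_h0Submodule.1 τ.2).2)
  obtain ⟨K, -, hK⟩ := Φ.exists_antilipschitzWith hker
  -- K² controls ‖τ‖² by the right-hand side, and the extra 1 accounts for the divergence part of
  -- ‖τ‖²_div.
  refine ⟨((K : ℝ) ^ 2 + 1)⁻¹, by positivity, fun τ hτ => ?_⟩
  have hb : ‖τ‖ ≤ K * ‖Φ ⟨τ, mem_h0Submodule.2 hτ⟩‖ := by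
    have := hK.le_mul_dist ⟨τ, mem_h0Submodule.2 hτ⟩ 0
    rwa [map_zero, dist_zero_right, dist_zero_right] at this
  have hΦ : ‖Φ ⟨τ, mem_h0Submodule.2 hτ⟩‖ ^ 2 ≤ ‖devLp Ω τ‖ ^ 2 + ‖wdiv τ‖ ^ 2 := by
    have h1 : ‖Φ ⟨τ, mem_h0Submodule.2 hτ⟩‖ = max ‖devLp Ω τ‖ ‖wdiv τ‖ := Prod.norm_def _
    rw [h1]
    rcases max_choice ‖devLp Ω τ‖ ‖wdiv τ‖ with h | h <;> rw [h] <;>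
      nlinarith [sq_nonneg ‖devLp Ω τ‖, sq_nonneg ‖wdiv τ‖]
  rw [integral_norm_dev_sq, divNorm_sq, inv_mul_le_iff₀ (by positivity)]
  have h2 : ‖τ‖ ^ 2 ≤ K ^ 2 * (‖devLp Ω τ‖ ^ 2 + ‖wdiv τ‖ ^ 2) := by
    calc ‖τ‖ ^ 2 ≤ (K * ‖Φ ⟨τ, mem_h0Submodule.2 hτ⟩‖) ^ 2 := by gcongr
      _ = K ^ 2 * ‖Φ ⟨τ, mem_h0Submodule.2 hτ⟩‖ ^ 2 := by ring
      _ ≤ _ := by gcongr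
  nlinarith [sq_nonneg ‖devLp Ω τ‖]

theorem memLp_idField (hΩ : IsLipschitzDomain Ω) :
    MemLp (fun _ : Pt n => (WithLp.toLp 2 fun p => if p.1 = p.2 then 1 else 0 : Tens n)) 2
      (volume.restrict Ω) := by
  have := hΩ.isFiniteMeasure
  exact memLp_const _

/-- The identity tensor field. -/
def idField (hΩ : IsLipschitzDomain Ω) : L2T Ω := (memLp_idField hΩ).toLp

theorem isWeakDiv_idField (hΩ : IsLipschitzDomain Ω) : IsWeakDiv Ω (idField hΩ) 0 := by
  intro φ hφ hφc hφs i
  have h0 : ∫ x in Ω, (0 : L2V Ω) x i * ((φ x : ℝ) : ℂ) = 0 := by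
    refine integral_eq_zero_of_ae ?_
    filter_upwards [Lp.coeFn_zero (Vec n) 2 (volume.restrict Ω)] with x hx
    rw [hx]; simp
  rw [h0, neg_zero]
  have h1 : ∫ x in Ω, ∑ j, idField hΩ x (i, j) *
      ((fderiv ℝ φ x (EuclideanSpace.single j 1) : ℝ) : ℂ)
      = ∫ x in Ω, ((fderiv ℝ φ x (EuclideanSpace.single i 1) : ℝ) : ℂ) := by
    refine integral_congr_ae ?_
    filter_upwards [(memLp_idField hΩ).coeFn_toLp] with x hx
    rw [idField, hx, Finset.sum_eq_single i]
    · simp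
    · intro l _ hl
      simp [hl.symm]
    · simp
  rw [h1, integral_complex_ofReal, setIntegral_eq_integral_of_forall_compl_eq_zero,
    integral_fderiv_eq_zero (hφ.of_le (by exact_mod_cast le_top)) hφc, Complex.ofReal_zero]
  intro x hx
  have : fderiv ℝ φ x = 0 := image_eq_zero_of_notMem_tsupport fun h =>
    hx (hφs (tsupport_fderiv_subset ℝ h))
  rw [this]; rfl

theorem idField_mem_RT (hΩ : IsLipschitzDomain Ω) (k : ℕ) : idField hΩ ∈ RT Ω 𝒯 k := by
  refine ⟨⟨0, isWeakDiv_idField hΩ⟩, fun T _ i =>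
    ⟨fun j => MvPolynomial.C (if i = j then 1 else 0), 0,
      fun j => by rw [MvPolynomial.totalDegree_C]; exact Nat.zero_le k, by simp, ?_⟩⟩
  filter_upwards [(memLp_idField hΩ).coeFn_toLp] with x hx _ j
  rw [idField, hx, polyAt_C, polyAt_zero]
  simp

theorem trInt_idField (hΩ : IsLipschitzDomain Ω) :
    trInt hΩ (idField hΩ) = volume.real Ω • (n : ℂ) := by
  rw [← setIntegral_const]
  refine integral_congr_ae ?_
  filter_upwards [(memLp_idField hΩ).coeFn_toLp] with x hx
  rw [idField, hx]
  simp [tr]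

/-- A multiple of the identity field corrects the mean trace of a Raviart–Thomas field without
changing its divergence. -/
theorem formb_eq_zero_of_forall_h0 (hn : n ≠ 0) (hΩ : IsLipschitzDomain Ω) {k : ℕ} {F : Family}
    {q : L2V Ω} (hq : ∀ τ ∈ H0h Ω 𝒯 k F, formb τ q = 0) : ∀ τ ∈ RT Ω 𝒯 k, formb τ q = 0 := by
  intro τ hτ
  have ht : trInt hΩ (idField hΩ) ≠ 0 := by
    rw [trInt_idField]
    exact smul_ne_zero hΩ.volume_real_ne_zero (Nat.cast_ne_zero.2 hn)
  set c := -(trInt hΩ τ / trInt hΩ (idField hΩ)) with hc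
  have hmem : τ + c • idField hΩ ∈ RT Ω 𝒯 k :=
    (rtSubmodule Ω 𝒯 k).add_mem hτ ((rtSubmodule Ω 𝒯 k).smul_mem c (idField_mem_RT hΩ k))
  have h0 : trInt hΩ (τ + c • idField hΩ) = 0 := by
    rw [map_add, map_smul, smul_eq_mul, hc]
    field_simp
    ring
  have hdiv : wdiv (τ + c • idField hΩ) = wdiv τ := by
    have := ((isWeakDiv_wdiv hτ.1).add ((isWeakDiv_idField hΩ).smul c)).wdiv_eq hΩ.isOpen
    rwa [smul_zero, add_zero] at this
  have := hq _ ⟨RT_subset_Hh k F hmem, h0⟩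
  rwa [formb_eq_inner, hdiv, ← formb_eq_inner] at this

theorem norm_formb_le (τ : L2T Ω) (q : L2V Ω) : ‖formb τ q‖ ≤ ‖q‖ * divNorm τ := by
  rw [formb_eq_inner]
  exact (norm_inner_le_norm _ _).trans
    (mul_le_mul_of_nonneg_left (norm_wdiv_le_divNorm τ) (norm_nonneg _))

theorem h0Div_mem_pwPoly (hΩ : IsLipschitzDomain Ω) (h𝒯 : IsMesh Ω 𝒯) (k : ℕ) (F : Family)
    (τ : h0Submodule hΩ 𝒯 k F) : h0Div hΩ 𝒯 k F τ ∈ pwPoly Ω 𝒯 (Fin n) k :=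
  wdiv_mem_Qh hΩ h𝒯 (Hh_subset_BDM k F (mem_h0Submodule.1 τ.2).1)

/-- The discrete divergence is surjective. -/
theorem exists_wdiv_eq {m : ℕ} {Ω : Set (Pt (m + 1))} {𝒯 : Finset (Finset (Pt (m + 1)))}
    (hΩ : IsLipschitzDomain Ω) (h𝒯 : IsMesh Ω 𝒯) {k : ℕ} (F : Family) {q : L2V Ω}
    (hq : q ∈ pwPoly Ω 𝒯 (Fin (m + 1)) k) : q ∈ LinearMap.range (h0Div hΩ 𝒯 k F) := by
  have := finiteDimensional_h0 hΩ h𝒯 k F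
  obtain ⟨R, hR⟩ : ∃ R : Submodule ℂ (L2V Ω), R = LinearMap.range (h0Div hΩ 𝒯 k F) := ⟨_, rfl⟩
  have hfin : FiniteDimensional ℂ R := by rw [hR]; infer_instance
  have hRW : R ≤ pwPoly Ω 𝒯 (Fin (m + 1)) k := by
    rw [hR]
    rintro _ ⟨τ, rfl⟩
    exact h0Div_mem_pwPoly hΩ h𝒯 k F τ
  have hmem : R.starProjection q ∈ R := R.starProjection_apply_mem q
  -- The residual of the projection onto the range is piecewise polynomial, because the range is,
  -- and it is orthogonal to all discrete divergences.
  have hz : q - R.starProjection q = 0 := by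
    refine eq_zero_of_orthogonal hΩ h𝒯
      (Submodule.sub_mem _ hq (hRW hmem))
      (formb_eq_zero_of_forall_h0 (F := F) (Nat.succ_ne_zero m) hΩ fun τ hτ => ?_)
    rw [formb_eq_inner]
    refine Submodule.inner_left_of_mem_orthogonal (K := R) ?_ (R.sub_starProjection_mem_orthogonal q)
    rw [hR]
    exact ⟨⟨τ, mem_h0Submodule.2 hτ⟩, rfl⟩
  rw [← hR, sub_eq_zero.1 hz]
  exact hmem

theorem exists_norm_le_of_surjective {E F : Type*} [NormedAddCommGroup E]
    [NormedSpace ℂ E] [NormedAddCommGroup F] [NormedSpace ℂ F] [FiniteDimensional ℂ F]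
    (f : E →ₗ[ℂ] F) (hf : Function.Surjective f) :
    ∃ K : ℝ, ∀ y, ∃ x, f x = y ∧ ‖x‖ ≤ K * ‖y‖ := by
  obtain ⟨S, hS⟩ := f.exists_rightInverse_of_surjective (LinearMap.range_eq_top.2 hf)
  exact ⟨‖LinearMap.toContinuousLinearMap S‖, fun y =>
    ⟨S y, LinearMap.congr_fun hS y, (LinearMap.toContinuousLinearMap S).le_opNorm y⟩⟩

theorem exists_bounded_wdiv_eq {m : ℕ} {Ω : Set (Pt (m + 1))} {𝒯 : Finset (Finset (Pt (m + 1)))}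
    (hΩ : IsLipschitzDomain Ω) (h𝒯 : IsMesh Ω 𝒯) (k : ℕ) (F : Family) :
    ∃ K : ℝ, ∀ q ∈ Qh Ω 𝒯 k, ∃ τ ∈ H0h Ω 𝒯 k F, wdiv τ = q ∧ ‖τ‖ ≤ K * ‖q‖ := by
  have := finiteDimensional_pwPoly h𝒯.subset_cells hΩ.isOpen.measurableSet (Fin (m + 1)) k
  obtain ⟨K, hK⟩ := exists_norm_le_of_surjective
    (LinearMap.codRestrict (pwPoly Ω 𝒯 (Fin (m + 1)) k) (h0Div hΩ 𝒯 k F)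
      (h0Div_mem_pwPoly hΩ h𝒯 k F))
    (fun q => by
      obtain ⟨τ, hτ⟩ := exists_wdiv_eq hΩ h𝒯 F q.2
      exact ⟨τ, Subtype.ext hτ⟩)
  refine ⟨K, fun q hq => ?_⟩
  obtain ⟨τ, h1, h2⟩ := hK ⟨q, hq⟩
  exact ⟨τ, mem_h0Submodule.1 τ.2, congrArg Subtype.val h1, h2⟩

/-- A preimage τ of q under the divergence with ‖τ‖ ≤ K ‖q‖ has b(τ, q) = ‖q‖² and ‖τ‖_div ≤ √(K² +
1) ‖q‖. -/
theorem exists_infSup {m : ℕ} {Ω : Set (Pt (m + 1))} {𝒯 : Finset (Finset (Pt (m + 1)))}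
    (hΩ : IsLipschitzDomain Ω) (h𝒯 : IsMesh Ω 𝒯) (k : ℕ) (F : Family) :
    ∃ γ : ℝ, 0 < γ ∧ InfSup (H0h Ω 𝒯 k F) (Qh Ω 𝒯 k) γ := by
  obtain ⟨K, hK⟩ := exists_bounded_wdiv_eq hΩ h𝒯 k F
  refine ⟨(√(K ^ 2 + 1))⁻¹, by positivity, fun q hq => ?_⟩
  -- Needed to bound the supremum from below by one of its terms: a real `⨆` over an unbounded
  -- family has the default value 0.
  have hbdd : BddAbove (range fun τ : H0h Ω 𝒯 k F =>
      ‖formb (τ : L2T Ω) q‖ / divNorm (τ : L2T Ω)) := by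
    refine ⟨‖q‖, ?_⟩
    rintro _ ⟨τ, rfl⟩
    exact div_le_of_le_mul₀ (divNorm_nonneg _) (norm_nonneg _) (norm_formb_le _ _)
  by_cases hq0 : q = 0
  · rw [hq0, norm_zero, mul_zero]
    exact Real.iSup_nonneg fun τ => div_nonneg (norm_nonneg _) (divNorm_nonneg _)
  have hqpos : 0 < ‖q‖ := norm_pos_iff.2 hq0
  obtain ⟨τ, hτ, hdiv, hnorm⟩ := hK q hq
  have hdn : divNorm τ ≤ √(K ^ 2 + 1) * ‖q‖ := by
    rw [divNorm, hdiv]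
    refine Real.sqrt_le_iff.2 ⟨by positivity, ?_⟩
    rw [mul_pow, Real.sq_sqrt (by positivity)]
    have := pow_le_pow_left₀ (norm_nonneg τ) hnorm 2
    linarith
  have hdn0 : 0 < divNorm τ :=
    lt_of_lt_of_le (by rw [hdiv]; exact hqpos) (norm_wdiv_le_divNorm _)
  refine le_trans ?_ (le_ciSup hbdd ⟨τ, hτ⟩)
  rw [formb_eq_inner, hdiv, inner_self_eq_norm_sq_to_K, le_div_iff₀ hdn0]
  calc (√(K ^ 2 + 1))⁻¹ * ‖q‖ * divNorm τ
      ≤ (√(K ^ 2 + 1))⁻¹ * ‖q‖ * (√(K ^ 2 + 1) * ‖q‖) := by gcongr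
    _ = ‖q‖ ^ 2 := by
      have : √(K ^ 2 + 1) ≠ 0 := by positivity
      field_simp
    _ = _ := by simp

end Constants

/-! ### Stability -/

section Stability

variable {n : ℕ} {Ω : Set (Pt n)} {𝒯 : Finset (Finset (Pt n))}

/-- The deviator is an orthogonal projection: A - Aᵈ is a multiple of the identity and Aᵈ is
trace-free. -/
theorem norm_dev_le (hn : n ≠ 0) (A : Tens n) : ‖dev A‖ ≤ ‖A‖ := by
  have hn' : (n : ℂ) ≠ 0 := Nat.cast_ne_zero.2 hn
  have hi : inner ℂ (A - dev A) (dev A) = 0 := by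
    rw [PiLp.inner_apply, Fintype.sum_prod_type]
    have h1 : ∀ i j, inner ℂ ((A - dev A) (i, j)) (dev A (i, j))
        = if i = j then conj ((1 / (n : ℂ)) * tr A) * (A (i, i) - (1 / (n : ℂ)) * tr A) else 0 := by
      intro i j
      by_cases h : i = j
      · subst h
        simp [dev, mul_comm]
      · simp [dev, h]
    simp only [h1, Finset.sum_ite_eq, Finset.mem_univ, if_true, ← Finset.mul_sum,
      Finset.sum_sub_distrib]
    have h2 : ∑ i, A (i, i) = tr A := rfl
    rw [h2]
    simp [hn']
  have h := norm_add_sq (𝕜 := ℂ) (A - dev A) (dev A)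
  rw [hi, sub_add_cancel, map_zero, mul_zero, add_zero] at h
  exact le_of_sq_le_sq (by nlinarith [sq_nonneg ‖A - dev A‖]) (norm_nonneg _)

theorem norm_devLp_le (hn : n ≠ 0) (τ : L2T Ω) : ‖devLp Ω τ‖ ≤ ‖τ‖ := by
  refine Lp.norm_le_norm_of_ae_le ?_
  filter_upwards [coeFn_devLp τ] with x hx
  rw [hx]
  exact norm_dev_le hn _

theorem formA_eq_inner (ν : ℝ) (σ τ : L2T Ω) :
    formA ν σ τ = (1 / (ν : ℂ)) * inner ℂ (devLp Ω τ) (devLp Ω σ) := by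
  rw [formA, L2.inner_def]
  congr 1
  refine integral_congr_ae ?_
  filter_upwards [coeFn_devLp σ, coeFn_devLp τ] with x h1 h2
  rw [h1, h2, ddot_eq_inner]

theorem wdiv_smul_add_smul (hΩ : IsOpen Ω) {σ τ : L2T Ω} (hσ : σ ∈ Hdiv Ω) (hτ : τ ∈ Hdiv Ω)
    (a c : ℂ) : wdiv (a • σ + c • τ) = a • wdiv σ + c • wdiv τ :=
  (((isWeakDiv_wdiv hσ).smul a).add ((isWeakDiv_wdiv hτ).smul c)).wdiv_eq hΩ

theorem divNorm_smul (hΩ : IsOpen Ω) {σ : L2T Ω} (hσ : σ ∈ Hdiv Ω) (c : ℂ) :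
    divNorm (c • σ) = ‖c‖ * divNorm σ := by
  have h : wdiv (c • σ) = c • wdiv σ := ((isWeakDiv_wdiv hσ).smul c).wdiv_eq hΩ
  rw [divNorm, divNorm, h, norm_smul, norm_smul, mul_pow, mul_pow, ← mul_add,
    Real.sqrt_mul (by positivity), Real.sqrt_sq (norm_nonneg _)]

/-- A normalized element that almost realizes the supremum in the inf-sup condition. -/
theorem exists_of_infSup (hΩ : IsLipschitzDomain Ω) {k : ℕ} {F : Family} {γ : ℝ} (hγ : 0 < γ)
    (h : InfSup (H0h Ω 𝒯 k F) (Qh Ω 𝒯 k) γ) {u : L2V Ω} (hu : u ∈ Qh Ω 𝒯 k) :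
    ∃ w ∈ H0h Ω 𝒯 k F, ∃ β : ℝ, γ / 2 * ‖u‖ ^ 2 ≤ β ∧ divNorm w ≤ ‖u‖ ∧ formb w u = β := by
  by_cases hu0 : u = 0
  · subst hu0
    refine ⟨0, mem_h0Submodule.1 (h0Submodule hΩ 𝒯 k F).zero_mem, 0, by simp, ?_, ?_⟩
    · have := divNorm_smul hΩ.isOpen (hdivSubmodule Ω).zero_mem (0 : ℂ)
      rw [smul_zero, norm_zero, zero_mul] at this
      rw [this, norm_zero]
    · rw [formb_eq_inner, inner_zero_left, Complex.ofReal_zero]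
  have hU : 0 < ‖u‖ := norm_pos_iff.2 hu0
  have : Nonempty (H0h Ω 𝒯 k F) := ⟨⟨0, mem_h0Submodule.1 (h0Submodule hΩ 𝒯 k F).zero_mem⟩⟩
  -- Giving up half of γ replaces attainment of the supremum by a strict inequality.
  obtain ⟨⟨w, hw⟩, hlt⟩ := exists_lt_of_lt_ciSup
    (lt_of_lt_of_le (show γ / 2 * ‖u‖ < γ * ‖u‖ by nlinarith) (h u hu))
  have hwd : w ∈ Hdiv Ω := h0Submodule_le_hdiv hΩ k F (mem_h0Submodule.2 hw)
  have hN : 0 < divNorm w := by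
    rcases (divNorm_nonneg w).eq_or_lt with h0 | h0
    · simp only [← h0, div_zero] at hlt
      exact absurd hlt (by push Not; positivity)
    · exact h0
  set z := formb w u with hz
  have hzn : γ / 2 * ‖u‖ * divNorm w < ‖z‖ := (lt_div_iff₀ hN).1 hlt
  have hz0 : 0 < ‖z‖ := lt_of_le_of_lt (by positivity) hzn
  have hzC : ((‖z‖ : ℝ) : ℂ) ≠ 0 := Complex.ofReal_ne_zero.2 hz0.ne'
  have hNC : ((divNorm w : ℝ) : ℂ) ≠ 0 := Complex.ofReal_ne_zero.2 hN.ne'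
  -- The modulus of c scales the norm of w to ‖u‖, and its phase makes b(c w, u) real and positive.
  set c : ℂ := (‖u‖ / divNorm w : ℝ) * (conj z / (‖z‖ : ℝ)) with hc
  have hcn : ‖c‖ = ‖u‖ / divNorm w := by
    rw [hc, norm_mul, norm_div, RCLike.norm_conj, Complex.norm_real, Complex.norm_real, norm_norm,
      div_self hz0.ne', mul_one, Real.norm_of_nonneg (by positivity)]
  refine ⟨c • w, mem_h0Submodule.1 ((h0Submodule hΩ 𝒯 k F).smul_mem c (mem_h0Submodule.2 hw)),
    ‖u‖ / divNorm w * ‖z‖, ?_, ?_, ?_⟩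
  · have e : ‖u‖ / divNorm w * ‖z‖ = ‖u‖ * ‖z‖ / divNorm w := by ring
    rw [e, le_div_iff₀ hN]
    nlinarith
  · rw [divNorm_smul hΩ.isOpen hwd, hcn, div_mul_cancel₀ _ hN.ne']
  · have hd : wdiv (c • w) = c • wdiv w := ((isWeakDiv_wdiv hwd).smul c).wdiv_eq hΩ.isOpen
    rw [formb_eq_inner, hd, inner_smul_right, ← formb_eq_inner, ← hz, hc]
    have h1 : conj z * z = ((‖z‖ : ℝ) : ℂ) ^ 2 := Complex.conj_mul' z
    push_cast
    field_simp
    linear_combination (‖u‖ : ℂ) * h1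

/-- A phase that makes a sum real. -/
theorem exists_phase (α : ℂ) (β : ℝ) :
    ∃ ζ : ℂ, ‖ζ‖ = 1 ∧ ∃ ρ : ℝ, conj ζ * α + ζ * β = ρ ∧ β - 3 * ‖α‖ ≤ ρ := by
  -- Since conj ζ α = 2 Re(conj ζ α) - ζ conj α, the sum equals ζ z plus a real number, so it
  -- suffices to rotate z to |z|. The loss is |α| in |z| ≥ β - |α| and 2|α| in the real part.
  set z : ℂ := β - conj α with hz
  obtain ⟨ζ, hζ, hζz⟩ : ∃ ζ : ℂ, ‖ζ‖ = 1 ∧ ζ * z = (‖z‖ : ℝ) := by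
    by_cases h : z = 0
    · exact ⟨1, by simp, by simp [h]⟩
    · have hz0 : ‖z‖ ≠ 0 := norm_ne_zero_iff.2 h
      refine ⟨conj z / (‖z‖ : ℝ), ?_, ?_⟩
      · rw [norm_div, RCLike.norm_conj, Complex.norm_real, norm_norm, div_self hz0]
      · rw [div_mul_eq_mul_div, Complex.conj_mul', sq, mul_div_assoc,
          div_self (Complex.ofReal_ne_zero.2 hz0), mul_one]
  refine ⟨ζ, hζ, ‖z‖ + 2 * (conj ζ * α).re, ?_, ?_⟩
  · have h1 : ζ * β = ζ * z + conj (conj ζ * α) := by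
      rw [map_mul, Complex.conj_conj, hz]; ring
    rw [h1, hζz]
    have h2 := Complex.add_conj (conj ζ * α)
    push_cast at h2 ⊢
    linear_combination h2
  · have h1 : |(conj ζ * α).re| ≤ ‖α‖ := by
      refine (Complex.abs_re_le_norm _).trans ?_
      rw [norm_mul, RCLike.norm_conj, hζ, one_mul]
    have h2 : β - ‖α‖ ≤ ‖z‖ := by
      have h3 : β ≤ ‖(β : ℂ)‖ := by rw [Complex.norm_real]; exact le_abs_self _
      have h4 : ‖(β : ℂ)‖ ≤ ‖z‖ + ‖conj α‖ := by
        have := norm_add_le z (conj α)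
        rwa [hz, sub_add_cancel] at this
      rw [RCLike.norm_conj] at h4
      linarith
    linarith [(abs_le.1 h1).1]

theorem tripleNorm_sq (τ : L2T Ω) (v : L2V Ω) :
    tripleNorm τ v ^ 2 = divNorm τ ^ 2 + ‖v‖ ^ 2 := Real.sq_sqrt (by positivity)

theorem norm_smul_add_smul_sq_le {E : Type*} [NormedAddCommGroup E] [NormedSpace ℂ E] (a c : ℂ)
    (x y : E) : ‖a • x + c • y‖ ^ 2 ≤ 2 * (‖a‖ ^ 2 * ‖x‖ ^ 2 + ‖c‖ ^ 2 * ‖y‖ ^ 2) := by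
  have h := norm_add_le (a • x) (c • y)
  rw [norm_smul, norm_smul] at h
  have h1 := pow_le_pow_left₀ (norm_nonneg _) h 2
  nlinarith [sq_nonneg (‖a‖ * ‖x‖ - ‖c‖ * ‖y‖)]

/-- The factor by which the test functions of the stability estimate are scaled. -/
def stabScale (c₁ ν γ : ℝ) : ℝ := (CJ c₁ ν γ * min (c₁ / (2 * ν)) (γ ^ 2 * ν / 72))⁻¹

/-- The norm bound for the test functions of the stability estimate. -/
def stabBound (c₁ ν γ : ℝ) : ℝ :=
  stabScale c₁ ν γ * √(2 * (1 + (γ * ν / 18) ^ 2 + (1 / ν) ^ 2))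

theorem CJ_pos {c₁ ν γ : ℝ} (h1 : 0 < c₁) (h2 : 0 < ν) (h3 : 0 < γ) : 0 < CJ c₁ ν γ :=
  inv_pos.2 (lt_min (by positivity) (by positivity))

theorem stabScale_pos {c₁ ν γ : ℝ} (h1 : 0 < c₁) (h2 : 0 < ν) (h3 : 0 < γ) :
    0 < stabScale c₁ ν γ :=
  inv_pos.2 (mul_pos (CJ_pos h1 h2 h3) (lt_min (by positivity) (by positivity)))

theorem stabBound_pos {c₁ ν γ : ℝ} (h1 : 0 < c₁) (h2 : 0 < ν) (h3 : 0 < γ) :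
    0 < stabBound c₁ ν γ :=
  mul_pos (stabScale_pos h1 h2 h3) (Real.sqrt_pos.2 (by positivity))

/-- The indefinite terms a b(σ, u) and -a conj b(σ, u)-type contributions are avoided by taking the
real coefficients a and -a on σ and u: the two occurrences of b(σ, u) cancel exactly. The term in e
supplies control of div σ. -/
theorem formB_test (hΩ : IsOpen Ω) (ν : ℝ) {σ w : L2T Ω} (hσ : σ ∈ Hdiv Ω) (hw : w ∈ Hdiv Ω)
    (u : L2V Ω) (a e : ℝ) (c : ℂ) :
    formB ν σ u ((a : ℂ) • σ + c • w) ((-a : ℂ) • u + (e : ℂ) • wdiv σ)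
      = ((a / ν * ‖devLp Ω σ‖ ^ 2 + e * ‖wdiv σ‖ ^ 2 : ℝ) : ℂ)
        + (conj c * formA ν σ w + c * formb w u) := by
  simp only [formB, formA_eq_inner, formb_eq_inner, wdiv_smul_add_smul hΩ hσ hw, map_add, map_smul,
    inner_add_left, inner_add_right, inner_smul_left, inner_smul_right, inner_self_eq_norm_sq_to_K,
    Complex.conj_ofReal, map_neg]
  push_cast
  simp only [Complex.coe_algebraMap]
  ring

theorem test_bound_aux {M θ ι x y p q U X Y Z : ℝ}
    (e1 : X ≤ 2 * (M ^ 2 * x + (M * θ) ^ 2 * p)) (e2 : Y ≤ 2 * (M ^ 2 * y + (M * θ) ^ 2 * q))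
    (e3 : Z ≤ 2 * (M ^ 2 * U + (M * ι) ^ 2 * y)) (hx : 0 ≤ x) (hy : 0 ≤ y) (hU : 0 ≤ U)
    (hpq : p + q ≤ U) :
    X + Y + Z ≤ M ^ 2 * (2 * (1 + θ ^ 2 + ι ^ 2)) * (x + y + U) := by
  have e4 : (M * θ) ^ 2 * (p + q) ≤ (M * θ) ^ 2 * U := by gcongr
  have e5 : 0 ≤ (M * θ) ^ 2 * (x + y) := by positivity
  have e6 : 0 ≤ (M * ι) ^ 2 * (x + U) := by positivity
  linear_combination e1 + e2 + e3 + 2 * e4 + 2 * e5 + 2 * e6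

theorem tripleNorm_test_le (hΩ : IsOpen Ω) {σ w : L2T Ω} (hσ : σ ∈ Hdiv Ω) (hw : w ∈ Hdiv Ω)
    (u : L2V Ω) (hwn : divNorm w ≤ ‖u‖) {M θ ν : ℝ} (hM : 0 < M) (hν : 0 < ν) {c : ℂ}
    (hc : ‖c‖ = M * θ) :
    tripleNorm ((M : ℂ) • σ + c • w) ((-M : ℂ) • u + ((M / ν : ℝ) : ℂ) • wdiv σ)
      ≤ M * √(2 * (1 + θ ^ 2 + (1 / ν) ^ 2)) * tripleNorm σ u := by
  have hMn : ‖(M : ℂ)‖ = M := by rw [Complex.norm_real, Real.norm_of_nonneg hM.le]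
  have hMν : ‖((M / ν : ℝ) : ℂ)‖ = M * (1 / ν) := by
    rw [Complex.norm_real, Real.norm_of_nonneg (by positivity)]
    ring
  have e1 := norm_smul_add_smul_sq_le (M : ℂ) c σ w
  have e2 := norm_smul_add_smul_sq_le (M : ℂ) c (wdiv σ) (wdiv w)
  have e3 := norm_smul_add_smul_sq_le (-M : ℂ) ((M / ν : ℝ) : ℂ) u (wdiv σ)
  rw [hMn, hc] at e1 e2
  rw [norm_neg, hMn, hMν] at e3
  have hw2 : ‖w‖ ^ 2 + ‖wdiv w‖ ^ 2 ≤ ‖u‖ ^ 2 := by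
    rw [← divNorm_sq]; exact pow_le_pow_left₀ (divNorm_nonneg _) hwn 2
  refine le_of_sq_le_sq ?_ (mul_nonneg (by positivity) (Real.sqrt_nonneg _))
  rw [mul_pow, tripleNorm_sq, tripleNorm_sq, divNorm_sq, divNorm_sq,
    wdiv_smul_add_smul hΩ hσ hw, mul_pow, Real.sq_sqrt (by positivity)]
  exact test_bound_aux e1 e2 e3 (by positivity) (by positivity) (by positivity) hw2

/-- Here s, d and U stand for ‖σᵈ‖, ‖div σ‖ and ‖u‖, and N for ‖σ‖²_div. Young's inequality absorbs
3α into half of γ U²/2 at the cost of 9s²/(γν²). The weight γν/18 turns this cost into s²/(2ν), half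
of the available s²/ν, and turns the remaining γU²/4 into γ²νU²/72. -/
theorem test_coercive_aux {c₁ ν γ s d U N α β ρ : ℝ} (hν : 0 < ν) (hγ : 0 < γ)
    (h1 : c₁ * N ≤ s ^ 2 + d ^ 2) (hN : 0 ≤ N) (hα : α ≤ s * U / ν) (hβ : γ / 2 * U ^ 2 ≤ β)
    (hρ : β - 3 * α ≤ ρ) :
    (N + U ^ 2) * min (c₁ / (2 * ν)) (γ ^ 2 * ν / 72)
      ≤ s ^ 2 / ν + d ^ 2 / ν + γ * ν / 18 * ρ := by
  have h2 : 3 * (s * U / ν) ≤ γ / 4 * U ^ 2 + 9 * s ^ 2 / (γ * ν ^ 2) := by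
    have : γ / 4 * U ^ 2 + 9 * s ^ 2 / (γ * ν ^ 2) - 3 * (s * U / ν)
        = (γ * ν * U - 6 * s) ^ 2 / (4 * γ * ν ^ 2) := by
      field_simp
      ring
    have h3 : 0 ≤ (γ * ν * U - 6 * s) ^ 2 / (4 * γ * ν ^ 2) := by positivity
    linarith
  have h3 : γ / 4 * U ^ 2 - 9 * s ^ 2 / (γ * ν ^ 2) ≤ ρ := by linarith
  have h4 := mul_le_mul_of_nonneg_left h3 (show 0 ≤ γ * ν / 18 by positivity)
  have h5 : γ * ν / 18 * (γ / 4 * U ^ 2 - 9 * s ^ 2 / (γ * ν ^ 2))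
      = γ ^ 2 * ν / 72 * U ^ 2 - s ^ 2 / (2 * ν) := by
    field_simp; ring
  have h6 : N * min (c₁ / (2 * ν)) (γ ^ 2 * ν / 72) ≤ (s ^ 2 + d ^ 2) / (2 * ν) := by
    calc N * min (c₁ / (2 * ν)) (γ ^ 2 * ν / 72) ≤ N * (c₁ / (2 * ν)) := by
          gcongr; exact min_le_left _ _
      _ = c₁ * N / (2 * ν) := by ring
      _ ≤ _ := by gcongr
  have h7 : U ^ 2 * min (c₁ / (2 * ν)) (γ ^ 2 * ν / 72) ≤ γ ^ 2 * ν / 72 * U ^ 2 := by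
    rw [mul_comm]; gcongr; exact min_le_right _ _
  have h8 : s ^ 2 / ν + d ^ 2 / ν - s ^ 2 / (2 * ν)
      = (s ^ 2 + d ^ 2) / (2 * ν) + d ^ 2 / (2 * ν) := by
    field_simp; ring
  have h9 : 0 ≤ d ^ 2 / (2 * ν) := by positivity
  linarith

theorem norm_formA_le (hn : n ≠ 0) {ν : ℝ} (hν : 0 < ν) (σ w : L2T Ω) :
    ‖formA ν σ w‖ ≤ ‖devLp Ω σ‖ * divNorm w / ν := by
  rw [formA_eq_inner, norm_mul, norm_div, norm_one, Complex.norm_real, Real.norm_of_nonneg hν.le,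
    one_div_mul_eq_div]
  refine div_le_div_of_nonneg_right ((norm_inner_le_norm _ _).trans ?_) hν.le
  rw [mul_comm]
  exact mul_le_mul_of_nonneg_left ((norm_devLp_le hn w).trans (norm_le_divNorm w)) (norm_nonneg _)

/-- The σ part of the test pair gives control of the deviator, its div σ part control of the
divergence, and the rotated inf-sup field w control of u. -/
theorem exists_test (hn : n ≠ 0) (hΩ : IsLipschitzDomain Ω) (h𝒯 : IsMesh Ω 𝒯) {k : ℕ} {F : Family}
    {c₁ ν γ : ℝ} (hc₁ : 0 < c₁) (hν : 0 < ν) (hγ : 0 < γ)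
    (hdev : DevDivBound (H0h Ω 𝒯 k F) c₁) (hinf : InfSup (H0h Ω 𝒯 k F) (Qh Ω 𝒯 k) γ)
    {σ : L2T Ω} (hσ : σ ∈ H0h Ω 𝒯 k F) {u : L2V Ω} (hu : u ∈ Qh Ω 𝒯 k) :
    ∃ τ ∈ H0h Ω 𝒯 k F, ∃ v ∈ Qh Ω 𝒯 k,
      tripleNorm τ v ≤ stabBound c₁ ν γ * tripleNorm σ u ∧ (formB ν σ u τ v).im = 0 ∧
      tripleNorm σ u ^ 2 ≤ CJ c₁ ν γ * (formB ν σ u τ v).re := by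
  obtain ⟨w, hw, β, hβ, hwn, hwb⟩ := exists_of_infSup hΩ hγ hinf hu
  have hσd : σ ∈ Hdiv Ω := h0Submodule_le_hdiv hΩ k F (mem_h0Submodule.2 hσ)
  have hwd : w ∈ Hdiv Ω := h0Submodule_le_hdiv hΩ k F (mem_h0Submodule.2 hw)
  obtain ⟨ζ, hζ, ρ, hρ, hρle⟩ := exists_phase (formA ν σ w) β
  -- M is chosen so that C_J M is the inverse of the coercivity constant obtained for the unscaled
  -- pair.
  obtain ⟨M, hM⟩ : ∃ M, M = stabScale c₁ ν γ := ⟨_, rfl⟩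
  have hM0 : 0 < M := hM ▸ stabScale_pos hc₁ hν hγ
  obtain ⟨c, hc⟩ : ∃ c : ℂ, c = (M * (γ * ν / 18) : ℝ) * ζ := ⟨_, rfl⟩
  have hcn : ‖c‖ = M * (γ * ν / 18) := by
    rw [hc, norm_mul, hζ, mul_one, Complex.norm_real, Real.norm_of_nonneg (by positivity)]
  have hB : formB ν σ u ((M : ℂ) • σ + c • w) ((-M : ℂ) • u + ((M / ν : ℝ) : ℂ) • wdiv σ)
      = ((M * (‖devLp Ω σ‖ ^ 2 / ν + ‖wdiv σ‖ ^ 2 / ν + γ * ν / 18 * ρ) : ℝ) : ℂ) := by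
    have : conj c * formA ν σ w + c * β = ((M * (γ * ν / 18) * ρ : ℝ) : ℂ) := by
      rw [Complex.ofReal_mul, ← hρ, hc, map_mul, Complex.conj_ofReal]
      ring
    rw [formB_test hΩ.isOpen ν hσd hwd, hwb, this, ← Complex.ofReal_add]
    congr 1
    ring
  refine ⟨(M : ℂ) • σ + c • w, mem_h0Submodule.1 ((h0Submodule hΩ 𝒯 k F).add_mem
    ((h0Submodule hΩ 𝒯 k F).smul_mem _ (mem_h0Submodule.2 hσ))
    ((h0Submodule hΩ 𝒯 k F).smul_mem _ (mem_h0Submodule.2 hw))),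
    (-M : ℂ) • u + ((M / ν : ℝ) : ℂ) • wdiv σ, ?_, ?_, ?_, ?_⟩
  · exact (pwPoly Ω 𝒯 (Fin n) k).add_mem ((pwPoly Ω 𝒯 (Fin n) k).smul_mem _ hu)
      ((pwPoly Ω 𝒯 (Fin n) k).smul_mem _ (wdiv_mem_Qh hΩ h𝒯 (Hh_subset_BDM k F hσ.1)))
  · rw [stabBound, ← hM]
    exact tripleNorm_test_le hΩ.isOpen hσd hwd u hwn hM0 hν hcn
  · rw [hB, Complex.ofReal_im]
  · rw [hB, Complex.ofReal_re, tripleNorm_sq]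
    have hμ : 0 < min (c₁ / (2 * ν)) (γ ^ 2 * ν / 72) := lt_min (by positivity) (by positivity)
    have hCM : CJ c₁ ν γ * M = (min (c₁ / (2 * ν)) (γ ^ 2 * ν / 72))⁻¹ := by
      rw [hM, stabScale, mul_inv, mul_inv_cancel_left₀ (CJ_pos hc₁ hν hγ).ne']
    rw [← mul_assoc, hCM, ← div_eq_inv_mul, le_div_iff₀ hμ]
    have h1 := hdev σ hσ
    rw [integral_norm_dev_sq] at h1
    refine test_coercive_aux hν hγ h1 (sq_nonneg _) ((norm_formA_le hn hν σ w).trans ?_) hβ hρle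
    gcongr

end Stability

end OseenFEM

end

theorem mainTheorem3 :
    ∃ C : ℝ → ℝ → ℝ → ℝ, (∀ c₁ ν γ : ℝ, 0 < c₁ → 0 < ν → 0 < γ → 0 < C c₁ ν γ) ∧
      ∀ (n : ℕ), n = 2 ∨ n = 3 →
      ∀ (Ω : Set (OseenFEM.Pt n)), OseenFEM.IsLipschitzDomain Ω →
      ∀ (𝒯 : Finset (Finset (OseenFEM.Pt n))), OseenFEM.IsMesh Ω 𝒯 →
      ∀ (k : ℕ) (F : OseenFEM.Family),
        (∃ c₁ : ℝ, 0 < c₁ ∧ OseenFEM.DevDivBound (OseenFEM.H0h Ω 𝒯 k F) c₁) ∧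
        (∃ γ : ℝ, 0 < γ ∧ OseenFEM.InfSup (OseenFEM.H0h Ω 𝒯 k F) (OseenFEM.Qh Ω 𝒯 k) γ) ∧
        ∀ c₁ ν γ : ℝ, 0 < c₁ → 0 < ν → 0 < γ →
          OseenFEM.DevDivBound (OseenFEM.H0h Ω 𝒯 k F) c₁ →
          OseenFEM.InfSup (OseenFEM.H0h Ω 𝒯 k F) (OseenFEM.Qh Ω 𝒯 k) γ →
          ∀ σ ∈ OseenFEM.H0h Ω 𝒯 k F, ∀ u ∈ OseenFEM.Qh Ω 𝒯 k,
            ∃ τ ∈ OseenFEM.H0h Ω 𝒯 k F, ∃ v ∈ OseenFEM.Qh Ω 𝒯 k,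
              OseenFEM.tripleNorm τ v ≤ C c₁ ν γ * OseenFEM.tripleNorm σ u ∧
              (OseenFEM.formB ν σ u τ v).im = 0 ∧
              OseenFEM.tripleNorm σ u ^ 2 ≤ OseenFEM.CJ c₁ ν γ * (OseenFEM.formB ν σ u τ v).re := by
  refine ⟨OseenFEM.stabBound, fun c₁ ν γ h1 h2 h3 => OseenFEM.stabBound_pos h1 h2 h3,
    fun n hn Ω hΩ 𝒯 h𝒯 k F => ?_⟩
  have hn0 : n ≠ 0 := by omega
  refine ⟨OseenFEM.exists_devDivBound hn0 hΩ h𝒯 k F, ?_,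
    fun c₁ ν γ hc₁ hν hγ hdev hinf σ hσ u hu =>
      OseenFEM.exists_test hn0 hΩ h𝒯 hc₁ hν hγ hdev hinf hσ hu⟩
  -- Writing the dimension as m + 1 allows Fubini to single out one coordinate of the reference
  -- simplex.
  obtain ⟨m, rfl⟩ := Nat.exists_eq_succ_of_ne_zero hn0
  exact OseenFEM.exists_infSup hΩ h𝒯 k F
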